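/- Let $\Bbbk$ be a commutative ring and $n\ge 0$. Write $\underline{r}=\{1<\dots<r\}$. A pruned tree with $n$ levels is a sequence of nondecreasing surjections $\underline{\tau}=\{\underline{t}_0\xrightarrow{\tau_1}\underline{t}_1\xrightarrow{\tau_2}\cdots\xrightarrow{\tau_n}\underline{t}_n=\underline{1}\}$. A morphism $u:\underline{\tau}\to\underline{\sigma}$ is a sequence of surjections $u:\underline{t}_i\to\underline{s}_i$, $0\le i\le n$, commuting with the structure maps and nondecreasing on each fibre $\tau_{i+1}^{-1}(x)\subset\underline{t}_i$. These form the category $\Omega_n^{epi}$. Put $\deg\underline{\tau}=t_0+\dots+t_{n-1}$ and $\deg u=\deg\underline{\tau}-\deg\underline{\sigma}$. *Bar construction.* $B(\Omega_n^{epi})(\underline{\tau},\underline{\sigma})$ is the chain complex of $\Bbbk$-modules that is free in degree $d$ on the $d$-tuples of composable morphisms $\{\underline{\sigma}=\underline{\tau}_0\xleftarrow{u_1}\cdots\xleftarrow{u_d}\underline{\tau}_d=\underline{\tau}\}$ none of which is an identity, with $$\partial\{u_1,\dots,u_d\}=\sum_{i=1}^{d-1}(-1)^i\{u_1,\dots,u_iu_{i+1},\dots,u_d\}.$$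 *Koszul construction.* $K(\Omega_n^{epi})(\underline{\tau},\underline{\sigma})$ is the chain complex with zero differential that is free in degree $d$ on generators $\{u\}$, for the morphisms $u:\underline{\tau}\to\underline{\sigma}$ of degree $d$. *Signs.* Assign to each vertex of level $<n$ of a tree a symbol of degree $1$, and order these symbols by running through the planar tree from the root upwards and from left to right (each vertex before the vertices above it; an entire branch before the branches to its right). A morphism $u$ of degree $1$ merges exactly one pair of vertices $a,b$, with $a$ before $b$. Starting with the tensor of the symbols of $\underline{\tau}$ in order, move $a,b$ to the first two places, replace them by the merged symbol of degree $1$, and reorder the result into the order of $\underline{\sigma}$; $\operatorname{sgn}(u)=\pm1$ is the product of the Koszul signs of these two permutations of symbols of degree $1$. **Theorem.** For all pruned trees $\underline{\tau},\underline{\sigma}$ with $n$ levels, the $\Bbbk$-linear map determined by $$\iota\{u\}=\sum_{\substack{u=u_1\cdots u_d\\ \deg u_1=\dots=\deg u_d=1}}\operatorname{sgn}(u_1)\cdots\operatorname{sgn}(u_d)\,\{\underline{\tau}_0\xleftarrow{u_1}\cdots\xleftarrow{u_d}\underline{\tau}_d\}$$ (the sum being over all decompositions of $u$ into morphisms of degree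 $1$) is a morphism of chain complexes $$\iota:K(\Omega_n^{epi})(\underline{\tau},\underline{\sigma})\to B(\Omega_n^{epi})(\underline{\tau},\underline{\sigma})$$ and a quasi-isomorphism. Consequently, for every $d$, $H_d\bigl(B(\Omega_n^{epi})(\underline{\tau},\underline{\sigma})\bigr)$ is isomorphic to the free $\Bbbk$-module on the morphisms $\underline{\tau}\to\underline{\sigma}$ of degree $d$; in particular it vanishes for $d\ne\deg\underline{\tau}-\deg\underline{\sigma}$. -/

import Mathlib

open CategoryTheory

universe w

/-- A pruned planar tree with `n` levels: a sequence of nondecreasing surjections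
`{1 < ⋯ < t₀} → {1 < ⋯ < t₁} → ⋯ → {1 < ⋯ < tₙ}` with `tₙ = 1`. The finite ordinal with `r` elements
is `Fin r`, `size i` is the number `tᵢ` of vertices of level `i`, and `edge i` is the map from the
vertices of level `i` to those of level `i + 1`. -/
structure PrunedTree (n : ℕ) : Type where
  size : Fin (n + 1) → ℕ
  edge : ∀ i : Fin n, Fin (size i.castSucc) → Fin (size i.succ)
  edge_monotone : ∀ i, Monotone (edge i)
  edge_surjective : ∀ i, Function.Surjective (edge i)
  size_last : size (Fin.last n) = 1

namespace PrunedTree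

variable {n : ℕ}

/-- A morphism of pruned trees: levelwise surjections, commuting with the edge maps, and
nondecreasing on each fibre of each edge map of the source. -/
@[ext]
structure Hom (τ σ : PrunedTree n) : Type where
  app : ∀ i : Fin (n + 1), Fin (τ.size i) → Fin (σ.size i)
  surjective : ∀ i, Function.Surjective (app i)
  comm : ∀ (i : Fin n) (x : Fin (τ.size i.castSucc)),
    σ.edge i (app i.castSucc x) = app i.succ (τ.edge i x)
  monotone_fibre : ∀ (i : Fin n) (x y : Fin (τ.size i.castSucc)),
    τ.edge i x = τ.edge i y → x ≤ y → app i.castSucc x ≤ app i.castSucc y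

/-- The category of pruned trees with `n` levels. -/
instance : Category (PrunedTree n) where
  Hom := Hom
  id τ :=
    { app := fun _ x => x
      surjective := fun _ => Function.surjective_id
      comm := fun _ _ => rfl
      monotone_fibre := fun _ _ _ _ h => h }
  comp u v :=
    { app := fun i x => v.app i (u.app i x)
      surjective := fun i => (v.surjective i).comp (u.surjective i)
      comm := fun i x => by rw [v.comm, u.comm]
      monotone_fibre := fun i x y h hxy =>
        v.monotone_fibre i _ _ (by rw [u.comm, u.comm, h]) (u.monotone_fibre i x y h hxy) }

/-- The degree `t₀ + ⋯ + tₙ₋₁` of a pruned tree. -/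
def deg (τ : PrunedTree n) : ℕ := ∑ i : Fin n, τ.size i.castSucc

/-- The morphism `u : τ ⟶ σ` has degree `d`, that is, `deg τ - deg σ = d`. -/
def HasDegree {τ σ : PrunedTree n} (_ : τ ⟶ σ) (d : ℕ) : Prop := τ.deg = σ.deg + d

/-! ### The planar order on the vertices and the sign of a morphism of degree one -/

/-- The vertices of level `< n`. -/
abbrev Vertex (τ : PrunedTree n) : Type := Σ i : Fin n, Fin (τ.size i.castSucc)

/-- The map from the vertices of level `i` to those of level `i + k`, the composite of `k`
successive edge maps. -/
def ancestor (τ : PrunedTree n) (i : ℕ) : ∀ (k : ℕ) (h : i + k < n + 1),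
    Fin (τ.size ⟨i, by omega⟩) → Fin (τ.size ⟨i + k, h⟩)
  | 0, _, x => x
  | k + 1, h, x => τ.edge ⟨i + k, by omega⟩ (ancestor τ i k (by omega) x)

/-- The ancestor at level `j ≥ i` of a vertex of level `i`, as a number. -/
def ancestorAt (τ : PrunedTree n) (v : τ.Vertex) (j : Fin n) (h : v.1 ≤ j) : ℕ :=
  (τ.ancestor v.1 (j - v.1) (by omega) v.2 : ℕ)

/-- `τ.Before v w`: the vertex `v` strictly precedes the vertex `w` when the tree is run through
from the root upwards and from left to right. (The root has level
`n` and the leaves have level `0`.) If `w` is on the level of `v` or further from the root, this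
means that `v` is an ancestor of `w` or lies to the left of the ancestor of `w` on the level of `v`;
if `v` is further from the root than `w`, it means that the ancestor of `v` on the level of `w`
lies strictly to the left of `w`. -/
def Before (τ : PrunedTree n) (v w : τ.Vertex) : Prop :=
  v ≠ w ∧
    ((∃ h : w.1 ≤ v.1, (v.2 : ℕ) ≤ τ.ancestorAt w v.1 h) ∨
      (∃ h : v.1 < w.1, τ.ancestorAt v w.1 h.le < (w.2 : ℕ)))

/-- The action of a morphism on the vertices of level `< n`. -/
def onVertex {τ σ : PrunedTree n} (u : τ ⟶ σ) (v : τ.Vertex) : σ.Vertex :=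
  ⟨v.1, Hom.app u v.1.castSucc v.2⟩

open Classical in
/-- The number of transpositions of symbols of degree one that are needed to bring the two symbols
`a`, `b` (with `a` before `b`) to the first two places of the tensor of the vertices of `τ`:
`a` passes all the vertices before it, then `b` passes all the vertices before it except `a`. -/
noncomputable def gatherCount (τ : PrunedTree n) (a b : τ.Vertex) : ℕ :=
  (Finset.univ.filter fun z => τ.Before z a).card +
    (Finset.univ.filter fun z => τ.Before z b ∧ z ≠ a).card

open Classical in
/-- The number of inversions of the permutation that brings the tensor formed by the merged vertex
`u a = u b` followed by the other vertices, in the order of `τ`, into the order of `σ`. -/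
noncomputable def reorderCount {τ σ : PrunedTree n} (u : τ ⟶ σ) (a b : τ.Vertex) : ℕ :=
  (Finset.univ.filter fun z : τ.Vertex =>
      z ≠ a ∧ z ≠ b ∧ σ.Before (onVertex u z) (onVertex u a)).card +
    (Finset.univ.filter fun p : τ.Vertex × τ.Vertex =>
      (p.1 ≠ a ∧ p.1 ≠ b) ∧ (p.2 ≠ a ∧ p.2 ≠ b) ∧
        τ.Before p.1 p.2 ∧ σ.Before (onVertex u p.2) (onVertex u p.1)).card

open Classical in
/-- The sign of a morphism `u` of degree one: the sign of the two permutations of symbols of degree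
one above. A morphism of degree one merges exactly one pair of vertices `a`, `b` with `a` before
`b`, so that the product has exactly one factor. (The definition is only used in degree one.) -/
noncomputable def sgn {τ σ : PrunedTree n} (u : τ ⟶ σ) : ℤ :=
  ∏ p ∈ Finset.univ.filter (fun p : τ.Vertex × τ.Vertex =>
      τ.Before p.1 p.2 ∧ onVertex u p.1 = onVertex u p.2),
    (-1) ^ (gatherCount τ p.1 p.2 + reorderCount u p.1 p.2)

/-! ### Identities -/

/-- The morphism `u` is an identity. -/
def IsIdentity {τ σ : PrunedTree n} (u : τ ⟶ σ) : Prop := ∃ h : τ = σ, u = eqToHom h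

theorem size_le {τ σ : PrunedTree n} (u : τ ⟶ σ) (i : Fin (n + 1)) : σ.size i ≤ τ.size i := by
  simpa using Fintype.card_le_of_surjective _ (Hom.surjective u i)

theorem strictMono_eq_id {m : ℕ} {f : Fin m → Fin m} (hf : StrictMono f) : f = id := by
  have h : Set.range f = Set.range (id : Fin m → Fin m) := by
    rw [(Finite.surjective_of_injective hf.injective).range_eq, Set.range_id]
  exact (StrictMono.range_inj hf strictMono_id).mp h

theorem isIdentity_of_size_eq {τ σ : PrunedTree n} (u : τ ⟶ σ)
    (h : ∀ i, τ.size i = σ.size i) : IsIdentity u := by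
  obtain ⟨t, e, em, es, el⟩ := τ
  obtain ⟨s, f, fm, fs, fl⟩ := σ
  obtain rfl : t = s := funext h
  have inj : ∀ i, Function.Injective (Hom.app u i) := fun i =>
    Finite.injective_iff_surjective.mpr (Hom.surjective u i)
  have key : ∀ i, Hom.app u i = id := by
    intro i
    induction i using Fin.reverseInduction with
    | last =>
      funext x
      have : Subsingleton (Fin (t (Fin.last n))) := by
        have h1 : t (Fin.last n) = 1 := el
        rw [h1]; infer_instance
      exact Subsingleton.elim (α := Fin (t (Fin.last n))) _ _
    | cast i ih =>
      apply strictMono_eq_id (m := t i.castSucc)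
      intro x y hxy
      have hx := Hom.comm u i x
      have hy := Hom.comm u i y
      rw [ih] at hx hy
      rcases (em i hxy.le).lt_or_eq with hlt | heq
      · by_contra hcon
        have h2 := fm i (not_lt.mp hcon)
        have h3 : f i (Hom.app u i.castSucc y) = e i y := hy
        have h4 : f i (Hom.app u i.castSucc x) = e i x := hx
        rw [h3, h4] at h2
        exact absurd hlt (not_lt.mpr h2)
      · exact lt_of_le_of_ne (Hom.monotone_fibre u i x y heq hxy.le)
          fun hc => hxy.ne (inj _ hc)
  obtain rfl : e = f := by
    funext i x
    have hx := Hom.comm u i x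
    rw [key, key] at hx
    exact hx.symm
  refine ⟨rfl, ?_⟩
  apply Hom.ext
  funext i
  exact key i

/-- A composite of two morphisms is an identity only if its second factor is. -/
theorem not_isIdentity_comp {τ θ σ : PrunedTree n} (v : τ ⟶ θ) (u : θ ⟶ σ)
    (hu : ¬ IsIdentity u) : ¬ IsIdentity (v ≫ u) := by
  rintro ⟨rfl, -⟩
  exact hu (isIdentity_of_size_eq u fun i => le_antisymm (size_le v i) (size_le u i))

/-! ### The reduced normalized bar construction -/

/-- `BarChain d τ σ` is the set of `d`-tuples of composable morphisms
`σ = τ₀ ⟵ τ₁ ⟵ ⋯ ⟵ τ_d = τ`, none of which is an identity. In `cons u hu c`, the morphism `u` is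
`u₁ : τ₁ ⟶ τ₀` and `c` is the tuple of the remaining ones. -/
inductive BarChain : ℕ → PrunedTree n → PrunedTree n → Type
  | nil (τ : PrunedTree n) : BarChain 0 τ τ
  | cons {d : ℕ} {τ θ σ : PrunedTree n} (u : θ ⟶ σ) (hu : ¬ IsIdentity u)
      (c : BarChain d τ θ) : BarChain (d + 1) τ σ

namespace BarChain

/-- The composite `u₁ ⋯ u_d : τ ⟶ σ`. -/
def comp : ∀ {d : ℕ} {τ σ : PrunedTree n}, BarChain d τ σ → (τ ⟶ σ)
  | _, _, _, nil τ => 𝟙 τ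
  | _, _, _, cons u _ c => c.comp ≫ u

/-- All the morphisms `uᵢ` have degree one. -/
def AllDegreeOne : ∀ {d : ℕ} {τ σ : PrunedTree n}, BarChain d τ σ → Prop
  | _, _, _, nil _ => True
  | _, _, _, cons u _ c => HasDegree u 1 ∧ c.AllDegreeOne

/-- The product `sgn u₁ ⋯ sgn u_d`. -/
noncomputable def sgn : ∀ {d : ℕ} {τ σ : PrunedTree n}, BarChain d τ σ → ℤ
  | _, _, _, nil _ => 1
  | _, _, _, cons u _ c => PrunedTree.sgn u * c.sgn

/-- The tuple obtained by replacing `u_{i+1}`, `u_{i+2}` by their composite. -/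
def face : ∀ {d : ℕ} {τ σ : PrunedTree n}, Fin (d + 1) → BarChain (d + 2) τ σ →
    BarChain (d + 1) τ σ
  | _, _, _, ⟨0, _⟩, cons u hu (cons v _ c) => cons (v ≫ u) (not_isIdentity_comp v u hu) c
  | d + 1, _, _, ⟨i + 1, h⟩, cons u hu c => cons u hu (face ⟨i, by omega⟩ c)

theorem face_face : ∀ {d : ℕ} {τ σ : PrunedTree n} (i : Fin (d + 2)) (j : Fin (d + 1))
    (_ : (i : ℕ) ≤ j) (c : BarChain (d + 3) τ σ),
    face j (face i c) = face ⟨i, by omega⟩ (face j.succ c)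
  | d, _, _, ⟨0, _⟩, ⟨0, _⟩, _, cons u hu (cons v hv (cons w hw c)) => by
    have key : cons (w ≫ v ≫ u) (not_isIdentity_comp w _ (not_isIdentity_comp v u hu)) c =
        cons ((w ≫ v) ≫ u) (not_isIdentity_comp (w ≫ v) u hu) c := by
      congr 1
    cases d <;> exact key
  | d + 1, _, _, ⟨0, _⟩, ⟨j + 1, _⟩, _, cons u hu (cons v hv (cons w hw c)) => rfl
  | 0, _, _, ⟨0, _⟩, ⟨j + 1, h⟩, _, _ => absurd h (by omega)
  | _, _, _, ⟨i + 1, _⟩, ⟨0, _⟩, h, _ => absurd h (by simp)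
  | 0, _, _, ⟨i + 1, _⟩, ⟨j + 1, h⟩, _, _ => absurd h (by omega)
  | d + 1, _, _, ⟨i + 1, _⟩, ⟨j + 1, _⟩, h, cons u hu c => by
    have := face_face (⟨i, by omega⟩ : Fin (d + 2)) (⟨j, by omega⟩ : Fin (d + 1))
      (by simpa using h) c
    simp only [face, Fin.succ] at this ⊢
    rw [this]

/-- The trees with bounded level sizes, such as those that receive a morphism from a given tree, form
a finite set. -/
theorem finite_bounded (s : Fin (n + 1) → ℕ) :
    Finite {θ : PrunedTree n // ∀ i, θ.size i ≤ s i} := by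
  let F : {θ : PrunedTree n // ∀ i, θ.size i ≤ s i} →
      Σ r : (∀ i, Fin (s i + 1)), ∀ i : Fin n, Fin (r i.castSucc) → Fin (r i.succ) :=
    fun θ => ⟨fun i => ⟨θ.1.size i, Nat.lt_succ_of_le (θ.2 i)⟩, θ.1.edge⟩
  refine Finite.of_injective F ?_
  rintro ⟨⟨r, e, em, es, el⟩, hr⟩ ⟨⟨r', e', em', es', el'⟩, hr'⟩ h
  have h1 := congrArg Sigma.fst h
  obtain rfl : r = r' := by
    funext i
    exact congrArg Fin.val (congrFun h1 i)
  have h2 := eq_of_heq (Sigma.mk.inj h).2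
  obtain rfl : e = e' := h2
  rfl

instance finite_hom (τ σ : PrunedTree n) : Finite (τ ⟶ σ) :=
  Finite.of_injective (fun u : τ ⟶ σ => Hom.app u) fun _ _ h => Hom.ext h

instance finite_barChain : ∀ (d : ℕ) (τ σ : PrunedTree n), Finite (BarChain d τ σ)
  | 0, τ, σ => by
    have : Subsingleton (BarChain 0 τ σ) := ⟨by rintro ⟨⟩ ⟨⟩; rfl⟩
    infer_instance
  | d + 1, τ, σ => by
    have := finite_barChain d τ
    have := finite_bounded τ.size
    let F : BarChain (d + 1) τ σ →
        Σ θ : {θ : PrunedTree n // ∀ i, θ.size i ≤ τ.size i}, (θ.1 ⟶ σ) × BarChain d τ θ.1 :=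
      fun c => match c with
        | cons (θ := θ) u _ c => ⟨⟨θ, size_le c.comp⟩, u, c⟩
    refine Finite.of_injective F ?_
    rintro (_ | ⟨u, hu, c⟩) (_ | ⟨u', hu', c'⟩) h
    simp only [F, Sigma.mk.injEq, Subtype.mk.injEq] at h
    obtain ⟨rfl, h⟩ := h
    obtain ⟨rfl, rfl⟩ := Prod.mk.inj (eq_of_heq h)
    rfl

noncomputable instance (d : ℕ) (τ σ : PrunedTree n) : Fintype (BarChain d τ σ) :=
  Fintype.ofFinite _

end BarChain

section Complexes

variable (k : Type w) [CommRing k] (τ σ : PrunedTree n)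

/-- The differential of the bar construction,
`∂{u₁, …, u_d} = ∑_{i = 1}^{d - 1} (-1)^i {u₁, …, u_i u_{i+1}, …, u_d}`,
from degree `d + 1` to degree `d`; the index `i` of the sum below is `i - 1` in this formula. -/
noncomputable def barDifferential :
    ∀ d : ℕ, (BarChain (d + 1) τ σ →₀ k) →ₗ[k] (BarChain d τ σ →₀ k)
  | 0 => 0
  | d + 1 => ∑ i : Fin (d + 1), (-1 : k) ^ ((i : ℕ) + 1) • Finsupp.lmapDomain k k (BarChain.face i)

theorem barDifferential_comp (d : ℕ) :
    barDifferential k τ σ d ∘ₗ barDifferential k τ σ (d + 1) = 0 := by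
  cases d with
  | zero => simp [barDifferential]
  | succ d =>
    apply Finsupp.lhom_ext'
    intro c
    apply LinearMap.ext_ring
    simp only [barDifferential, LinearMap.comp_apply, LinearMap.sum_apply, LinearMap.smul_apply,
      Finsupp.lsingle_apply, Finsupp.lmapDomain_apply, Finsupp.mapDomain_single, map_sum, map_smul,
      LinearMap.zero_apply, Finset.smul_sum, smul_smul, ← pow_add]
    rw [← Fintype.sum_prod_type' (fun (i : Fin (d + 2)) (j : Fin (d + 1)) =>
      (-1 : k) ^ ((i : ℕ) + 1 + ((j : ℕ) + 1)) •
        Finsupp.single (BarChain.face j (BarChain.face i c)) (1 : k))]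
    refine Finset.sum_involution (fun p _ =>
      if h : (p.1 : ℕ) ≤ p.2 then (p.2.succ, ⟨p.1, by omega⟩)
      else (p.2.castSucc, ⟨(p.1 : ℕ) - 1, by omega⟩)) ?_ ?_ ?_ ?_
    · rintro ⟨i, j⟩ -
      by_cases h : (i : ℕ) ≤ j
      · simp only [h, dite_true]
        rw [BarChain.face_face i j h]
        simp only [Fin.val_succ, ← add_smul]
        convert zero_smul k _ using 2
        ring
      · simp only [h, dite_false]
        obtain ⟨i, hi⟩ := i
        obtain ⟨j, hj⟩ := j
        simp only [not_le] at h
        obtain ⟨m, rfl⟩ : ∃ m, i = m + 1 := ⟨i - 1, by omega⟩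
        have := BarChain.face_face (⟨j, by omega⟩ : Fin (d + 2)) (⟨m, by omega⟩ : Fin (d + 1))
          (by simp; omega) c
        simp only [Fin.succ_mk] at this
        rw [← this]
        simp only [Fin.castSucc_mk, Nat.add_sub_cancel, ← add_smul]
        convert zero_smul k _ using 2
        ring
    · rintro ⟨i, j⟩ - - h
      by_cases hij : (i : ℕ) ≤ j
      · simp only [hij, dite_true, Prod.mk.injEq, Fin.ext_iff, Fin.val_succ] at h
        omega
      · simp only [hij, dite_false, Prod.mk.injEq, Fin.ext_iff, Fin.val_castSucc] at h
        omega
    · intro p _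
      simp
    · rintro ⟨i, j⟩ -
      by_cases hij : (i : ℕ) ≤ j
      · have : ¬ ((j : ℕ) + 1 ≤ i) := by omega
        simp [hij, this]
      · have : ((j : ℕ) ≤ (i : ℕ) - 1) := by omega
        have h2 : (i : ℕ) - 1 + 1 = i := by omega
        simp [hij, this, h2]

/-- The reduced normalized bar construction `B(Ω_n^epi)(τ, σ)`: in degree `d`, the free module on
the `d`-tuples of composable non-identity morphisms from `τ` to `σ`. -/
noncomputable def barComplex : ChainComplex (ModuleCat.{w} k) ℕ :=
  ChainComplex.of (fun d => ModuleCat.of k (BarChain d τ σ →₀ k))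
    (fun d => ModuleCat.ofHom (barDifferential k τ σ d))
    (fun d => by
      rw [← ModuleCat.ofHom_comp, barDifferential_comp]
      rfl)

/-- The Koszul construction `K(Ω_n^epi)(τ, σ)`: in degree `d`, the free module on the morphisms
`τ ⟶ σ` of degree `d`, with the zero differential. -/
noncomputable def koszulComplex : ChainComplex (ModuleCat.{w} k) ℕ :=
  ChainComplex.of (fun d => ModuleCat.of k ({u : τ ⟶ σ // HasDegree u d} →₀ k))
    (fun _ => 0) (fun _ => by simp)

open Classical in
/-- The component in degree `d` of the map `ι`, which sends the generator `{u}` to the sum, over the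
decompositions `u = u₁ ⋯ u_d` of `u` into morphisms of degree one, of
`sgn u₁ ⋯ sgn u_d {u₁, …, u_d}`. -/
noncomputable def koszulToBar (d : ℕ) :
    ({u : τ ⟶ σ // HasDegree u d} →₀ k) →ₗ[k] (BarChain d τ σ →₀ k) :=
  Finsupp.linearCombination k fun u =>
    ∑ c ∈ Finset.univ.filter (fun c : BarChain d τ σ => c.AllDegreeOne ∧ c.comp = u.1),
      Finsupp.single c ((c.sgn : ℤ) : k)

end Complexes

end PrunedTree

namespace PrunedTree

variable {n : ℕ}

/-! ### Morphisms of pruned trees -/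

section Basic

variable {τ θ σ ρ : PrunedTree n}

/-! The argument is a Koszul criterion. Tuples in the bar construction are sorted by their first
morphism `u₁ : τ₁ ⟶ σ`. Up to terms that raise the degree of `τ₁`, the differential acts on the rest
of the tuple as in the bar construction from `τ` to `τ₁` (`component_barDifferential`), which by
induction on the length may be replaced by the Koszul construction. What remains is a complex on
composable pairs `τ ⟶ θ ⟶ σ`, whose differential splits a morphism of degree one off the first
factor and composes it into the second. Once this complex is exact for `σ.deg < τ.deg`
(`koszulDifferential_exact`), injectivity of `ι` (`eq_zero_of_koszulToBar_eq_zero`) and the fact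
that every cycle is a boundary plus an element of the image of `ι` (`exists_eq_of_isCycle`) follow
by induction on the degree.

The differential on pairs preserves the composite `u`, so the complex is a direct sum of complexes
spanned by the factorisations of a fixed `u`. A factorisation amounts to a compatible family of
total preorders on the levels of `τ` (`exists_factorisation`, `eq_of_forall_le_iff`). In this form
the factorisations carry an acyclic matching in the sense of discrete Morse theory
(`exists_matching`): each factorisation singles out a key vertex, which is either alone in its class
and gets merged with the next class, or shares its class and gets split off to the front of it.
Levels nearer to the leaves than the key follow a forced lexicographic order. The matched
coefficients are signs, hence units, and triangular elimination (`exists_preimage_of_matching`)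
gives exactness over any `k`.

That the differential squares to zero is a statement about morphisms of degree two: the matching
shows that there are exactly two factorisations into morphisms of degree one, and the products of
their signs are opposite (`sgn_mul_sgn_eq_neg`). Indeed such a product is the sign of the
permutation that puts two vertices first and the others in the order of the target, and the two
permutations differ by a transposition. -/

theorem comp_app (u : τ ⟶ θ) (v : θ ⟶ σ) (i : Fin (n + 1)) (x : Fin (τ.size i)) :
    Hom.app (u ≫ v) i x = Hom.app v i (Hom.app u i x) := rfl

theorem hom_ext {u v : τ ⟶ σ} (h : ∀ i x, Hom.app u i x = Hom.app v i x) : u = v :=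
  Hom.ext (funext fun i => funext fun x => h i x)

instance epi_hom (u : τ ⟶ θ) : Epi u where
  left_cancellation v w h := hom_ext fun i x => by
    obtain ⟨y, rfl⟩ := Hom.surjective u i x
    rw [← comp_app, h, comp_app]

theorem subsingleton_last (τ : PrunedTree n) : Subsingleton (Fin (τ.size (Fin.last n))) := by
  rw [τ.size_last]; infer_instance

theorem deg_le (u : τ ⟶ σ) : σ.deg ≤ τ.deg := Finset.sum_le_sum fun i _ => size_le u i.castSucc

theorem size_eq_of_deg_eq (u : τ ⟶ σ) (h : τ.deg = σ.deg) (i : Fin (n + 1)) :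
    τ.size i = σ.size i := by
  induction i using Fin.lastCases with
  | last => rw [τ.size_last, σ.size_last]
  | cast i =>
    exact (((Finset.sum_eq_sum_iff_of_le fun i _ => size_le u i.castSucc).mp h.symm) i
      (Finset.mem_univ i)).symm

theorem isIdentity_iff (u : τ ⟶ σ) : IsIdentity u ↔ τ.deg = σ.deg := by
  refine ⟨?_, fun h => isIdentity_of_size_eq u (size_eq_of_deg_eq u h)⟩
  rintro ⟨rfl, -⟩
  rfl

/-- Vertices with the same image under `β` have parents with the same image, so the hypothesis
applies in both directions and makes `w` constant on the fibres of `β`. For the quotient map it is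
then exactly monotonicity on fibres. -/
theorem exists_desc (β : τ ⟶ θ) (w : τ ⟶ ρ)
    (h : ∀ (i : Fin n) (a b : Fin (τ.size i.castSucc)), Hom.app β _ a ≤ Hom.app β _ b →
      Hom.app β _ (τ.edge i a) = Hom.app β _ (τ.edge i b) → Hom.app w _ a ≤ Hom.app w _ b) :
    ∃ γ : θ ⟶ ρ, β ≫ γ = w := by
  have key : ∀ (k : Fin (n + 1)) (a b : Fin (τ.size k)), Hom.app β _ a = Hom.app β _ b →
      Hom.app w _ a = Hom.app w _ b := by
    intro k
    induction k using Fin.lastCases with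
    | last => exact fun a b _ => (subsingleton_last ρ).elim _ _
    | cast i =>
      intro a b hab
      have hp : Hom.app β _ (τ.edge i a) = Hom.app β _ (τ.edge i b) := by
        rw [← Hom.comm, ← Hom.comm, hab]
      exact le_antisymm (h i a b hab.le hp) (h i b a hab.ge hp.symm)
  let g : ∀ k, Fin (θ.size k) → Fin (ρ.size k) := fun k c =>
    Hom.app w k (Function.surjInv (Hom.surjective β k) c)
  have hg : ∀ k a, g k (Hom.app β k a) = Hom.app w k a := fun k a =>
    key k _ _ (Function.surjInv_eq (Hom.surjective β k) _)
  refine ⟨⟨g, ?_, ?_, ?_⟩, hom_ext hg⟩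
  · intro k y
    obtain ⟨a, rfl⟩ := Hom.surjective w k y
    exact ⟨_, hg k a⟩
  · intro i x
    obtain ⟨a, rfl⟩ := Hom.surjective β _ x
    rw [hg, Hom.comm, Hom.comm, hg]
  · intro i x y hxy hle
    obtain ⟨a, rfl⟩ := Hom.surjective β _ x
    obtain ⟨b, rfl⟩ := Hom.surjective β _ y
    rw [hg, hg]
    rw [Hom.comm, Hom.comm] at hxy
    exact h i a b hle hxy

/-- Each element is ranked by the number of elements strictly below it, and the ranks that occur are
renumbered increasingly. -/
theorem exists_rank {t : ℕ} (r : Fin t → Fin t → Prop) (total : ∀ a b, r a b ∨ r b a)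
    (trans : ∀ a b c, r a b → r b c → r a c) :
    ∃ (m : ℕ) (f : Fin t → Fin m), Function.Surjective f ∧ ∀ a b, f a ≤ f b ↔ r a b := by
  classical
  let g : Fin t → ℕ := fun a => (Finset.univ.filter fun b => ¬ r a b).card
  have hg : ∀ a b, g a ≤ g b ↔ r a b := by
    intro a b
    constructor
    · intro h
      by_contra hab
      have hba := (total a b).resolve_left hab
      refine absurd h (not_le.mpr (Finset.card_lt_card ?_))
      refine Finset.ssubset_iff_subset_ne.mpr ⟨fun c hc => ?_, fun heq => ?_⟩
      · simp only [Finset.mem_filter, Finset.mem_univ, true_and] at hc ⊢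
        exact fun hac => hc (trans b a c hba hac)
      · have : b ∈ Finset.univ.filter fun c => ¬ r b c := by rw [heq]; simpa using hab
        simp only [Finset.mem_filter, Finset.mem_univ, true_and] at this
        exact this ((total b b).elim id id)
    · intro h
      refine Finset.card_le_card fun c hc => ?_
      simp only [Finset.mem_filter, Finset.mem_univ, true_and] at hc ⊢
      exact fun hbc => hc (trans a b c h hbc)
  let e := (Finset.univ.image g).orderIsoOfFin rfl
  refine ⟨_, fun a => e.symm ⟨g a, Finset.mem_image_of_mem g (Finset.mem_univ a)⟩, ?_, ?_⟩
  · intro c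
    obtain ⟨a, -, ha⟩ := Finset.mem_image.mp (e c).2
    refine ⟨a, ?_⟩
    rw [OrderIso.symm_apply_eq]
    exact Subtype.ext ha
  · intro a b
    rw [e.symm.le_iff_le, Subtype.mk_le_mk, hg]

/-- A compatible family of total preorders on the levels of `τ` comes from a factorisation. -/
theorem exists_factorisation (u : τ ⟶ σ)
    (L : ∀ k : Fin (n + 1), Fin (τ.size k) → Fin (τ.size k) → Prop)
    (total : ∀ k a b, L k a b ∨ L k b a) (trans : ∀ k a b c, L k a b → L k b c → L k a c)
    (edge : ∀ (i : Fin n) a b, L i.castSucc a b → L i.succ (τ.edge i a) (τ.edge i b))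
    (fibre : ∀ (i : Fin n) a b, τ.edge i a = τ.edge i b → a ≤ b → L i.castSucc a b)
    (target : ∀ (i : Fin n) a b, L i.castSucc a b → L i.succ (τ.edge i b) (τ.edge i a) →
      Hom.app u _ a ≤ Hom.app u _ b) :
    ∃ x : Factorisation u, ∀ k a b, Hom.app x.ι k a ≤ Hom.app x.ι k b ↔ L k a b := by
  choose m f hf hL using fun k => exists_rank (L k) (total k) (trans k)
  let p : ∀ i : Fin n, Fin (m i.castSucc) → Fin (m i.succ) := fun i c =>
    f i.succ (τ.edge i (Function.surjInv (hf i.castSucc) c))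
  have hp : ∀ (i : Fin n) a, p i (f i.castSucc a) = f i.succ (τ.edge i a) := by
    intro i a
    have h : f i.castSucc (Function.surjInv (hf i.castSucc) (f i.castSucc a)) = f i.castSucc a :=
      Function.surjInv_eq (hf i.castSucc) _
    exact le_antisymm ((hL _ _ _).mpr (edge i _ _ ((hL _ _ _).mp h.le)))
      ((hL _ _ _).mpr (edge i _ _ ((hL _ _ _).mp h.ge)))
  let θ : PrunedTree n :=
    { size := m
      edge := p
      edge_monotone := by
        intro i c c' hc
        obtain ⟨a, rfl⟩ := hf _ c
        obtain ⟨b, rfl⟩ := hf _ c'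
        rw [hp, hp, hL]
        exact edge i a b ((hL _ _ _).mp hc)
      edge_surjective := by
        intro i c
        obtain ⟨a, rfl⟩ := hf _ c
        obtain ⟨b, rfl⟩ := τ.edge_surjective i a
        exact ⟨f _ b, hp i b⟩
      size_last := by
        have h1 : m (Fin.last n) ≤ 1 := by
          have := Fintype.card_le_of_surjective _ (hf (Fin.last n))
          simpa [τ.size_last] using this
        have h2 : 0 < m (Fin.last n) :=
          Fin.pos (f (Fin.last n) ⟨0, by rw [τ.size_last]; exact one_pos⟩)
        omega }
  let β : τ ⟶ θ :=
    { app := f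
      surjective := hf
      comm := fun i x => hp i x
      monotone_fibre := fun i x y h hxy => (hL _ _ _).mpr (fibre i x y h hxy) }
  obtain ⟨γ, hγ⟩ := exists_desc β u (fun i a b h1 h2 =>
    target i a b ((hL _ _ _).mp h1) ((hL _ _ _).mp (le_of_eq h2.symm)))
  exact ⟨⟨θ, β, γ, hγ⟩, fun k a b => hL k a b⟩

end Basic

/-! ### Factorisations of a morphism -/

section Factorisations

variable {τ σ : PrunedTree n} {u : τ ⟶ σ}

theorem factorisation_edge (x : Factorisation u) (i : Fin n) {a b : Fin (τ.size i.castSucc)}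
    (h : Hom.app x.ι _ a ≤ Hom.app x.ι _ b) :
    Hom.app x.ι _ (τ.edge i a) ≤ Hom.app x.ι _ (τ.edge i b) := by
  rw [← Hom.comm, ← Hom.comm]
  exact x.mid.edge_monotone i h

theorem factorisation_edge_eq (x : Factorisation u) (i : Fin n) {a b : Fin (τ.size i.castSucc)}
    (h : Hom.app x.ι _ a = Hom.app x.ι _ b) :
    Hom.app x.ι _ (τ.edge i a) = Hom.app x.ι _ (τ.edge i b) := by
  rw [← Hom.comm, ← Hom.comm, h]

theorem factorisation_app (x : Factorisation u) (k : Fin (n + 1)) (a : Fin (τ.size k)) :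
    Hom.app x.π k (Hom.app x.ι k a) = Hom.app u k a := by
  rw [← comp_app, x.ι_π]

theorem factorisation_target (x : Factorisation u) (i : Fin n) {a b : Fin (τ.size i.castSucc)}
    (h : Hom.app x.ι _ a ≤ Hom.app x.ι _ b)
    (hp : Hom.app x.ι _ (τ.edge i a) = Hom.app x.ι _ (τ.edge i b)) :
    Hom.app u _ a ≤ Hom.app u _ b := by
  rw [← factorisation_app x, ← factorisation_app x]
  refine Hom.monotone_fibre x.π i _ _ ?_ h
  rw [Hom.comm, Hom.comm, hp]

theorem factorisation_fibre (x : Factorisation u) (i : Fin n) {a b : Fin (τ.size i.castSucc)}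
    (h : τ.edge i a = τ.edge i b) (hab : a ≤ b) : Hom.app x.ι _ a ≤ Hom.app x.ι _ b :=
  Hom.monotone_fibre x.ι i a b h hab

theorem factorisation_eq_target (x : Factorisation u) {k : Fin (n + 1)} {a b : Fin (τ.size k)}
    (h : Hom.app x.ι _ a = Hom.app x.ι _ b) : Hom.app u _ a = Hom.app u _ b := by
  rw [← factorisation_app x, ← factorisation_app x, h]

/-- `x` is a refinement of `y`. -/
def Refines (x y : Factorisation u) : Prop := ∃ e : x.mid ⟶ y.mid, x.ι ≫ e = y.ι

theorem refines_of_forall {x y : Factorisation u}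
    (h : ∀ (i : Fin n) (a b : Fin (τ.size i.castSucc)), Hom.app x.ι _ a ≤ Hom.app x.ι _ b →
      Hom.app x.ι _ (τ.edge i a) = Hom.app x.ι _ (τ.edge i b) →
        Hom.app y.ι _ a ≤ Hom.app y.ι _ b) : Refines x y :=
  exists_desc x.ι y.ι h

theorem Refines.comp_π {x y : Factorisation u} {e : x.mid ⟶ y.mid} (h : x.ι ≫ e = y.ι) :
    e ≫ y.π = x.π := by
  rw [← cancel_epi x.ι, ← Category.assoc, h, y.ι_π, x.ι_π]

theorem Refines.app_eq {x y : Factorisation u} (h : Refines x y) {k : Fin (n + 1)}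
    {a b : Fin (τ.size k)} (hab : Hom.app x.ι _ a = Hom.app x.ι _ b) :
    Hom.app y.ι _ a = Hom.app y.ι _ b := by
  obtain ⟨e, he⟩ := h
  rw [← he, comp_app, comp_app, hab]

theorem Refines.app_le {x y : Factorisation u} (h : Refines x y) {i : Fin n}
    {a b : Fin (τ.size i.castSucc)} (hab : Hom.app x.ι _ a ≤ Hom.app x.ι _ b)
    (hp : Hom.app x.ι _ (τ.edge i a) = Hom.app x.ι _ (τ.edge i b)) :
    Hom.app y.ι _ a ≤ Hom.app y.ι _ b := by
  obtain ⟨e, he⟩ := h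
  rw [← he, comp_app, comp_app]
  refine Hom.monotone_fibre e i _ _ ?_ hab
  rw [Hom.comm, Hom.comm, hp]

/-- A morphism between trees of equal degree is an identity, so equality of factorisations needs a
comparison in one direction only. -/
theorem Refines.eq_of_deg_eq {x y : Factorisation u} (h : Refines x y)
    (hd : x.mid.deg = y.mid.deg) : x = y := by
  obtain ⟨e, he⟩ := h
  have hπ := Refines.comp_π he
  obtain ⟨X, ι, π, hx⟩ := x
  obtain ⟨Y, ι', π', hy⟩ := y
  dsimp only at e he hd hπ
  obtain ⟨heq, rfl⟩ := (isIdentity_iff e).mpr hd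
  subst heq
  simp only [eqToHom_refl, Category.comp_id, Category.id_comp] at he hπ
  subst he hπ
  rfl

/-- `x` refines `y` by a morphism of degree one. -/
def Covers (x y : Factorisation u) : Prop := Refines x y ∧ x.mid.deg = y.mid.deg + 1

theorem size_eq_of_ker_eq {x y : Factorisation u} {k : Fin (n + 1)}
    (h : ∀ a b, Hom.app x.ι k a = Hom.app x.ι k b ↔ Hom.app y.ι k a = Hom.app y.ι k b) :
    x.mid.size k = y.mid.size k := by
  let f : Fin (x.mid.size k) → Fin (y.mid.size k) := fun c =>
    Hom.app y.ι k (Function.surjInv (Hom.surjective x.ι k) c)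
  have hf : ∀ a, f (Hom.app x.ι k a) = Hom.app y.ι k a := fun a =>
    (h _ _).mp (Function.surjInv_eq (Hom.surjective x.ι k) _)
  have : Function.Bijective f := by
    constructor
    · intro c c' hc
      obtain ⟨a, rfl⟩ := Hom.surjective x.ι k c
      obtain ⟨b, rfl⟩ := Hom.surjective x.ι k c'
      rw [hf, hf] at hc
      exact (h _ _).mpr hc
    · intro d
      obtain ⟨a, rfl⟩ := Hom.surjective y.ι k d
      exact ⟨_, hf a⟩
  simpa using Fintype.card_of_bijective this

/-- Equal preorders give a refinement and equal numbers of classes on every level. A factorisation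
is thus encoded by its preorders on `τ`; finiteness follows. -/
theorem eq_of_forall_le_iff {x y : Factorisation u}
    (h : ∀ k a b, Hom.app x.ι k a ≤ Hom.app x.ι k b ↔ Hom.app y.ι k a ≤ Hom.app y.ι k b) :
    x = y := by
  refine Refines.eq_of_deg_eq (refines_of_forall fun i a b hab _ => (h _ _ _).mp hab) ?_
  refine Finset.sum_congr rfl fun i _ => size_eq_of_ker_eq fun a b => ?_
  rw [le_antisymm_iff, le_antisymm_iff, h, h]

instance finite_factorisation (u : τ ⟶ σ) : Finite (Factorisation u) := by
  let F : Factorisation u → ∀ k, Fin (τ.size k) → Fin (τ.size k) → Prop :=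
    fun x k a b => Hom.app x.ι k a ≤ Hom.app x.ι k b
  refine Finite.of_injective F fun x y h => eq_of_forall_le_iff fun k a b => ?_
  exact iff_of_eq (congrFun (congrFun (congrFun h k) a) b)

noncomputable instance (u : τ ⟶ σ) : Fintype (Factorisation u) := Fintype.ofFinite _

end Factorisations

/-! ### Surjections between sets whose sizes differ by one -/

/-- Deleting one point of a collision leaves a surjection between sets of the same size, hence an
injection. Deleting either of the two points in turn leaves no room for another collision. -/
theorem exists_unique_collision {A B : Type*} [Fintype A] [Fintype B] (f : A → B)
    (hf : Function.Surjective f) (h : Fintype.card A = Fintype.card B + 1) :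
    ∃ a b, a ≠ b ∧ f a = f b ∧
      ∀ x y, x ≠ y → f x = f y → (x = a ∧ y = b) ∨ (x = b ∧ y = a) := by
  classical
  have hn : ¬ Function.Injective f := fun hi => by
    have := Fintype.card_le_of_injective f hi
    omega
  simp only [Function.Injective, not_forall] at hn
  obtain ⟨a, b, hab, hne⟩ := hn
  have key : ∀ c d, c ≠ d → f c = f d → ∀ x y, x ≠ c → y ≠ c → f x = f y → x = y := by
    intro c d hcd hfcd
    let g : {x // x ≠ c} → B := fun x => f x
    have hg : Function.Surjective g := by
      intro z
      obtain ⟨x, rfl⟩ := hf z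
      by_cases hx : x = c
      · exact ⟨⟨d, hcd.symm⟩, by simp [g, hx, hfcd]⟩
      · exact ⟨⟨x, hx⟩, rfl⟩
    have hcard : Fintype.card {x // x ≠ c} = Fintype.card B := by
      rw [Fintype.card_subtype_compl, Fintype.card_subtype_eq, h, Nat.add_sub_cancel]
    have hinj := ((Fintype.bijective_iff_surjective_and_card g).mpr ⟨hg, hcard⟩).1
    intro x y hx hy hxy
    exact congrArg Subtype.val (@hinj ⟨x, hx⟩ ⟨y, hy⟩ hxy)
  refine ⟨a, b, hne, hab, fun x y hxy hf => ?_⟩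
  have h1 := key a b hne hab x y
  have h2 := key b a (Ne.symm hne) hab.symm x y
  by_cases hxa : x = a
  · by_cases hyb : y = b
    · exact Or.inl ⟨hxa, hyb⟩
    · exact absurd (h2 (hxa ▸ hne) hyb hf) hxy
  · by_cases hya : y = a
    · by_cases hxb : x = b
      · exact Or.inr ⟨hxb, hya⟩
      · exact absurd (h2 hxb (hya ▸ hne) hf) hxy
    · exact absurd (h1 hxa hya hf) hxy

/-! ### The pivot of a morphism and the marked vertices of a factorisation -/

section Matching

variable {τ σ : PrunedTree n} {u : τ ⟶ σ}

local notation:max x:max " ◃ " a:max => Hom.app (Factorisation.ι x) _ a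

/-- `v` is the first vertex, on the lowest possible level, that `u` merges with a later vertex which
has the same parent. -/
structure IsPivot (u : τ ⟶ σ) (v : τ.Vertex) : Prop where
  exists_gt : ∃ a, v.2 < a ∧ τ.edge v.1 a = τ.edge v.1 v.2 ∧ Hom.app u _ a = Hom.app u _ v.2
  le_of_eq : ∀ a, τ.edge v.1 a = τ.edge v.1 v.2 → Hom.app u _ a = Hom.app u _ v.2 → v.2 ≤ a
  injective : ∀ i < v.1, ∀ a b, τ.edge i a = τ.edge i b →
    Hom.app u i.castSucc a = Hom.app u i.castSucc b → a = b

/-- If no two siblings were merged, injectivity would pass from the root down to the leaves, since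
equal images force equal parents; then the degree could not drop. -/
theorem exists_isPivot (u : τ ⟶ σ) (h : σ.deg < τ.deg) : ∃ v, IsPivot u v := by
  let S : Set (Fin n) := {i | ∃ a b, a < b ∧ τ.edge i b = τ.edge i a ∧
    Hom.app u i.castSucc b = Hom.app u i.castSucc a}
  have hS : S.Nonempty := by
    by_contra hS
    rw [Set.not_nonempty_iff_eq_empty] at hS
    have hinj : ∀ k, Function.Injective (Hom.app u k) := by
      intro k
      induction k using Fin.reverseInduction with
      | last => exact fun a b _ => (subsingleton_last τ).elim a b
      | cast i ih =>
        intro a b hab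
        have hp : τ.edge i a = τ.edge i b := ih (by rw [← Hom.comm, ← Hom.comm, hab])
        by_contra hne
        rcases lt_or_gt_of_ne hne with hlt | hlt
        · exact (Set.ext_iff.mp hS i).mp ⟨a, b, hlt, hp.symm, hab.symm⟩
        · exact (Set.ext_iff.mp hS i).mp ⟨b, a, hlt, hp, hab⟩
    refine h.not_ge (Finset.sum_le_sum fun i _ => ?_)
    simpa using Fintype.card_le_of_injective _ (hinj i.castSucc)
  obtain ⟨i, hi, hmin⟩ := wellFounded_lt.has_min S hS
  let T : Set (Fin (τ.size i.castSucc)) := {a | ∃ b, a < b ∧ τ.edge i b = τ.edge i a ∧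
    Hom.app u i.castSucc b = Hom.app u i.castSucc a}
  obtain ⟨s, hs, hsmin⟩ := wellFounded_lt.has_min T hi
  refine ⟨⟨i, s⟩, hs, fun a ha hu => ?_, fun j hj a b hp hu => ?_⟩
  · by_contra hlt
    rw [not_le] at hlt
    exact hsmin a ⟨s, hlt, ha.symm, hu.symm⟩ hlt
  · by_contra hne
    rcases lt_or_gt_of_ne hne with hlt | hlt
    · exact hmin j ⟨a, b, hlt, hp.symm, hu.symm⟩ hj
    · exact hmin j ⟨b, a, hlt, hp, hu⟩ hj

/-- An earlier vertex with the same image in the target does not precede `v` in the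
factorisation `x`, although the two have the same parent there. -/
def Bad (x : Factorisation u) (v : τ.Vertex) : Prop :=
  ∃ a, a < v.2 ∧ x ◃ v.2 ≤ x ◃ a ∧ x ◃ (τ.edge v.1 a) = x ◃ (τ.edge v.1 v.2) ∧
    Hom.app u _ a = Hom.app u _ v.2

/-- The marked vertices are the pivot and the bad vertices on lower levels. -/
def Marked (v₀ : τ.Vertex) (x : Factorisation u) (v : τ.Vertex) : Prop :=
  v = v₀ ∨ (v.1 < v₀.1 ∧ Bad x v)

/-- `v` is the last one of the marked vertices on the lowest level that has any. -/
structure IsKey (v₀ : τ.Vertex) (x : Factorisation u) (v : τ.Vertex) : Prop where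
  marked : Marked v₀ x v
  level_le : ∀ v', Marked v₀ x v' → v.1 ≤ v'.1
  le : ∀ a, Marked v₀ x ⟨v.1, a⟩ → a ≤ v.2

theorem exists_isKey (v₀ : τ.Vertex) (x : Factorisation u) : ∃ v, IsKey v₀ x v := by
  let S : Set (Fin n) := {i | ∃ a, Marked v₀ x ⟨i, a⟩}
  have hS : S.Nonempty := ⟨v₀.1, v₀.2, Or.inl rfl⟩
  obtain ⟨i, hi, hmin⟩ := wellFounded_lt.has_min S hS
  let T : Set (Fin (τ.size i.castSucc)) := {a | Marked v₀ x ⟨i, a⟩}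
  obtain ⟨s, hs, hsmax⟩ := wellFounded_gt.has_min T hi
  exact ⟨⟨i, s⟩, hs, fun v hv => not_lt.mp (hmin v.1 ⟨v.2, hv⟩), fun a ha => not_lt.mp (hsmax a ha)⟩

theorem IsKey.congr {v₀ v : τ.Vertex} {x y : Factorisation u} (h : IsKey v₀ x v)
    (hxy : ∀ v', Marked v₀ x v' ↔ Marked v₀ y v') : IsKey v₀ y v :=
  ⟨(hxy _).mp h.marked, fun v' hv' => h.level_le v' ((hxy _).mpr hv'),
    fun a ha => h.le a ((hxy _).mpr ha)⟩

theorem IsKey.unique {v₀ v v' : τ.Vertex} {x : Factorisation u} (h : IsKey v₀ x v)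
    (h' : IsKey v₀ x v') : v = v' := by
  obtain ⟨i, a⟩ := v
  obtain ⟨j, b⟩ := v'
  obtain rfl : i = j := le_antisymm (h.level_le _ h'.marked) (h'.level_le _ h.marked)
  obtain rfl : a = b := le_antisymm (h'.le _ h.marked) (h.le _ h'.marked)
  rfl

/-- Badness is a weak inequality between vertices whose parents coincide in the middle tree, and
coarsening preserves precisely such inequalities. So marked vertices only accumulate under
coarsening, which yields the leading term of the potential. -/
theorem Refines.bad {x y : Factorisation u} (h : Refines x y) {v : τ.Vertex} (hv : Bad x v) :
    Bad y v := by
  obtain ⟨a, ha, hle, hp, hu⟩ := hv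
  exact ⟨a, ha, h.app_le hle hp.symm, h.app_eq hp, hu⟩

theorem Refines.marked {x y : Factorisation u} (h : Refines x y) {v₀ v : τ.Vertex}
    (hv : Marked v₀ x v) : Marked v₀ y v :=
  hv.imp_right fun hv => ⟨hv.1, h.bad hv.2⟩

/-- The order on level `i` that is determined by the order of the parents, the order of the images
in the target, and the order in the source. -/
def LexLE (x : Factorisation u) (i : Fin n) (a b : Fin (τ.size i.castSucc)) : Prop :=
  x ◃ (τ.edge i a) < x ◃ (τ.edge i b) ∨ (x ◃ (τ.edge i a) = x ◃ (τ.edge i b) ∧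
    (Hom.app u _ a < Hom.app u _ b ∨ (Hom.app u _ a = Hom.app u _ b ∧ a ≤ b)))

/-- Level `i` of the factorisation `x` carries the order `LexLE`. -/
def IsLex (x : Factorisation u) (i : Fin n) : Prop :=
  ∀ a b : Fin (τ.size i.castSucc), x ◃ a ≤ x ◃ b ↔ LexLE x i a b

/-- In any factorisation the order on a level is constrained first by the parents and then by the
images in the target. Only ties in both are free, and without bad vertices all of them are broken by
the order of the source. -/
theorem isLex_of_not_bad {x : Factorisation u} {i : Fin n} (h : ∀ s, ¬ Bad x ⟨i, s⟩) :
    IsLex x i := by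
  have key : ∀ a b : Fin (τ.size i.castSucc), x ◃ (τ.edge i a) = x ◃ (τ.edge i b) →
      Hom.app u _ a = Hom.app u _ b → a < b → x ◃ a < x ◃ b := fun a b hp hu hab => by
    by_contra hc
    exact h b ⟨a, hab, not_lt.mp hc, hp, hu⟩
  intro a b
  constructor
  · intro hab
    rcases (factorisation_edge x i hab).lt_or_eq with hlt | heq
    · exact Or.inl hlt
    · refine Or.inr ⟨heq, ?_⟩
      rcases (factorisation_target x i hab heq).lt_or_eq with hlt | hu
      · exact Or.inl hlt
      · refine Or.inr ⟨hu, ?_⟩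
        by_contra hc
        exact absurd hab (not_le.mpr (key b a heq.symm hu.symm (not_le.mp hc)))
  · rintro (hlt | ⟨heq, hlt | ⟨hu, hab⟩⟩)
    · by_contra hc
      exact absurd (factorisation_edge x i (not_le.mp hc).le) (not_le.mpr hlt)
    · by_contra hc
      exact absurd (factorisation_target x i (not_le.mp hc).le heq.symm) (not_le.mpr hlt)
    · rcases hab.lt_or_eq with hlt | rfl
      · exact (key a b heq hu hlt).le
      · exact le_rfl

theorem IsLex.not_bad {x : Factorisation u} {i : Fin n} (h : IsLex x i)
    (s : Fin (τ.size i.castSucc)) : ¬ Bad x ⟨i, s⟩ := by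
  rintro ⟨a, ha, hle, hp, hu⟩
  dsimp only at ha hle hp hu
  rcases (h _ _).mp hle with hlt | ⟨-, hlt | ⟨-, hlt⟩⟩
  · exact hlt.ne hp.symm
  · exact hlt.ne hu.symm
  · exact absurd ha (not_lt.mpr hlt)

theorem IsLex.injective {x : Factorisation u} {i : Fin n} (h : IsLex x i)
    {a b : Fin (τ.size i.castSucc)} (hab : x ◃ a = x ◃ b) : a = b := by
  have hp := factorisation_edge_eq x i hab
  have hu := factorisation_eq_target x hab
  rcases (h _ _).mp hab.le with h1 | ⟨-, h1 | ⟨-, h1⟩⟩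
  · exact absurd hp h1.ne
  · exact absurd hu h1.ne
  · rcases (h _ _).mp hab.ge with h2 | ⟨-, h2 | ⟨-, h2⟩⟩
    · exact absurd hp.symm h2.ne
    · exact absurd hu.symm h2.ne
    · exact le_antisymm h1 h2

section Key

variable {v₀ v : τ.Vertex} {x : Factorisation u}

theorem IsKey.level_le_pivot (h : IsKey v₀ x v) : v.1 ≤ v₀.1 := h.level_le v₀ (Or.inl rfl)

theorem IsKey.isLex (h : IsKey v₀ x v) {i : Fin n} (hi : i < v.1) : IsLex x i :=
  isLex_of_not_bad fun s hs =>
    absurd (h.level_le ⟨i, s⟩ (Or.inr ⟨hi.trans_le h.level_le_pivot, hs⟩)) (not_le.mpr hi)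

/-- This vertex makes merging possible: if `v` is alone, the class following `v` lies between `v`
and `a`, hence has the same parent and the same image in the target. For the pivot, `a` is a later
sibling; for a bad vertex it is the witness of badness. -/
theorem IsKey.exists_ne (hv₀ : IsPivot u v₀) (h : IsKey v₀ x v) :
    ∃ a, a ≠ v.2 ∧ x ◃ v.2 ≤ x ◃ a ∧ x ◃ (τ.edge v.1 a) = x ◃ (τ.edge v.1 v.2) ∧
      Hom.app u _ a = Hom.app u _ v.2 := by
  rcases h.marked with rfl | ⟨-, a, ha, h1, h2, h3⟩
  · obtain ⟨a, ha, hp, hu⟩ := hv₀.exists_gt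
    exact ⟨a, ha.ne', factorisation_fibre x _ hp.symm ha.le, by rw [hp], hu⟩
  · exact ⟨a, ha.ne, h1, h2, h3⟩

/-- This makes splitting possible: moving `v` to the front of its class overtakes no earlier
sibling. The pivot was chosen first, and below its level `u` is injective on siblings. -/
theorem IsKey.le_of_eq (hv₀ : IsPivot u v₀) (h : IsKey v₀ x v) (a : Fin (τ.size v.1.castSucc))
    (hp : τ.edge v.1 a = τ.edge v.1 v.2) (hu : Hom.app u _ a = Hom.app u _ v.2) : v.2 ≤ a := by
  rcases h.marked with rfl | ⟨hlt, -⟩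
  · exact hv₀.le_of_eq a hp hu
  · exact (hv₀.injective _ hlt _ _ hp hu).ge

end Key

/-! ### Modifying the order on one level -/

/-- `y` has the order of `x` above the level `j`, the order `R` on this level and the order
`LexLE` below. -/
structure IsModification (x : Factorisation u) (j : Fin n)
    (R : Fin (τ.size j.castSucc) → Fin (τ.size j.castSucc) → Prop) (y : Factorisation u) :
    Prop where
  above : ∀ k, j.castSucc < k → ∀ a b : Fin (τ.size k), y ◃ a ≤ y ◃ b ↔ x ◃ a ≤ x ◃ b
  at_level : ∀ a b, y ◃ a ≤ y ◃ b ↔ R a b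
  isLex : ∀ i < j, IsLex y i

theorem IsModification.above_eq {x : Factorisation u} {j : Fin n}
    {R : Fin (τ.size j.castSucc) → Fin (τ.size j.castSucc) → Prop} {y : Factorisation u}
    (h : IsModification x j R y) {k : Fin (n + 1)} (hk : j.castSucc < k) (a b : Fin (τ.size k)) :
    y ◃ a = y ◃ b ↔ x ◃ a = x ◃ b := by
  rw [le_antisymm_iff, le_antisymm_iff, h.above k hk, h.above k hk]

/-- The levels are determined one after another from the root: copied above `j`, prescribed at `j`,
and computed from the order of the parents below it. -/
theorem IsModification.unique {x : Factorisation u} {j : Fin n}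
    {R : Fin (τ.size j.castSucc) → Fin (τ.size j.castSucc) → Prop} {y y' : Factorisation u}
    (h : IsModification x j R y) (h' : IsModification x j R y') : y = y' := by
  apply eq_of_forall_le_iff
  intro k
  induction k using Fin.reverseInduction with
  | last =>
    intro a b
    obtain rfl := (subsingleton_last τ).elim a b
    simp
  | cast i ih =>
    intro a b
    rcases lt_trichotomy i j with hi | rfl | hi
    · have ihlt : ∀ c d : Fin (τ.size i.succ), y ◃ c < y ◃ d ↔ y' ◃ c < y' ◃ d := fun c d => by
        rw [lt_iff_not_ge, lt_iff_not_ge, ih]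
      have iheq : ∀ c d : Fin (τ.size i.succ), y ◃ c = y ◃ d ↔ y' ◃ c = y' ◃ d := fun c d => by
        rw [le_antisymm_iff, le_antisymm_iff, ih, ih]
      rw [h.isLex i hi, h'.isLex i hi, LexLE, LexLE, ihlt, iheq]
    · rw [h.at_level, h'.at_level]
    · have hi' : j.castSucc < i.castSucc := Fin.castSucc_lt_castSucc_iff.mpr hi
      rw [h.above _ hi', h'.above _ hi']

theorem exists_isModification (x : Factorisation u) (j : Fin n)
    (R : Fin (τ.size j.castSucc) → Fin (τ.size j.castSucc) → Prop)
    (total : ∀ a b, R a b ∨ R b a) (trans : ∀ a b c, R a b → R b c → R a c)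
    (edge : ∀ a b, R a b → x ◃ (τ.edge j a) ≤ x ◃ (τ.edge j b))
    (fibre : ∀ a b, τ.edge j a = τ.edge j b → a ≤ b → R a b)
    (target : ∀ a b, R a b → x ◃ (τ.edge j a) = x ◃ (τ.edge j b) →
      Hom.app u _ a ≤ Hom.app u _ b) :
    ∃ y, IsModification x j R y := by
  -- The preorder on a level is defined from the preorder `P` on the parents. In the branch below
  -- `j`, the negation of `P` says that the parents are strictly ordered, so that this branch is
  -- `LexLE` written without reference to a factorisation.
  let step : ∀ i : Fin n, (Fin (τ.size i.succ) → Fin (τ.size i.succ) → Prop) →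
      Fin (τ.size i.castSucc) → Fin (τ.size i.castSucc) → Prop := fun i P a b =>
    (i < j ∧ (¬ P (τ.edge i b) (τ.edge i a) ∨ (P (τ.edge i a) (τ.edge i b) ∧
      (Hom.app u _ a < Hom.app u _ b ∨ (Hom.app u _ a = Hom.app u _ b ∧ a ≤ b))))) ∨
    (∃ h : i = j, R (h ▸ a) (h ▸ b)) ∨ (j < i ∧ x ◃ a ≤ x ◃ b)
  let L : ∀ k : Fin (n + 1), Fin (τ.size k) → Fin (τ.size k) → Prop := fun k =>
    Fin.reverseInduction (motive := fun k => Fin (τ.size k) → Fin (τ.size k) → Prop)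
      (fun a b => x ◃ a ≤ x ◃ b) step k
  have hlast : ∀ a b, L (Fin.last n) a b ↔ x ◃ a ≤ x ◃ b := fun a b => by
    simp only [L, Fin.reverseInduction_last]
  have hcast : ∀ i, L i.castSucc = step i (L i.succ) := fun i => by
    simp only [L, Fin.reverseInduction_castSucc]
  have hlt : ∀ i < j, ∀ a b, L i.castSucc a b ↔ (¬ L i.succ (τ.edge i b) (τ.edge i a) ∨
      (L i.succ (τ.edge i a) (τ.edge i b) ∧
      (Hom.app u _ a < Hom.app u _ b ∨ (Hom.app u _ a = Hom.app u _ b ∧ a ≤ b)))) := by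
    intro i hi a b
    rw [hcast]
    simp only [step, hi, true_and, hi.ne, IsEmpty.exists_iff, hi.not_gt, false_and, or_false]
  have heq : ∀ a b, L j.castSucc a b ↔ R a b := by
    intro a b
    rw [hcast]
    simp [step]
  have hgt : ∀ k, j.castSucc < k → ∀ a b : Fin (τ.size k), L k a b ↔ x ◃ a ≤ x ◃ b := by
    intro k hk a b
    induction k using Fin.lastCases with
    | last => exact hlast a b
    | cast i =>
      have hi : j < i := Fin.castSucc_lt_castSucc_iff.mp hk
      rw [hcast]
      simp only [step, hi, true_and, hi.ne', IsEmpty.exists_iff, hi.not_gt, false_and, false_or]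
  have htot : ∀ k a b, L k a b ∨ L k b a := by
    intro k
    induction k using Fin.reverseInduction with
    | last => intro a b; rw [hlast, hlast]; exact le_total _ _
    | cast i ih =>
      intro a b
      rcases lt_trichotomy i j with hi | rfl | hi
      · rw [hlt i hi, hlt i hi]
        by_cases h1 : L i.succ (τ.edge i a) (τ.edge i b)
        · by_cases h2 : L i.succ (τ.edge i b) (τ.edge i a)
          · rcases lt_trichotomy (Hom.app u _ a) (Hom.app u _ b) with h | h | h
            · exact Or.inl (Or.inr ⟨h1, Or.inl h⟩)
            · rcases le_total a b with h' | h'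
              · exact Or.inl (Or.inr ⟨h1, Or.inr ⟨h, h'⟩⟩)
              · exact Or.inr (Or.inr ⟨h2, Or.inr ⟨h.symm, h'⟩⟩)
            · exact Or.inr (Or.inr ⟨h2, Or.inl h⟩)
          · exact Or.inl (Or.inl h2)
        · exact Or.inr (Or.inl h1)
      · rw [heq, heq]; exact total a b
      · rw [hgt _ (Fin.castSucc_lt_castSucc_iff.mpr hi),
          hgt _ (Fin.castSucc_lt_castSucc_iff.mpr hi)]
        exact le_total _ _
  have htrans : ∀ k a b c, L k a b → L k b c → L k a c := by
    intro k
    induction k using Fin.reverseInduction with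
    | last => intro a b c; rw [hlast, hlast, hlast]; exact le_trans
    | cast i ih =>
      intro a b c
      rcases lt_trichotomy i j with hi | rfl | hi
      · rw [hlt i hi, hlt i hi, hlt i hi]
        have t := ih (τ.edge i a) (τ.edge i b) (τ.edge i c)
        have t1 := ih (τ.edge i c) (τ.edge i a) (τ.edge i b)
        have t2 := ih (τ.edge i b) (τ.edge i c) (τ.edge i a)
        have hab := htot i.succ (τ.edge i a) (τ.edge i b)
        have hbc := htot i.succ (τ.edge i b) (τ.edge i c)
        rintro (h1 | ⟨h1, h1'⟩) (h2 | ⟨h2, h2'⟩)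
        · left; tauto
        · left; tauto
        · left; tauto
        · refine Or.inr ⟨t h1 h2, ?_⟩
          rcases h1' with h | ⟨h, h'⟩ <;> rcases h2' with g | ⟨g, g'⟩
          · exact Or.inl (h.trans g)
          · exact Or.inl (g ▸ h)
          · exact Or.inl (h ▸ g)
          · exact Or.inr ⟨h.trans g, h'.trans g'⟩
      · rw [heq, heq, heq]; exact trans a b c
      · have hi' := Fin.castSucc_lt_castSucc_iff.mpr hi
        rw [hgt _ hi', hgt _ hi', hgt _ hi']
        exact le_trans
  have hsucc : ∀ a b, L j.succ a b ↔ x ◃ a ≤ x ◃ b := hgt j.succ Fin.castSucc_lt_succ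
  have hgt' : ∀ i, j < i → ∀ a b, L i.succ a b ↔ x ◃ a ≤ x ◃ b := fun i hi =>
    hgt i.succ ((Fin.castSucc_lt_castSucc_iff.mpr hi).trans Fin.castSucc_lt_succ)
  obtain ⟨y, hy⟩ := exists_factorisation u L htot htrans
    (by
      intro i a b
      rcases lt_trichotomy i j with hi | rfl | hi
      · rw [hlt i hi]
        rintro (h | ⟨h, -⟩)
        · exact (htot _ _ _).resolve_right h
        · exact h
      · rw [heq, hsucc]; exact edge a b
      · rw [hgt _ (Fin.castSucc_lt_castSucc_iff.mpr hi), hgt' i hi]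
        exact factorisation_edge x i)
    (by
      intro i a b hp hab
      rcases lt_trichotomy i j with hi | rfl | hi
      · rw [hlt i hi]
        refine Or.inr ⟨hp ▸ (htot _ _ _).elim id id, ?_⟩
        rcases (Hom.monotone_fibre u i a b hp hab).lt_or_eq with h | h
        · exact Or.inl h
        · exact Or.inr ⟨h, hab⟩
      · rw [heq]; exact fibre a b hp hab
      · rw [hgt _ (Fin.castSucc_lt_castSucc_iff.mpr hi)]
        exact factorisation_fibre x i hp hab)
    (by
      intro i a b
      rcases lt_trichotomy i j with hi | rfl | hi
      · rw [hlt i hi]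
        rintro (h | ⟨-, h | h⟩) h'
        · exact absurd h' h
        · exact h.le
        · exact h.1.le
      · rw [heq, hsucc]
        exact fun h h' => target a b h (le_antisymm (edge a b h) h')
      · rw [hgt _ (Fin.castSucc_lt_castSucc_iff.mpr hi), hgt' i hi]
        exact fun h h' => factorisation_target x i h
          (le_antisymm (factorisation_edge x i h) h'))
  refine ⟨y, fun k hk a b => (hy k a b).trans (hgt k hk a b), fun a b => (hy _ a b).trans (heq a b),
    fun i hi a b => ?_⟩
  rw [hy, hlt i hi, ← hy, ← hy, not_le, LexLE]
  constructor
  · rintro (h | ⟨h, h'⟩)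
    · exact Or.inl h
    · rcases h.lt_or_eq with g | g
      · exact Or.inl g
      · exact Or.inr ⟨g, h'⟩
  · rintro (h | ⟨h, h'⟩)
    · exact Or.inl h
    · exact Or.inr ⟨h.le, h'⟩

/-! ### The matching of the factorisations of a morphism -/

/-- `v` is not identified with any other vertex. -/
def IsAlone (x : Factorisation u) (v : τ.Vertex) : Prop := ∀ a, x ◃ a = x ◃ v.2 → a = v.2

/-- The order on the level of `v` that arises when `v` is merged with the next class. -/
def MergeRel (x : Factorisation u) (v : τ.Vertex) (a b : Fin (τ.size v.1.castSucc)) : Prop :=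
  x ◃ a ≤ x ◃ b ∨ (b = v.2 ∧ ∀ c, x ◃ v.2 < x ◃ c → x ◃ a ≤ x ◃ c)

/-- The order on the level of `v` that arises when `v` is put before the rest of its class. -/
def SplitRel (x : Factorisation u) (v : τ.Vertex) (a b : Fin (τ.size v.1.castSucc)) : Prop :=
  x ◃ a ≤ x ◃ b ∧ ¬ (b = v.2 ∧ a ≠ v.2 ∧ x ◃ v.2 ≤ x ◃ a)

/-- `x` arises from `y` by merging the key vertex `v` with the next class. -/
structure IsMerge (v₀ v : τ.Vertex) (y x : Factorisation u) : Prop where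
  key : IsKey v₀ y v
  key' : IsKey v₀ x v
  marked : ∀ v', Marked v₀ y v' ↔ Marked v₀ x v'
  alone : IsAlone y v
  modification : IsModification y v.1 (MergeRel y v) x

section

variable {v₀ v : τ.Vertex} {x y y' : Factorisation u}

/-- Only the new relations, those with `v` on the right, need an argument. As `v` is alone, the
vertex `c` lies strictly after it, so a vertex now placed at or before `v` was at or before `c`; and
`c` agrees with `v` in parent and image. -/
theorem exists_isModification_merge (hv₀ : IsPivot u v₀) (h : IsKey v₀ y v) (ha : IsAlone y v) :
    ∃ x, IsModification y v.1 (MergeRel y v) x := by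
  obtain ⟨c, hcv, hc, hcp, hcu⟩ := h.exists_ne hv₀
  have hlt : y ◃ v.2 < y ◃ c := lt_of_le_of_ne hc fun he => hcv (ha c he.symm)
  apply exists_isModification
  · intro a b
    exact (le_total (y ◃ a) (y ◃ b)).imp Or.inl Or.inl
  · rintro a b d (h1 | ⟨rfl, h1⟩) (h2 | ⟨rfl, h2⟩)
    · exact Or.inl (h1.trans h2)
    · exact Or.inr ⟨rfl, fun c hc => h1.trans (h2 c hc)⟩
    · rcases h2.lt_or_eq with h2 | h2
      · exact Or.inl (h1 d h2)
      · exact Or.inr ⟨ha d h2.symm, h1⟩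
    · exact Or.inr ⟨rfl, h1⟩
  · rintro a b (h1 | ⟨rfl, h1⟩)
    · exact factorisation_edge y _ h1
    · rw [← hcp]
      exact factorisation_edge y _ (h1 c hlt)
  · exact fun a b hp hab => Or.inl (factorisation_fibre y _ hp hab)
  · rintro a b (h1 | ⟨rfl, h1⟩) hp
    · exact factorisation_target y _ h1 hp
    · rw [← hcu]
      exact factorisation_target y _ (h1 c hlt) (hp.trans hcp.symm)

/-- Splitting only removes relations, so the conditions at risk are totality, transitivity and
monotonicity on the fibres of `τ`. The last one holds because `v` comes first among its siblings
with the same image. -/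
theorem exists_isModification_split (hv₀ : IsPivot u v₀) (h : IsKey v₀ x v) :
    ∃ y, IsModification x v.1 (SplitRel x v) y := by
  apply exists_isModification
  · intro a b
    have key : ∀ a b, x ◃ a ≤ x ◃ b → SplitRel x v a b ∨ SplitRel x v b a := by
      intro a b hab
      by_cases hc : b = v.2 ∧ a ≠ v.2 ∧ x ◃ v.2 ≤ x ◃ a
      · right
        refine ⟨hc.1 ▸ hc.2.2, fun hc' => hc.2.1 hc'.1⟩
      · exact Or.inl ⟨hab, hc⟩
    exact (le_total (x ◃ a) (x ◃ b)).elim (key a b) fun h => (key b a h).symm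
  · rintro a b c ⟨h1, h1'⟩ ⟨h2, h2'⟩
    refine ⟨h1.trans h2, ?_⟩
    rintro ⟨rfl, hne, hle⟩
    by_cases hb : b = v.2
    · exact h1' ⟨hb, hne, hle⟩
    · exact h2' ⟨rfl, hb, hle.trans h1⟩
  · exact fun a b h1 => factorisation_edge x _ h1.1
  · intro a b hp hab
    have hle := factorisation_fibre x _ hp hab
    refine ⟨hle, ?_⟩
    rintro ⟨rfl, hne, hle'⟩
    exact hne (le_antisymm hab
      (h.le_of_eq hv₀ a hp (factorisation_eq_target x (le_antisymm hle hle'))))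
  · exact fun a b h1 hp => factorisation_target x _ h1.1 hp

theorem eq_of_eq_of_isModification (hlex : ∀ i < v.1, IsLex y i)
    (h : IsModification y v.1 (MergeRel y v) x) {k : Fin (n + 1)} {a b : Fin (τ.size k)}
    (hab : y ◃ a = y ◃ b) : x ◃ a = x ◃ b := by
  rcases lt_trichotomy v.1.castSucc k with hk | hk | hk
  · exact (h.above_eq hk a b).mpr hab
  · subst hk
    exact le_antisymm ((h.at_level a b).mpr (Or.inl hab.le)) ((h.at_level b a).mpr (Or.inl hab.ge))
  · induction k using Fin.lastCases with
    | last => exact (subsingleton_last _).elim _ _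
    | cast i => rw [(hlex i (Fin.castSucc_lt_castSucc_iff.mp hk)).injective hab]

theorem refines_of_isModification (hlex : ∀ i < v.1, IsLex y i)
    (h : IsModification y v.1 (MergeRel y v) x) : Refines y x := by
  obtain ⟨j, s⟩ := v
  refine refines_of_forall fun i a b hab hp => ?_
  rcases lt_trichotomy i j with hi | rfl | hi
  · have hp' : x ◃ (τ.edge i a) = x ◃ (τ.edge i b) := eq_of_eq_of_isModification hlex h hp
    rw [h.isLex i hi]
    rcases (hlex i hi a b).mp hab with h1 | ⟨-, h1⟩
    · exact absurd hp h1.ne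
    · exact Or.inr ⟨hp', h1⟩
  · exact (h.at_level a b).mpr (Or.inl hab)
  · exact (h.above _ (Fin.castSucc_lt_castSucc_iff.mpr hi) a b).mpr hab

theorem IsModification.bad_iff_of_lt {j : Fin n}
    {R : Fin (τ.size j.castSucc) → Fin (τ.size j.castSucc) → Prop} (h : IsModification y j R x)
    {i : Fin n} (hi : j < i) (t : Fin (τ.size i.castSucc)) : Bad x ⟨i, t⟩ ↔ Bad y ⟨i, t⟩ := by
  have h1 : j.castSucc < i.castSucc := Fin.castSucc_lt_castSucc_iff.mpr hi
  have h2 : j.castSucc < i.succ := h1.trans Fin.castSucc_lt_succ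
  exact exists_congr fun a => and_congr_right fun _ =>
    and_congr (h.above _ h1 _ _) (and_congr_left fun _ => h.above_eq h2 _ _)

/-- A new bad vertex `t` on the level of the key could only have the key itself as its witness. The
key is then bad through some `b` before it, and `t` is placed at or before `b` in `y`, so `t` was
already bad; but it lies after the key, the last marked vertex of the level. -/
theorem marked_of_isModification_merge (h : IsKey v₀ y v) (hv₀ : IsPivot u v₀) (ha : IsAlone y v)
    (hm : IsModification y v.1 (MergeRel y v) x) (v' : τ.Vertex) :
    Marked v₀ y v' ↔ Marked v₀ x v' := by
  refine ⟨fun hv' => (refines_of_isModification (fun i hi => h.isLex hi) hm).marked hv', ?_⟩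
  rintro (rfl | ⟨hlt, hbad⟩)
  · exact Or.inl rfl
  · refine Or.inr ⟨hlt, ?_⟩
    obtain ⟨i, t⟩ := v'
    obtain ⟨j, s⟩ := v
    rcases lt_trichotomy i j with hi | rfl | hi
    · exact absurd hbad ((hm.isLex i hi).not_bad t)
    · obtain ⟨t', ht', hle, hp, hu⟩ := hbad
      dsimp only at ht' hle hp hu hlt hm
      rw [hm.above_eq Fin.castSucc_lt_succ] at hp
      rcases (hm.at_level _ _).mp hle with h1 | ⟨h1, h2⟩
      · exact ⟨t', ht', h1, hp, hu⟩
      · dsimp only at h1 h2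
        subst h1
        obtain ⟨b, hb, hle', hp', hu'⟩ : Bad y ⟨i, t'⟩ := by
          rcases h.marked with h0 | h0
          · exact absurd hlt (by rw [← h0]; exact lt_irrefl _)
          · exact h0.2
        dsimp only at hb hle' hp' hu'
        have hlt' : y ◃ t' < y ◃ b := lt_of_le_of_ne hle' fun he => hb.ne (ha b he.symm)
        have : Marked v₀ y ⟨i, t⟩ :=
          Or.inr ⟨hlt, b, hb.trans ht', h2 b hlt', hp'.trans hp, hu'.trans hu⟩
        exact absurd ht' (not_lt.mpr (h.le t this))
    · exact (hm.bad_iff_of_lt hi t).mp hbad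

theorem exists_isMerge_of_isAlone (hv₀ : IsPivot u v₀) (h : IsKey v₀ y v) (ha : IsAlone y v) :
    ∃ x, IsMerge v₀ v y x := by
  obtain ⟨x, hx⟩ := exists_isModification_merge hv₀ h ha
  have hm := marked_of_isModification_merge h hv₀ ha hx
  exact ⟨x, h, h.congr hm, hm, ha, hx⟩

/-- After splitting, the class following `v` is what remains of its former class, so merging
restores `x`. The marked vertices persist: only the key moves, and as a witness it would mark a
vertex after itself. -/
theorem exists_isMerge_of_not_isAlone (hv₀ : IsPivot u v₀) (h : IsKey v₀ x v)
    (ha : ¬ IsAlone x v) : ∃ y, IsMerge v₀ v y x := by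
  obtain ⟨y, hy⟩ := exists_isModification_split hv₀ h
  have halone : IsAlone y v := fun a hav => by
    by_contra hne
    have h1 := (hy.at_level _ _).mp hav.le
    have h2 := (hy.at_level _ _).mp hav.ge
    exact h1.2 ⟨rfl, hne, h2.1⟩
  have hmod : IsModification y v.1 (MergeRel y v) x := by
    refine ⟨fun k hk a b => (hy.above k hk a b).symm, fun a b => ?_, fun i hi => h.isLex hi⟩
    have hlt : ∀ c, y ◃ v.2 < y ◃ c ↔ c ≠ v.2 ∧ x ◃ v.2 ≤ x ◃ c := fun c => by
      rw [lt_iff_not_ge, hy.at_level, SplitRel, not_and, not_not]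
      constructor
      · intro hc
        by_cases hcv : c = v.2
        · exact absurd (hc (by rw [hcv])).2.1 (by simp [hcv])
        · exact ⟨hcv, (le_total _ _).elim id fun h => (hc h).2.2⟩
      · exact fun hc _ => ⟨rfl, hc⟩
    rw [MergeRel, hy.at_level, SplitRel]
    constructor
    · intro hab
      by_cases hc : b = v.2 ∧ a ≠ v.2 ∧ x ◃ v.2 ≤ x ◃ a
      · refine Or.inr ⟨hc.1, fun c hcv => ?_⟩
        rw [hlt] at hcv
        rw [hy.at_level]
        refine ⟨?_, fun h => hcv.1 h.1⟩
        rw [hc.1] at hab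
        exact hab.trans hcv.2
      · exact Or.inl ⟨hab, hc⟩
    · rintro (hab | ⟨rfl, hab⟩)
      · exact hab.1
      -- A classmate `c` of `v` in `x` lies strictly after `v` in `y`, so it bounds `a`.
      · simp only [IsAlone, not_forall] at ha
        obtain ⟨c, hc, hcv⟩ := ha
        have := hab c ((hlt c).mpr ⟨hcv, hc.ge⟩)
        rw [hy.at_level] at this
        exact this.1.trans hc.le
  have hlex : ∀ i < v.1, IsLex y i := fun i hi => hy.isLex i hi
  have hmarked : ∀ v', Marked v₀ y v' ↔ Marked v₀ x v' := by
    refine fun v' => ⟨(refines_of_isModification hlex hmod).marked, ?_⟩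
    rintro (rfl | ⟨hlt, hbad⟩)
    · exact Or.inl rfl
    · refine Or.inr ⟨hlt, ?_⟩
      have hmv : Marked v₀ x v' := Or.inr ⟨hlt, hbad⟩
      obtain ⟨i, t⟩ := v'
      obtain ⟨j, s⟩ := v
      rcases lt_trichotomy i j with hi | rfl | hi
      · exact absurd hbad ((h.isLex hi).not_bad t)
      · obtain ⟨t', ht', hle, hp, hu⟩ := hbad
        dsimp only at ht' hle hp hu hlt hy
        refine ⟨t', ht', ?_, (hy.above_eq Fin.castSucc_lt_succ _ _).mpr hp, hu⟩
        refine (hy.at_level _ _).mpr ⟨hle, ?_⟩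
        rintro ⟨rfl, -, -⟩
        exact absurd ht' (not_lt.mpr (h.le t hmv))
      · exact (hy.bad_iff_of_lt hi t).mpr hbad
  exact ⟨y, h.congr fun v' => (hmarked v').symm, h, hmarked, halone, hmod⟩

namespace IsMerge

theorem unique {x' : Factorisation u} (h : IsMerge v₀ v y x) (h' : IsMerge v₀ v y x') : x = x' :=
  h.modification.unique h'.modification

theorem refines (h : IsMerge v₀ v y x) : Refines y x :=
  refines_of_isModification (fun _ hi => h.key.isLex hi) h.modification

theorem lt_of_app_eq (h : IsMerge v₀ v y x) {b : Fin (τ.size v.1.castSucc)} (hb : b ≠ v.2)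
    (hxb : x ◃ b = x ◃ v.2) : y ◃ v.2 < y ◃ b := by
  rcases (h.modification.at_level _ _).mp hxb.ge with h1 | ⟨h1, -⟩
  · exact lt_of_le_of_ne h1 fun he => hb (h.alone b he.symm)
  · exact absurd h1 hb

theorem exists_app_eq (hv₀ : IsPivot u v₀) (h : IsMerge v₀ v y x) :
    ∃ b, b ≠ v.2 ∧ x ◃ b = x ◃ v.2 := by
  obtain ⟨c, hcv, hc, -, -⟩ := h.key.exists_ne hv₀
  have hlt : y ◃ v.2 < y ◃ c := lt_of_le_of_ne hc fun he => hcv (h.alone c he.symm)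
  -- `b` is a member of the class immediately following `v`.
  obtain ⟨b, hb, hmin⟩ := (Set.toFinite {c | y ◃ v.2 < y ◃ c}).exists_minimalFor
    (fun c => y ◃ c) _ ⟨c, hlt⟩
  refine ⟨b, fun he => ?_, le_antisymm ?_ ?_⟩
  · rw [he] at hb
    exact lt_irrefl _ (show y ◃ v.2 < y ◃ v.2 from hb)
  · refine (h.modification.at_level _ _).mpr (Or.inr ⟨rfl, fun d hd => ?_⟩)
    exact (le_total (y ◃ b) (y ◃ d)).elim id fun hdb => hmin hd hdb
  · exact (h.modification.at_level _ _).mpr (Or.inl (le_of_lt hb))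

theorem not_isAlone (hv₀ : IsPivot u v₀) (h : IsMerge v₀ v y x) : ¬ IsAlone x v := fun ha => by
  obtain ⟨b, hb, hxb⟩ := h.exists_app_eq hv₀
  exact hb (ha b hxb)

theorem size_eq (h : IsMerge v₀ v y x) {i : Fin n} (hi : i ≠ v.1) :
    y.mid.size i.castSucc = x.mid.size i.castSucc := by
  refine size_eq_of_ker_eq fun a b => ?_
  rcases lt_or_gt_of_ne hi with hi | hi
  · exact ⟨fun hab => by rw [(h.key.isLex hi).injective hab],
      fun hab => by rw [(h.key'.isLex hi).injective hab]⟩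
  · exact (h.modification.above_eq (Fin.castSucc_lt_castSucc_iff.mpr hi) a b).symm

/-- Without the singleton class of `v`, the classes of `y` on this level correspond bijectively to
those of `x`. -/
theorem size_key (hv₀ : IsPivot u v₀) (h : IsMerge v₀ v y x) :
    y.mid.size v.1.castSucc = x.mid.size v.1.castSucc + 1 := by
  obtain ⟨e, he⟩ := h.refines
  have hea : ∀ a : Fin (τ.size v.1.castSucc), Hom.app e _ (y ◃ a) = x ◃ a := fun a => by
    rw [← he, comp_app]
  obtain ⟨b, hb, hxb⟩ := h.exists_app_eq hv₀
  let g : {c : Fin (y.mid.size v.1.castSucc) // c ≠ y ◃ v.2} → Fin (x.mid.size v.1.castSucc) :=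
    fun c => Hom.app e _ c.1
  have hg : Function.Bijective g := by
    constructor
    · rintro ⟨c, hc⟩ ⟨d, hd⟩ hcd
      obtain ⟨a, rfl⟩ := Hom.surjective y.ι _ c
      obtain ⟨a', rfl⟩ := Hom.surjective y.ι _ d
      have hcd' : x ◃ a = x ◃ a' := by rw [← hea, ← hea]; exact hcd
      have ha : a ≠ v.2 := fun h => hc (by rw [h])
      have ha' : a' ≠ v.2 := fun h => hd (by rw [h])
      refine Subtype.ext (le_antisymm ?_ ?_)
      · exact ((h.modification.at_level _ _).mp hcd'.le).resolve_right fun h => ha' h.1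
      · exact ((h.modification.at_level _ _).mp hcd'.ge).resolve_right fun h => ha h.1
    · intro z
      obtain ⟨a, rfl⟩ := Hom.surjective x.ι _ z
      by_cases ha : a = v.2
      · exact ⟨⟨y ◃ b, (h.lt_of_app_eq hb hxb).ne'⟩, by rw [ha, ← hxb]; exact hea b⟩
      · exact ⟨⟨y ◃ a, fun he => ha (h.alone a he)⟩, hea a⟩
  have hcard := Fintype.card_of_bijective hg
  rw [Fintype.card_subtype_compl, Fintype.card_subtype_eq, Fintype.card_fin, Fintype.card_fin]
    at hcard
  have := Fin.pos (y ◃ v.2)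
  omega

theorem covers (hv₀ : IsPivot u v₀) (h : IsMerge v₀ v y x) : Covers y x := by
  refine ⟨h.refines, ?_⟩
  have hs : ∀ i : Fin n, y.mid.size i.castSucc =
      x.mid.size i.castSucc + if i = v.1 then 1 else 0 := fun i => by
    split_ifs with hi
    · rw [hi]; exact h.size_key hv₀
    · exact h.size_eq hi
  rw [deg, deg, Finset.sum_congr rfl fun i _ => hs i, Finset.sum_add_distrib]
  simp

end IsMerge

/-! ### The potential -/

/-- The collision on level `j` uses up the whole drop in degree, so every other level keeps its size
and the surjection on it is bijective. -/
theorem Covers.injective_of_ne (h : Covers y x) {j : Fin n} {a b : Fin (τ.size j.castSucc)}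
    (hy : y ◃ a ≠ y ◃ b) (hx : x ◃ a = x ◃ b) {i : Fin n} (hi : i ≠ j)
    {c d : Fin (τ.size i.castSucc)} (hcd : x ◃ c = x ◃ d) : y ◃ c = y ◃ d := by
  obtain ⟨⟨e, he⟩, hdeg⟩ := h
  have hea : ∀ k (a : Fin (τ.size k)), Hom.app e _ (y ◃ a) = x ◃ a := fun k a => by
    rw [← he, comp_app]
  have hlt : x.mid.size j.castSucc < y.mid.size j.castSucc := by
    refine lt_of_le_of_ne (size_le e _) fun hs => hy ?_
    have : Function.Bijective (Hom.app e j.castSucc) :=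
      (Fintype.bijective_iff_surjective_and_card _).mpr ⟨Hom.surjective e _, by simp [hs]⟩
    exact this.1 (by rw [hea, hea, hx])
  have hs : y.mid.size i.castSucc = x.mid.size i.castSucc := by
    refine le_antisymm ?_ (size_le e _)
    by_contra hlt'
    rw [not_le] at hlt'
    have key : ∀ k : Fin n, x.mid.size k.castSucc +
        ((if k = i then 1 else 0) + (if k = j then 1 else 0)) ≤ y.mid.size k.castSucc := by
      intro k
      have := size_le e k.castSucc
      split_ifs with h1 h2 h2
      · exact absurd (h1.symm.trans h2) hi
      · subst h1; omega
      · subst h2; omega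
      · omega
    have := Finset.sum_le_sum fun k (_ : k ∈ Finset.univ) => key k
    simp only [Finset.sum_add_distrib, Finset.sum_ite_eq', Finset.mem_univ, if_true] at this
    simp only [deg] at hdeg
    omega
  have : Function.Bijective (Hom.app e i.castSucc) :=
    (Fintype.bijective_iff_surjective_and_card _).mpr ⟨Hom.surjective e _, by simp [hs]⟩
  exact this.1 (by rw [hea, hea, hcd])

/-- Above `j` the classes do not change. Going down from the root, distinct parents stay distinct
and force the order, while under equal parents the refinement preserves it. -/
theorem Covers.le_iff_above (h : Covers y x) {j : Fin n} {a b : Fin (τ.size j.castSucc)}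
    (hy : y ◃ a ≠ y ◃ b) (hx : x ◃ a = x ◃ b) (k : Fin (n + 1)) (hk : j.castSucc < k)
    (c d : Fin (τ.size k)) : y ◃ c ≤ y ◃ d ↔ x ◃ c ≤ x ◃ d := by
  have hinj : ∀ (i : Fin n) (c d : Fin (τ.size i.castSucc)), j < i → x ◃ c = x ◃ d →
      y ◃ c = y ◃ d := fun i c d hi => h.injective_of_ne hy hx hi.ne'
  have hinj' : ∀ (k : Fin (n + 1)) (c d : Fin (τ.size k)), j.castSucc < k → x ◃ c = x ◃ d →
      y ◃ c = y ◃ d := by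
    intro k
    induction k using Fin.lastCases with
    | last => exact fun _ _ _ _ => (subsingleton_last _).elim _ _
    | cast i => exact fun c d hk => hinj i c d (Fin.castSucc_lt_castSucc_iff.mp hk)
  have key : ∀ k, j.castSucc < k → ∀ c d : Fin (τ.size k), y ◃ c ≤ y ◃ d → x ◃ c ≤ x ◃ d := by
    intro k
    induction k using Fin.reverseInduction with
    | last => exact fun _ c d _ => ((subsingleton_last _).elim _ _ : x ◃ c = x ◃ d).le
    | cast i ih =>
      intro hk c d hcd
      have hk' : j.castSucc < i.succ := hk.trans Fin.castSucc_lt_succ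
      rcases (factorisation_edge y i hcd).lt_or_eq with hlt | heq
      · have hp : x ◃ (τ.edge i c) < x ◃ (τ.edge i d) :=
          lt_of_le_of_ne (ih hk' _ _ hlt.le) fun he => hlt.ne (hinj' _ _ _ hk' he)
        by_contra hc
        exact absurd (factorisation_edge x i (not_le.mp hc).le) (not_le.mpr hp)
      · exact h.1.app_le hcd heq
  refine ⟨key k hk c d, fun hcd => ?_⟩
  by_contra hc
  exact hc (hinj' k c d hk (le_antisymm hcd (key k hk d c (not_le.mp hc).le))).le

/-- The number of vertices on the level of `v` that do not lie after `v`. -/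
noncomputable def position (x : Factorisation u) (v : τ.Vertex) : ℕ :=
  (Finset.univ.filter fun a => x ◃ a ≤ x ◃ v.2).card

/-- In `y` the vertex `v` precedes all its classmates of `x`. If it also did so in `y'`, then `y'`
would refine `y` in equal degree and be equal to it. So some classmate is at or before `v` in `y'`,
while no vertex at or before `v` in `y` moves after it. -/
theorem IsMerge.position_lt (hv₀ : IsPivot u v₀) (h : IsMerge v₀ v y x) (hc : Covers y' x)
    (hk : IsKey v₀ y' v) (ha : IsAlone y' v) (hne : y' ≠ y) : position y v < position y' v := by
  obtain ⟨j, s⟩ := v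
  have hml := h.modification.at_level
  dsimp only at hml
  obtain ⟨b₀, hb₀, hxb₀⟩ := h.exists_app_eq hv₀
  have hsep : y' ◃ b₀ ≠ y' ◃ s := fun he => hb₀ (ha b₀ he)
  have habove := hc.le_iff_above hsep hxb₀
  obtain ⟨b, hb, hxb, hyb⟩ : ∃ b, b ≠ s ∧ x ◃ b = x ◃ s ∧ y' ◃ b ≤ y' ◃ s := by
    by_contra hcon
    push Not at hcon
    have heq : ∀ (k : Fin (n + 1)) (a b : Fin (τ.size k)), y' ◃ a = y' ◃ b → y ◃ a = y ◃ b := by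
      intro k a b hab
      rcases lt_trichotomy j.castSucc k with hk' | hk' | hk'
      · exact (h.modification.above_eq hk' a b).mp (hc.1.app_eq hab)
      · subst hk'
        have hx := hc.1.app_eq hab
        by_cases has : a = s
        · rw [has] at hab hx ⊢
          rw [ha b hab.symm]
        · by_cases hbs : b = s
          · rw [hbs] at hab
            exact absurd (ha a hab) has
          · exact le_antisymm (((hml a b).mp hx.le).resolve_right fun h => hbs h.1)
              (((hml b a).mp hx.ge).resolve_right fun h => has h.1)
      · induction k using Fin.lastCases with
        | last => exact (subsingleton_last _).elim _ _
        | cast i => rw [(hk.isLex (Fin.castSucc_lt_castSucc_iff.mp hk')).injective hab]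
    refine hne (Refines.eq_of_deg_eq (refines_of_forall fun i a b hab hp => ?_) ?_)
    · rcases lt_trichotomy i j with hi | rfl | hi
      · rcases (hk.isLex hi a b).mp hab with h1 | ⟨-, h1⟩
        · exact absurd hp h1.ne
        · exact (h.key.isLex hi a b).mpr (Or.inr ⟨heq _ _ _ hp, h1⟩)
      · have hx := hc.1.app_le hab hp
        rcases (hml a b).mp hx with h1 | ⟨hbs, h1⟩
        · exact h1
        · dsimp only at hbs
          subst hbs
          by_cases hab' : a = b
          · rw [hab']
          · by_contra hlt
            rw [not_le] at hlt
            have hxa : x ◃ b ≤ x ◃ a := (hml b a).mpr (Or.inl hlt.le)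
            exact absurd hab (not_le.mpr (hcon a hab' (le_antisymm hx hxa)))
      · exact (h.modification.above _ (Fin.castSucc_lt_castSucc_iff.mpr hi) a b).mp
          (hc.1.app_le hab hp)
    · have h1 := hc.2
      have h2 := (h.covers hv₀).2
      omega
  have hlt := h.lt_of_app_eq hb hxb
  refine Finset.card_lt_card (Finset.ssubset_iff_subset_ne.mpr ⟨fun a haf => ?_, fun he => ?_⟩)
  · simp only [Finset.mem_filter, Finset.mem_univ, true_and] at haf ⊢
    by_cases has : a = s
    · rw [has]
    by_contra hcon
    rw [not_le] at hcon
    have hp1 := factorisation_edge y _ haf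
    have hp2 := factorisation_edge y' _ hcon.le
    rw [← h.modification.above _ Fin.castSucc_lt_succ] at hp1
    have hp3 := (habove _ Fin.castSucc_lt_succ _ _).mp hp2
    have hp4 := (habove _ Fin.castSucc_lt_succ _ _).mpr hp1
    have hxsa := hc.1.app_le hcon.le (le_antisymm hp2 hp4)
    rcases (hml _ _).mp hxsa with h1 | ⟨h1, -⟩
    · exact has (h.alone a (le_antisymm haf h1))
    · exact has h1
  · have : b ∈ Finset.univ.filter fun a => y ◃ a ≤ y ◃ s := by rw [he]; simpa using hyb
    simp only [Finset.mem_filter, Finset.mem_univ, true_and] at this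
    exact absurd this (not_le.mpr hlt)

end

/-- The factorisations of a morphism of positive degree can be matched in pairs, along relations of
degree one and acyclically. -/
theorem exists_matching (u : τ ⟶ σ) (h : σ.deg < τ.deg) :
    ∃ (Low : Factorisation u → Prop) (up : Factorisation u → Factorisation u)
      (r : Factorisation u → ℕ),
      (∀ y, Low y → ¬ Low (up y)) ∧ (∀ y, Low y → Covers y (up y)) ∧
      (∀ x, ¬ Low x → ∃ y, Low y ∧ up y = x) ∧
      (∀ y y', Low y → Low y' → y' ≠ y → Covers y' (up y) → r y < r y') := by
  classical
  obtain ⟨v₀, hv₀⟩ := exists_isPivot u h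
  choose key hkey using fun x : Factorisation u => exists_isKey v₀ x
  have hup : ∀ y : Factorisation u, ∃ x, IsAlone y (key y) → IsMerge v₀ (key y) y x := by
    intro y
    by_cases ha : IsAlone y (key y)
    · obtain ⟨x, hx⟩ := exists_isMerge_of_isAlone hv₀ (hkey y) ha
      exact ⟨x, fun _ => hx⟩
    · exact ⟨y, fun h => absurd h ha⟩
  choose up hup using hup
  let m : Factorisation u → ℕ := fun x => (Finset.univ.filter fun v => Marked v₀ x v).card
  let N := Fintype.card τ.Vertex
  let C := (∑ i : Fin n, τ.size i.castSucc) + 1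
  have hm : ∀ x, m x ≤ N := fun x => Finset.card_le_univ _
  have hpos : ∀ (x : Factorisation u) v, position x v < C := fun x v => by
    refine Nat.lt_succ_of_le ((Finset.card_le_univ _).trans ?_)
    rw [Fintype.card_fin]
    exact Finset.single_le_sum (f := fun i : Fin n => τ.size i.castSucc)
      (fun _ _ => Nat.zero_le _) (Finset.mem_univ v.1)
  -- As `C` exceeds every position, this potential is lexicographic: it grows when there are fewer
  -- marked vertices, and for equal numbers it compares the positions of the key.
  refine ⟨fun y => IsAlone y (key y), up, fun y => (N - m y) * C + position y (key y),
    fun y hy => ?_, fun y hy => (hup y hy).covers hv₀, fun x hx => ?_, ?_⟩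
  · have hmerge := hup y hy
    dsimp only
    rw [(hkey (up y)).unique hmerge.key']
    exact hmerge.not_isAlone hv₀
  · obtain ⟨y, hy⟩ := exists_isMerge_of_not_isAlone hv₀ (hkey x) hx
    have hk : key y = key x := (hkey y).unique hy.key
    have ha : IsAlone y (key y) := hk ▸ hy.alone
    exact ⟨y, ha, (hk ▸ hup y ha : IsMerge v₀ (key x) y (up y)).unique hy⟩
  · intro y y' hy hy' hne hc
    have hmerge := hup y hy
    have hsub : ∀ v, Marked v₀ y' v → Marked v₀ y v := fun v hv =>
      (hmerge.marked v).mpr (hc.1.marked hv)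
    by_cases hsup : ∀ v, Marked v₀ y v → Marked v₀ y' v
    · have hiff : ∀ v, Marked v₀ y' v ↔ Marked v₀ y v := fun v => ⟨hsub v, hsup v⟩
      have hmm : m y' = m y := by simp only [m, hiff]
      have hkk : key y' = key y := ((hkey y').congr hiff).unique (hkey y)
      have := hmerge.position_lt hv₀ hc (hkk ▸ hkey y') (hkk ▸ hy') hne
      dsimp only
      rw [hmm, hkk]
      omega
    · have hmm : m y' < m y := by
        push Not at hsup
        obtain ⟨v, hv, hv'⟩ := hsup
        refine Finset.card_lt_card (Finset.ssubset_iff_subset_ne.mpr ⟨fun v hv => ?_, fun he => ?_⟩)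
        · simp only [Finset.mem_filter, Finset.mem_univ, true_and] at hv ⊢
          exact hsub v hv
        · have : v ∈ Finset.univ.filter fun v => Marked v₀ y' v := by rw [he]; simpa using hv
          exact hv' (by simpa using this)
      have h1 := hm y
      have h2 : N - m y + 1 ≤ N - m y' := by omega
      have h3 := Nat.mul_le_mul_right C h2
      have h4 := hpos y (key y)
      dsimp only
      rw [Nat.add_mul, one_mul] at h3
      omega

end Matching

/-! ### Inversions between tournaments -/

/-- `r` is irreflexive and relates any two distinct elements in exactly one way. -/
def IsTournament {V : Type*} (r : V → V → Prop) : Prop :=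
  (∀ x, ¬ r x x) ∧ ∀ x y, x ≠ y → (r x y ↔ ¬ r y x)

open Classical in
/-- The number of pairs that are ordered differently by `r` and `s`. -/
noncomputable def inversions {V : Type*} [Fintype V] (r s : V → V → Prop) : ℕ :=
  (Finset.univ.filter fun p : V × V => r p.1 p.2 ∧ s p.2 p.1).card

/-- The relation that puts `a` first and compares the other elements through `f`. -/
def putFirst {V W : Type*} (a : V) (f : V → W) (R : W → W → Prop) (x y : V) : Prop :=
  y ≠ a ∧ (x = a ∨ R (f x) (f y))

section Tournaments

variable {V W : Type*}

theorem IsTournament.putFirst {a : V} {f : V → W} {R : W → W → Prop} (hR : IsTournament R)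
    (hf : ∀ x y, x ≠ a → y ≠ a → f x = f y → x = y) : IsTournament (putFirst a f R) := by
  refine ⟨fun x h => h.2.elim h.1 (hR.1 _), fun x y hxy => ?_⟩
  unfold PrunedTree.putFirst
  by_cases hx : x = a
  · subst hx
    simp [hxy.symm]
  · by_cases hy : y = a
    · subst hy
      simp [hx]
    · have := hR.2 (f x) (f y) fun h => hxy (hf x y hx hy h)
      simp [hx, hy, this]

variable [Fintype V] [Fintype W]

/-- A pair reversed in both comparisons counts twice on the left and not at all on the right; every
other pair counts equally on both sides. -/
theorem inversions_add {r s t : V → V → Prop} (hr : IsTournament r) (hs : IsTournament s)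
    (ht : IsTournament t) :
    (-1 : ℤ) ^ inversions r s * (-1) ^ inversions s t = (-1) ^ inversions r t := by
  classical
  have key : inversions r s + inversions s t = inversions r t +
      2 * (Finset.univ.filter fun p : V × V => r p.1 p.2 ∧ s p.2 p.1 ∧ t p.1 p.2).card := by
    have hswap : (Finset.univ.filter fun p : V × V => r p.1 p.2 ∧ s p.2 p.1 ∧ t p.1 p.2).card =
        (Finset.univ.filter fun p : V × V => r p.2 p.1 ∧ s p.1 p.2 ∧ t p.2 p.1).card :=
      Finset.card_equiv (Equiv.prodComm V V) (by simp)
    rw [two_mul]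
    nth_rewrite 2 [hswap]
    unfold inversions
    simp only [Finset.card_filter, ← Finset.sum_add_distrib]
    refine Finset.sum_congr rfl fun p _ => ?_
    obtain ⟨x, y⟩ := p
    by_cases hxy : x = y
    · subst hxy
      simp [hr.1, hs.1]
    · have h1 := hr.2 x y hxy
      have h2 := hs.2 x y hxy
      have h3 := ht.2 x y hxy
      dsimp only
      by_cases g1 : r y x <;> by_cases g2 : s y x <;> by_cases g3 : t y x <;>
        simp [h1, h2, h3, g1, g2, g3]
  rw [← pow_add, key, pow_add, pow_mul]
  simp

theorem inversions_putFirst {a : V} {f : V → W} {R R' : W → W → Prop}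
    (hf : ∀ x y, x ≠ a → y ≠ a → f x = f y → x = y) (hs : ∀ z, ∃ x, x ≠ a ∧ f x = z) :
    inversions (putFirst a f R) (putFirst a f R') = inversions R R' := by
  classical
  unfold inversions
  refine Finset.card_bij (fun p _ => (f p.1, f p.2)) ?_ ?_ ?_
  · rintro ⟨x, y⟩ h
    simp only [Finset.mem_filter, Finset.mem_univ, true_and] at h ⊢
    exact ⟨h.1.2.resolve_left h.2.1, h.2.2.resolve_left h.1.1⟩
  · rintro ⟨x, y⟩ h ⟨x', y'⟩ h' he
    simp only [Finset.mem_filter, Finset.mem_univ, true_and, Prod.mk.injEq] at h h' he ⊢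
    exact ⟨hf _ _ h.2.1 h'.2.1 he.1, hf _ _ h.1.1 h'.1.1 he.2⟩
  · rintro ⟨z, z'⟩ h
    obtain ⟨x, hx, rfl⟩ := hs z
    obtain ⟨y, hy, rfl⟩ := hs z'
    simp only [Finset.mem_filter, Finset.mem_univ, true_and] at h
    refine ⟨(x, y), ?_, rfl⟩
    simp only [Finset.mem_filter, Finset.mem_univ, true_and]
    exact ⟨⟨hy, Or.inr h.1⟩, hx, Or.inr h.2⟩

/-- Apart from the pair `a`, `b` itself, the reversed pairs are matched without fixed points by `(x,
y) ↦ (swap y, swap x)`. -/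
theorem odd_inversions_swap [DecidableEq V] {r : V → V → Prop} (hr : IsTournament r) {a b : V}
    (hab : a ≠ b) {r' : V → V → Prop}
    (h : ∀ x y, r' x y ↔ r (Equiv.swap a b x) (Equiv.swap a b y)) : Odd (inversions r r') := by
  classical
  wlog hrab : r a b generalizing a b
  · refine this hab.symm (fun x y => ?_) ?_
    · rw [h, Equiv.swap_comm]
    · exact (hr.2 b a hab.symm).mpr hrab
  have hmem : (a, b) ∈ Finset.univ.filter fun p : V × V => r p.1 p.2 ∧ r' p.2 p.1 := by
    simp [h, hrab]
  rw [inversions, ← Finset.card_erase_add_one hmem]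
  refine Even.add_one ((ZMod.natCast_eq_zero_iff_even).mp ?_)
  rw [Finset.card_eq_sum_ones, Nat.cast_sum]
  refine Finset.sum_involution
    (fun p _ => (Equiv.swap a b p.2, Equiv.swap a b p.1)) ?_ ?_ ?_ ?_
  · intro p _
    decide
  · rintro ⟨x, y⟩ hp - he
    simp only [Finset.mem_erase, Finset.mem_filter, Finset.mem_univ, true_and, Prod.mk.injEq, h,
      ne_eq] at hp he
    obtain ⟨hne, hxy, -⟩ := hp
    rw [Equiv.swap_apply_def] at he
    split_ifs at he with h1 h2
    · subst h1
      rw [← he.1] at hxy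
      exact (hr.2 _ _ hab).mp hrab hxy
    · exact hne ⟨he.1.symm, h2⟩
    · rw [he.1] at hxy
      exact hr.1 _ hxy
  · rintro ⟨x, y⟩ hp
    simp only [Finset.mem_erase, Finset.mem_filter, Finset.mem_univ, true_and, h, ne_eq,
      Equiv.swap_apply_self, Prod.mk.injEq] at hp ⊢
    refine ⟨fun he => hp.1 ?_, hp.2.2, hp.2.1⟩
    rw [Equiv.swap_apply_eq_iff, Equiv.swap_apply_eq_iff] at he
    simpa using he.symm
  · rintro ⟨x, y⟩ _
    simp

end Tournaments

/-! ### The planar order -/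

section Planar

variable {τ θ σ : PrunedTree n}

theorem ancestor_of_eq_zero (τ : PrunedTree n) (i k : ℕ) (h : i + k < n + 1) (hk : k = 0)
    (x : Fin (τ.size ⟨i, by omega⟩)) : (τ.ancestor i k h x : ℕ) = x := by
  subst hk
  rfl

theorem ancestorAt_self (v : τ.Vertex) (j : Fin n) (h : v.1 ≤ j) (hj : j = v.1) :
    τ.ancestorAt v j h = v.2 :=
  ancestor_of_eq_zero τ _ _ _ (by rw [hj, Nat.sub_self]) _

theorem before_iff_of_eq {v w : τ.Vertex} (h : v.1 = w.1) :
    τ.Before v w ↔ (v.2 : ℕ) < w.2 := by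
  have hne : v ≠ w ↔ (v.2 : ℕ) ≠ w.2 := by
    obtain ⟨i, a⟩ := v
    obtain ⟨j, b⟩ := w
    dsimp only at h
    subst h
    simp [Fin.ext_iff]
  constructor
  · rintro ⟨h1, ⟨h2, h3⟩ | ⟨h2, -⟩⟩
    · rw [ancestorAt_self w v.1 h2 h] at h3
      exact lt_of_le_of_ne h3 (hne.mp h1)
    · exact absurd h h2.ne
  · intro hlt
    exact ⟨hne.mpr hlt.ne, Or.inl ⟨h.ge, by rw [ancestorAt_self w v.1 h.ge h]; exact hlt.le⟩⟩

theorem before_mk_iff {i : Fin n} {a b : Fin (τ.size i.castSucc)} :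
    τ.Before ⟨i, a⟩ ⟨i, b⟩ ↔ a < b := before_iff_of_eq rfl

/-- For vertices on different levels the two clauses of the definition are complementary
inequalities on a common level. Transitivity is not needed, because inversions are counted pair by
pair. -/
theorem isTournament_before (τ : PrunedTree n) : IsTournament τ.Before := by
  refine ⟨fun x h => h.1 rfl, ?_⟩
  have key : ∀ x y : τ.Vertex, x.1 < y.1 → (τ.Before x y ↔ ¬ τ.Before y x) := by
    intro x y hlt
    have hne : x ≠ y := fun h => hlt.ne (by rw [h])
    have h1 : τ.Before x y ↔ τ.ancestorAt x y.1 hlt.le < (y.2 : ℕ) := by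
      constructor
      · rintro ⟨-, ⟨h, -⟩ | ⟨_, h⟩⟩
        · exact absurd hlt (not_lt.mpr h)
        · exact h
      · exact fun h => ⟨hne, Or.inr ⟨hlt, h⟩⟩
    have h2 : τ.Before y x ↔ (y.2 : ℕ) ≤ τ.ancestorAt x y.1 hlt.le := by
      constructor
      · rintro ⟨-, ⟨_, h⟩ | ⟨h, -⟩⟩
        · exact h
        · exact absurd hlt h.not_gt
      · exact fun h => ⟨hne.symm, Or.inl ⟨hlt.le, h⟩⟩
    rw [h1, h2, not_le]
  intro x y hxy
  rcases lt_trichotomy x.1 y.1 with h | h | h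
  · exact key x y h
  · rw [before_iff_of_eq h, before_iff_of_eq h.symm, not_lt]
    have hne : (x.2 : ℕ) ≠ y.2 := by
      obtain ⟨i, a⟩ := x
      obtain ⟨j, b⟩ := y
      dsimp only at h
      subst h
      simpa [Fin.ext_iff] using hxy
    exact ⟨le_of_lt, fun h => lt_of_le_of_ne h hne⟩
  · rw [key y x h, not_not]

theorem onVertex_comp (v : τ ⟶ θ) (u : θ ⟶ σ) (x : τ.Vertex) :
    onVertex (v ≫ u) x = onVertex u (onVertex v x) := rfl

theorem onVertex_surjective (u : τ ⟶ σ) : Function.Surjective (onVertex u) := by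
  rintro ⟨i, c⟩
  obtain ⟨a, rfl⟩ := Hom.surjective u _ c
  exact ⟨⟨i, a⟩, rfl⟩

theorem onVertex_mk_eq_iff (u : τ ⟶ σ) {i : Fin n} {a b : Fin (τ.size i.castSucc)} :
    onVertex u ⟨i, a⟩ = onVertex u ⟨i, b⟩ ↔ Hom.app u _ a = Hom.app u _ b := by
  simp [onVertex]

theorem card_vertex (τ : PrunedTree n) : Fintype.card τ.Vertex = τ.deg := by
  simp [deg]

/-- `x` and `y` have the same parent and `x` is not to the right of `y`. -/
def SiblingLE (x y : τ.Vertex) : Prop :=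
  ∃ (i : Fin n) (a b : Fin (τ.size i.castSucc)), x = ⟨i, a⟩ ∧ y = ⟨i, b⟩ ∧ a ≤ b ∧
    τ.edge i a = τ.edge i b

theorem SiblingLE.not_before {x y : τ.Vertex} (h : SiblingLE x y) (f : τ ⟶ θ) :
    ¬ θ.Before (onVertex f y) (onVertex f x) := by
  obtain ⟨i, a, b, rfl, rfl, hab, hp⟩ := h
  rw [onVertex, onVertex, before_mk_iff, not_lt]
  exact Hom.monotone_fibre f i a b hp hab

theorem SiblingLE.total {x y z : τ.Vertex} (h : SiblingLE x y) (h' : SiblingLE x z) :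
    SiblingLE y z ∨ SiblingLE z y := by
  obtain ⟨i, a, b, rfl, rfl, hab, hp⟩ := h
  obtain ⟨j, c, d, hac, rfl, hcd, hp'⟩ := h'
  obtain ⟨rfl, hac⟩ := Sigma.mk.inj hac
  obtain rfl := eq_of_heq hac
  rcases le_total b d with h | h
  · exact Or.inl ⟨i, b, d, rfl, rfl, h, hp.symm.trans hp'⟩
  · exact Or.inr ⟨i, d, b, rfl, rfl, h, hp'.symm.trans hp⟩

/-- `u` merges `a` with `b`, where `a` is before `b`, and nothing else. -/
structure MergesPair (u : τ ⟶ σ) (a b : τ.Vertex) : Prop where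
  before : τ.Before a b
  sibling : SiblingLE a b
  eq : onVertex u a = onVertex u b
  unique : ∀ x y, x ≠ y → onVertex u x = onVertex u y → (x = a ∧ y = b) ∨ (x = b ∧ y = a)

/-- The vertex sets differ in size by one, so there is a single collision, necessarily within one
level. Distinct parents would be merged too and give a second collision on the next level. -/
theorem exists_mergesPair (u : τ ⟶ σ) (h : HasDegree u 1) : ∃ a b, MergesPair u a b := by
  obtain ⟨a, b, hab, he, huniq⟩ := exists_unique_collision (onVertex u) (onVertex_surjective u)
    (by rw [card_vertex, card_vertex]; exact h)
  wlog hb : τ.Before a b generalizing a b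
  · refine this b a hab.symm he.symm (fun x y hxy h => (huniq x y hxy h).symm) ?_
    exact ((isTournament_before τ).2 b a hab.symm).mpr hb
  refine ⟨a, b, hb, ?_, he, huniq⟩
  obtain ⟨i, a⟩ := a
  obtain ⟨j, b⟩ := b
  obtain rfl : i = j := congrArg Sigma.fst he
  rw [onVertex_mk_eq_iff] at he
  refine ⟨i, a, b, rfl, rfl, (before_mk_iff.mp hb).le, ?_⟩
  have hinj : ∀ k : Fin (n + 1), k ≠ i.castSucc → Function.Injective (Hom.app u k) := by
    intro k
    induction k using Fin.lastCases with
    | last => exact fun _ c d _ => (subsingleton_last τ).elim c d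
    | cast k =>
      intro hk c d hcd
      by_contra hne
      have hki : k ≠ i := fun h => hk (by rw [h])
      rcases huniq ⟨k, c⟩ ⟨k, d⟩ (by simpa using hne) ((onVertex_mk_eq_iff u).mpr hcd) with h | h
      · exact hki (congrArg Sigma.fst h.1)
      · exact hki (congrArg Sigma.fst h.1)
  refine hinj i.succ (Fin.castSucc_lt_succ).ne' ?_
  rw [← Hom.comm, ← Hom.comm, he]

namespace MergesPair

variable {u : τ ⟶ σ} {a b : τ.Vertex}

theorem ne (h : MergesPair u a b) : a ≠ b := h.before.1

theorem injOn (h : MergesPair u a b) (x y : τ.Vertex) (hx : x ≠ a) (hy : y ≠ a)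
    (hxy : onVertex u x = onVertex u y) : x = y := by
  by_contra hne
  rcases h.unique x y hne hxy with h | h
  · exact hx h.1
  · exact hy h.2

theorem exists_lift (h : MergesPair u a b) (z : σ.Vertex) : ∃ x, x ≠ a ∧ onVertex u x = z := by
  obtain ⟨x, rfl⟩ := onVertex_surjective u z
  by_cases hx : x = a
  · exact ⟨b, h.ne.symm, by rw [hx, h.eq]⟩
  · exact ⟨x, hx, rfl⟩

/-- Let `a` stay in first place as a placeholder and let `b` carry the merged symbol. The first
permutation leads from the planar order to `a`, `b`, rest; the second from there to `a` followed by
the order of the target. The two signs multiply to that of the direct passage. -/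
theorem sgn_eq (h : MergesPair u a b) :
    sgn u = (-1) ^ inversions τ.Before (putFirst a (onVertex u) σ.Before) := by
  classical
  have hfilter : (Finset.univ.filter fun p : τ.Vertex × τ.Vertex =>
      τ.Before p.1 p.2 ∧ onVertex u p.1 = onVertex u p.2) = {(a, b)} := by
    ext ⟨x, y⟩
    simp only [Finset.mem_filter, Finset.mem_univ, true_and, Finset.mem_singleton, Prod.mk.injEq]
    constructor
    · rintro ⟨hb, he⟩
      rcases h.unique x y hb.1 he with hxy | ⟨rfl, rfl⟩
      · exact hxy
      · exact absurd hb (((isTournament_before τ).2 _ _ h.ne).mp h.before)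
    · rintro ⟨rfl, rfl⟩
      exact ⟨h.before, h.eq⟩
  have hτ := isTournament_before τ
  have h1 : IsTournament (putFirst a id (putFirst b id τ.Before)) :=
    (hτ.putFirst fun _ _ _ _ h => h).putFirst fun _ _ _ _ h => h
  have hgather : inversions τ.Before (putFirst a id (putFirst b id τ.Before)) =
      gatherCount τ a b := by
    have hset : (Finset.univ.filter fun p : τ.Vertex × τ.Vertex => τ.Before p.1 p.2 ∧
        putFirst a id (putFirst b id τ.Before) p.2 p.1) =
        ((Finset.univ.filter fun z => τ.Before z a).image fun z => (z, a)) ∪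
          ((Finset.univ.filter fun z => τ.Before z b ∧ z ≠ a).image fun z => (z, b)) := by
      ext ⟨x, y⟩
      simp only [Finset.mem_filter, Finset.mem_univ, true_and, Finset.mem_union,
        Finset.mem_image, Prod.mk.injEq]
      simp only [putFirst, id]
      constructor
      · rintro ⟨hb, hxa, rfl | ⟨hxb, rfl | hyx⟩⟩
        · exact Or.inl ⟨x, hb, rfl, rfl⟩
        · exact Or.inr ⟨x, ⟨hb, hxa⟩, rfl, rfl⟩
        · exact absurd hyx ((hτ.2 _ _ hb.1).mp hb)
      · rintro (⟨z, hz, rfl, rfl⟩ | ⟨z, ⟨hz, hza⟩, rfl, rfl⟩)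
        · exact ⟨hz, hz.1, Or.inl rfl⟩
        · exact ⟨hz, hza, Or.inr ⟨hz.1, Or.inl rfl⟩⟩
    rw [inversions, hset, Finset.card_union_of_disjoint,
      Finset.card_image_of_injective _ fun _ _ h => congrArg Prod.fst h,
      Finset.card_image_of_injective _ fun _ _ h => congrArg Prod.fst h, gatherCount]
    rw [Finset.disjoint_left]
    rintro ⟨x, y⟩ h2 h3
    simp only [Finset.mem_image, Prod.mk.injEq] at h2 h3
    obtain ⟨_, -, -, rfl⟩ := h2
    obtain ⟨_, -, -, h3⟩ := h3
    exact h.ne h3.symm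
  have hreorder : inversions (putFirst a id (putFirst b id τ.Before))
      (putFirst a (onVertex u) σ.Before) = reorderCount u a b := by
    have hset : (Finset.univ.filter fun p : τ.Vertex × τ.Vertex =>
        putFirst a id (putFirst b id τ.Before) p.1 p.2 ∧
        putFirst a (onVertex u) σ.Before p.2 p.1) =
        ((Finset.univ.filter fun z : τ.Vertex =>
          z ≠ a ∧ z ≠ b ∧ σ.Before (onVertex u z) (onVertex u a)).image
          fun z => (b, z)) ∪
        (Finset.univ.filter fun p : τ.Vertex × τ.Vertex =>
          (p.1 ≠ a ∧ p.1 ≠ b) ∧ (p.2 ≠ a ∧ p.2 ≠ b) ∧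
            τ.Before p.1 p.2 ∧ σ.Before (onVertex u p.2) (onVertex u p.1)) := by
      ext ⟨x, y⟩
      simp only [Finset.mem_filter, Finset.mem_univ, true_and, Finset.mem_union,
        Finset.mem_image, Prod.mk.injEq]
      simp only [putFirst, id]
      constructor
      · rintro ⟨⟨hya, hx⟩, hxa, hy⟩
        have hy' := hy.resolve_left hya
        obtain ⟨hyb, hx'⟩ := hx.resolve_left hxa
        by_cases hxb : x = b
        · exact Or.inl ⟨y, ⟨hya, hyb, by rw [h.eq, ← hxb]; exact hy'⟩, hxb.symm, rfl⟩
        · exact Or.inr ⟨⟨hxa, hxb⟩, ⟨hya, hyb⟩, hx'.resolve_left hxb, hy'⟩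
      · rintro (⟨z, ⟨hza, hzb, hz⟩, rfl, rfl⟩ | ⟨⟨hxa, hxb⟩, ⟨hya, hyb⟩, h1, h2⟩)
        · exact ⟨⟨hza, Or.inr ⟨hzb, Or.inl rfl⟩⟩, h.ne.symm, Or.inr (h.eq ▸ hz)⟩
        · exact ⟨⟨hya, Or.inr ⟨hyb, Or.inr h1⟩⟩, hxa, Or.inr h2⟩
    rw [inversions, hset, Finset.card_union_of_disjoint,
      Finset.card_image_of_injective _ fun _ _ h => congrArg Prod.snd h, reorderCount]
    rw [Finset.disjoint_left]
    rintro ⟨x, y⟩ h2 h3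
    simp only [Finset.mem_image, Prod.mk.injEq, Finset.mem_filter,
      Finset.mem_univ, true_and] at h2 h3
    obtain ⟨_, -, rfl, -⟩ := h2
    exact h3.1.2 rfl
  rw [sgn, hfilter, Finset.prod_singleton, pow_add, ← hgather, ← hreorder]
  exact inversions_add hτ h1 ((isTournament_before σ).putFirst h.injOn)

end MergesPair

theorem isUnit_sgn (u : τ ⟶ σ) : IsUnit (sgn u) := by
  rw [sgn]
  exact Finset.prod_induction _ IsUnit (fun _ _ => IsUnit.mul) isUnit_one
    fun p _ => isUnit_one.neg.pow _

end Planar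

/-! ### Signs of the factorisations of a morphism of degree two -/

section DegreeTwo

variable {τ θ σ : PrunedTree n}

/-- The relation that puts `p` first and `q` second and compares the other vertices in the target
of `w`. -/
def putTwoFirst (w : τ ⟶ σ) (p q : τ.Vertex) : τ.Vertex → τ.Vertex → Prop :=
  putFirst p id (putFirst q (onVertex w) σ.Before)

/-- `v` merges `p` with `b`, and `u` merges the images of `q` and `e`. -/
structure MergesPairs (v : τ ⟶ θ) (u : θ ⟶ σ) (p b q e : τ.Vertex) : Prop where
  fst : MergesPair v p b
  snd : MergesPair u (onVertex v q) (onVertex v e)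
  left_ne : q ≠ p
  right_ne : e ≠ p

theorem exists_mergesPairs (v : τ ⟶ θ) (u : θ ⟶ σ) (hv : HasDegree v 1) (hu : HasDegree u 1) :
    ∃ p b q e, MergesPairs v u p b q e := by
  obtain ⟨p, b, hp⟩ := exists_mergesPair v hv
  obtain ⟨c, d, hc⟩ := exists_mergesPair u hu
  obtain ⟨q, hq, rfl⟩ := hp.exists_lift c
  obtain ⟨e, he, rfl⟩ := hp.exists_lift d
  exact ⟨p, b, q, e, hp, hc, hq, he⟩

namespace MergesPairs

variable {v : τ ⟶ θ} {u : θ ⟶ σ} {p b q e : τ.Vertex}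

theorem app_eq (h : MergesPairs v u p b q e) :
    onVertex (v ≫ u) q = onVertex (v ≫ u) e := h.snd.eq

theorem eq_of_app_eq (h : MergesPairs v u p b q e) {x y : τ.Vertex} (hx : x ≠ p) (hy : y ≠ p)
    (hxy : x ≠ y) (he : onVertex (v ≫ u) x = onVertex (v ≫ u) y) :
    (x = q ∧ y = e) ∨ (x = e ∧ y = q) := by
  rcases h.snd.unique _ _ (fun h' => hxy (h.fst.injOn x y hx hy h')) he with ⟨h1, h2⟩ | ⟨h1, h2⟩
  · exact Or.inl ⟨h.fst.injOn _ _ hx h.left_ne h1, h.fst.injOn _ _ hy h.right_ne h2⟩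
  · exact Or.inr ⟨h.fst.injOn _ _ hx h.right_ne h1, h.fst.injOn _ _ hy h.left_ne h2⟩

theorem putFirst_eq (h : MergesPairs v u p b q e) :
    putFirst p (onVertex v) (putFirst (onVertex v q) (onVertex u) σ.Before) =
      putTwoFirst (v ≫ u) p q := by
  funext x y
  unfold putTwoFirst putFirst
  refine propext (and_congr_right fun hy => ?_)
  by_cases hx : x = p
  · simp [hx]
  · have h1 : onVertex v y = onVertex v q ↔ y = q :=
      ⟨h.fst.injOn y q hy h.left_ne, fun h => by rw [h]⟩
    have h2 : onVertex v x = onVertex v q ↔ x = q :=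
      ⟨h.fst.injOn x q hx h.left_ne, fun h => by rw [h]⟩
    simp only [hx, false_or, id, ne_eq, h1, h2, onVertex_comp]

theorem isTournament (h : MergesPairs v u p b q e) : IsTournament (putTwoFirst (v ≫ u) p q) := by
  rw [← h.putFirst_eq]
  exact ((isTournament_before σ).putFirst h.snd.injOn).putFirst h.fst.injOn

/-- Pulling the second reordering back along `v` behind `p` does not change its inversions. The
product therefore depends on the factorisation only through `p` and `q`. -/
theorem sgn_mul_sgn (h : MergesPairs v u p b q e) :
    sgn v * sgn u = (-1) ^ inversions τ.Before (putTwoFirst (v ≫ u) p q) := by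
  have h1 := (isTournament_before θ).putFirst h.fst.injOn
  have h2 := (isTournament_before σ).putFirst h.snd.injOn
  rw [h.fst.sgn_eq, h.snd.sgn_eq, ← h.putFirst_eq,
    ← inversions_putFirst h.fst.injOn h.fst.exists_lift]
  exact inversions_add (isTournament_before τ) h1 (h2.putFirst h.fst.injOn)

end MergesPairs

theorem putTwoFirst_swap [DecidableEq τ.Vertex] (w : τ ⟶ σ) {p q : τ.Vertex} (hpq : q ≠ p)
    (x y : τ.Vertex) : putTwoFirst w q p x y ↔
      putTwoFirst w p q (Equiv.swap p q x) (Equiv.swap p q y) := by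
  unfold putTwoFirst putFirst
  simp only [Equiv.swap_apply_def, id]
  by_cases h1 : x = p <;> by_cases h2 : x = q <;> by_cases h3 : y = p <;> by_cases h4 : y = q <;>
    simp_all

theorem putTwoFirst_swap_right [DecidableEq τ.Vertex] (w : τ ⟶ σ) {p q q' : τ.Vertex}
    (hq : q ≠ p) (hq' : q' ≠ p) (hw : onVertex w q = onVertex w q')
    (x y : τ.Vertex) : putTwoFirst w p q' x y ↔
      putTwoFirst w p q (Equiv.swap q q' x) (Equiv.swap q q' y) := by
  have hs : ∀ z, onVertex w (Equiv.swap q q' z) = onVertex w z := fun z => by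
    rw [Equiv.swap_apply_def]
    split_ifs with h1 h2
    · rw [h1, hw]
    · rw [h2, hw]
    · rfl
  have hp : ∀ z, Equiv.swap q q' z = p ↔ z = p := fun z => by
    rw [Equiv.swap_apply_eq_iff, Equiv.swap_apply_of_ne_of_ne hq.symm hq'.symm]
  have hz : ∀ z, Equiv.swap q q' z = q ↔ z = q' := fun z => by
    rw [Equiv.swap_apply_eq_iff, Equiv.swap_apply_left]
  simp only [putTwoFirst, putFirst, id, ne_eq, hs, hp, hz]

variable {w : τ ⟶ σ}

/-- The pair `p`, `b` fixes the classes of the middle tree. Two of its vertices that are ordered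
differently, under a common parent, would both times form the pair merged in the second step, where
the image of `q` comes first; this identifies them. -/
theorem eq_of_mergesPairs {x x' : Factorisation w} {p b q e : τ.Vertex}
    (hdeg : x.mid.deg = x'.mid.deg)
    (h : MergesPairs x.ι x.π p b q e) (h' : MergesPairs x'.ι x'.π p b q e) : x = x' := by
  have key : ∀ y z : τ.Vertex, onVertex x.ι y = onVertex x.ι z →
      onVertex x'.ι y = onVertex x'.ι z := by
    intro y z hyz
    by_cases hne : y = z
    · rw [hne]
    · rcases h.fst.unique y z hne hyz with ⟨rfl, rfl⟩ | ⟨rfl, rfl⟩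
      · exact h'.fst.eq
      · exact h'.fst.eq.symm
  have keyf : ∀ (k : Fin (n + 1)) (y z : Fin (τ.size k)), Hom.app x.ι k y = Hom.app x.ι k z →
      Hom.app x'.ι k y = Hom.app x'.ι k z := by
    intro k
    induction k using Fin.lastCases with
    | last => exact fun _ _ _ => (subsingleton_last _).elim _ _
    | cast i =>
      intro y z hyz
      rw [← onVertex_mk_eq_iff] at hyz ⊢
      exact key _ _ hyz
  refine Refines.eq_of_deg_eq (refines_of_forall fun i y z hyz hp => ?_) hdeg
  by_contra hlt
  rw [not_le] at hlt
  have hp' := keyf _ _ _ hp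
  have hw : Hom.app w _ y = Hom.app w _ z :=
    le_antisymm (factorisation_target x i hyz hp) (factorisation_target x' i hlt.le hp'.symm)
  have hlt' : Hom.app x.ι _ y < Hom.app x.ι _ z :=
    lt_of_le_of_ne hyz fun he => hlt.ne' (keyf _ _ _ he)
  have hb : x.mid.Before (onVertex x.ι ⟨i, y⟩) (onVertex x.ι ⟨i, z⟩) := before_mk_iff.mpr hlt'
  have hb' : x'.mid.Before (onVertex x'.ι ⟨i, z⟩) (onVertex x'.ι ⟨i, y⟩) := before_mk_iff.mpr hlt
  have hw1 : onVertex x.π (onVertex x.ι ⟨i, y⟩) = onVertex x.π (onVertex x.ι ⟨i, z⟩) := by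
    rw [← onVertex_comp, ← onVertex_comp, x.ι_π, onVertex_mk_eq_iff, hw]
  have hw2 : onVertex x'.π (onVertex x'.ι ⟨i, z⟩) = onVertex x'.π (onVertex x'.ι ⟨i, y⟩) := by
    rw [← onVertex_comp, ← onVertex_comp, x'.ι_π, onVertex_mk_eq_iff, hw]
  have h1 : onVertex x.ι ⟨i, y⟩ = onVertex x.ι q := by
    rcases h.snd.unique _ _ hb.1 hw1 with h1 | h1
    · exact h1.1
    · refine absurd hb (((isTournament_before _).2 _ _ hb.1.symm).mp ?_)
      rw [h1.1, h1.2]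
      exact h.snd.before
  have h2 : onVertex x'.ι ⟨i, z⟩ = onVertex x'.ι q := by
    rcases h'.snd.unique _ _ hb'.1 hw2 with h1 | h1
    · exact h1.1
    · refine absurd hb' (((isTournament_before _).2 _ _ hb'.1.symm).mp ?_)
      rw [h1.1, h1.2]
      exact h'.snd.before
  exact hb'.1 (h2.trans (key _ _ h1).symm)

/-- The pair `p`, `b` is merged by `w` but not by the first step of `x'`, so it is the pair merged
in the second step; the order of siblings excludes the crossed identification. -/
theorem MergesPairs.onVertex_eq {x x' : Factorisation w} {p b q e p' b' q' e' : τ.Vertex}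
    (h : MergesPairs x.ι x.π p b q e) (h' : MergesPairs x'.ι x'.π p' b' q' e')
    (hne : ¬ (p = p' ∧ b = b')) : onVertex x'.ι p = onVertex x'.ι q' ∧
      onVertex x'.ι b = onVertex x'.ι e' := by
  have hnv : onVertex x'.ι p ≠ onVertex x'.ι b := fun he => by
    rcases h'.fst.unique p b h.fst.ne he with h1 | ⟨rfl, rfl⟩
    · exact hne h1
    · exact ((isTournament_before _).2 _ _ h.fst.ne).mp h.fst.before h'.fst.before
  have hw : onVertex x'.π (onVertex x'.ι p) = onVertex x'.π (onVertex x'.ι b) := by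
    rw [← onVertex_comp, ← onVertex_comp, x'.ι_π, ← x.ι_π, onVertex_comp, onVertex_comp,
      h.fst.eq]
  rcases h'.snd.unique _ _ hnv hw with h1 | h1
  · exact h1
  · refine absurd h'.snd.before ?_
    rw [← h1.1, ← h1.2]
    exact h.fst.sibling.not_before x'.ι

/-- If the first steps merge the same pair, the factorisations differ in the order of `q` and `e`.
Otherwise each merges first what the other merges second, so that `p` and `q` trade places. Either
way the final arrangements differ by one transposition. -/
theorem sgn_mul_sgn_eq_neg {x x' : Factorisation w} (hne : x ≠ x') (h1 : HasDegree x.ι 1)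
    (h2 : HasDegree x.π 1) (h1' : HasDegree x'.ι 1) (h2' : HasDegree x'.π 1) :
    sgn x.ι * sgn x.π = -(sgn x'.ι * sgn x'.π) := by
  classical
  obtain ⟨p, b, q, e, h⟩ := exists_mergesPairs _ _ h1 h2
  obtain ⟨p', b', q', e', h'⟩ := exists_mergesPairs _ _ h1' h2'
  have ht := h.isTournament
  have ht' := h'.isTournament
  have hdeg : x.mid.deg = x'.mid.deg := by
    unfold HasDegree at h1 h1'
    omega
  rw [h.sgn_mul_sgn, h'.sgn_mul_sgn]
  rw [x.ι_π] at ht ⊢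
  rw [x'.ι_π] at ht' ⊢
  suffices hodd : Odd (inversions (putTwoFirst w p q) (putTwoFirst w p' q')) by
    rw [← inversions_add (isTournament_before τ) ht ht', hodd.neg_one_pow]
    ring
  by_cases hpb : p = p' ∧ b = b'
  · obtain ⟨rfl, rfl⟩ := hpb
    have hw : onVertex w q = onVertex w e := by
      have := h.app_eq
      rwa [x.ι_π] at this
    have hqe : q ≠ e := fun he => h.snd.ne (by rw [he])
    rcases h'.eq_of_app_eq h.left_ne h.right_ne hqe (by rw [x'.ι_π]; exact hw) with
      ⟨rfl, rfl⟩ | ⟨rfl, rfl⟩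
    · exact absurd (eq_of_mergesPairs hdeg h h') hne
    · exact odd_inversions_swap ht hqe (putTwoFirst_swap_right w h.left_ne h.right_ne hw)
  · obtain ⟨g1, g2⟩ := h.onVertex_eq h' hpb
    obtain ⟨g1', g2'⟩ := h'.onVertex_eq h fun h => hpb ⟨h.1.symm, h.2.symm⟩
    -- With `p = p'`, the siblings `b` and `b'` would appear in opposite strict orders in the two
    -- middle trees, against monotonicity on fibres.
    have hpp : p ≠ p' := by
      rintro rfl
      have hb : b ≠ b' := fun h => hpb ⟨rfl, h⟩
      have k1 : x.mid.Before (onVertex x.ι b) (onVertex x.ι b') := by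
        rw [g2', ← h.fst.eq, g1']
        exact h.snd.before
      have k2 : x'.mid.Before (onVertex x'.ι b') (onVertex x'.ι b) := by
        rw [g2, ← h'.fst.eq, g1]
        exact h'.snd.before
      rcases h.fst.sibling.total h'.fst.sibling with hs | hs
      · exact hs.not_before _ k2
      · exact hs.not_before _ k1
    obtain rfl : p = q' := h'.fst.injOn _ _ hpp h'.left_ne g1
    obtain rfl : p' = q := h.fst.injOn _ _ hpp.symm h.left_ne g1'
    exact odd_inversions_swap ht hpp (putTwoFirst_swap w hpp.symm)

-- In degree two, the factorisation through `τ` is matched upwards and the one through `σ`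
-- downwards. A factorisation of intermediate degree must be the partner of one of these, so there
-- are exactly two of them and their signs cancel.
open Classical in
theorem sum_sgn_mul_sgn (w : τ ⟶ σ) :
    ∑ x : Factorisation w with HasDegree x.ι 1 ∧ HasDegree x.π 1, sgn x.ι * sgn x.π = 0 := by
  by_cases hw : HasDegree w 2
  swap
  · refine Finset.sum_eq_zero fun x hx => absurd ?_ hw
    simp only [Finset.mem_filter, Finset.mem_univ, true_and] at hx
    unfold HasDegree at hx ⊢
    omega
  unfold HasDegree at hw
  obtain ⟨Low, up, r, hup, hcov, hsurj, hr⟩ := exists_matching w (by omega)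
  have hle : ∀ x : Factorisation w, x.mid.deg ≤ τ.deg := fun x => deg_le x.ι
  have hge : ∀ x : Factorisation w, σ.deg ≤ x.mid.deg := fun x => deg_le x.π
  let bot : Factorisation w := ⟨τ, 𝟙 τ, w, Category.id_comp w⟩
  let top : Factorisation w := ⟨σ, w, 𝟙 σ, Category.comp_id w⟩
  have hbot : ∀ x : Factorisation w, x.mid.deg = τ.deg → bot = x := fun x hx =>
    Refines.eq_of_deg_eq ⟨x.ι, Category.id_comp _⟩ hx.symm
  have htop : ∀ x : Factorisation w, x.mid.deg = σ.deg → x = top := fun x hx =>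
    Refines.eq_of_deg_eq ⟨x.π, x.ι_π⟩ hx
  have hlb : Low bot := by
    by_contra hn
    obtain ⟨y, hy, he⟩ := hsurj bot hn
    have h1 := (hcov y hy).2
    have h2 := hle y
    rw [he] at h1
    change y.mid.deg = τ.deg + 1 at h1
    omega
  have hlt : ¬ Low top := fun hl => by
    have h1 := (hcov top hl).2
    have h2 := hge (up top)
    change σ.deg = _ at h1
    omega
  obtain ⟨y, hy, hyt⟩ := hsurj top hlt
  have h1 : τ.deg = (up bot).mid.deg + 1 := (hcov bot hlb).2
  have h2 : y.mid.deg = σ.deg + 1 := by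
    have := (hcov y hy).2
    rwa [hyt] at this
  have hinj : ∀ y', Low y' → up y' = top → y' = y := by
    intro y' hy' hyt'
    by_contra hne
    have := hr y y' hy hy' hne (by rw [hyt, ← hyt']; exact hcov y' hy')
    have := hr y' y hy' hy (Ne.symm hne) (by rw [hyt', ← hyt]; exact hcov y hy)
    omega
  have hne : up bot ≠ y := fun he => hup bot hlb (he ▸ hy)
  have hfilter : (Finset.univ.filter fun x : Factorisation w =>
      HasDegree x.ι 1 ∧ HasDegree x.π 1) = {up bot, y} := by
    ext x
    simp only [Finset.mem_filter, Finset.mem_univ, true_and, Finset.mem_insert,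
      Finset.mem_singleton]
    unfold HasDegree
    constructor
    · rintro ⟨hx1, hx2⟩
      by_cases hx : Low x
      · right
        refine hinj x hx (htop _ ?_)
        have := (hcov x hx).2
        omega
      · left
        obtain ⟨z, hz, rfl⟩ := hsurj x hx
        have := (hcov z hz).2
        rw [hbot z (by omega)]
    · rintro (rfl | rfl)
      · exact ⟨h1, by omega⟩
      · exact ⟨by omega, h2⟩
  rw [hfilter, Finset.sum_pair hne]
  rw [sgn_mul_sgn_eq_neg hne h1 (by unfold HasDegree; omega) (by unfold HasDegree; omega) h2]
  ring

end DegreeTwo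

/-! ### Acyclic matchings -/

/-- A differential with an acyclic matching of the basis elements is exact. -/
theorem exists_preimage_of_matching {k P : Type*} [CommRing k] [Finite P]
    (D : (P →₀ k) →ₗ[k] (P →₀ k)) (hD : ∀ x, D (D x) = 0) (Low : P → Prop) (up : P → P) (r : P → ℕ)
    (hunit : ∀ y, Low y → IsUnit (D (Finsupp.single (up y) 1) y))
    (hsurj : ∀ x, ¬ Low x → ∃ y, Low y ∧ up y = x)
    (hr : ∀ y y', Low y → Low y' → y' ≠ y → D (Finsupp.single (up y) 1) y' ≠ 0 → r y < r y')
    (x : P →₀ k) (hx : D x = 0) : ∃ z, D z = x := by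
  classical
  have := Fintype.ofFinite P
  -- The coordinates on `Low` are cleared in the order of increasing `r`: a correction along `up y`
  -- affects, besides `y`, only `Low` coordinates with larger `r`.
  have step : ∀ m : ℕ, ∃ z, ∀ y, Low y → r y < m → (x - D z) y = 0 := by
    intro m
    induction m with
    | zero => exact ⟨0, fun y _ h => absurd h (Nat.not_lt_zero _)⟩
    | succ m ih =>
      obtain ⟨z, hz⟩ := ih
      choose! c hc using fun y hy => (hunit y hy).exists_left_inv
      refine ⟨z + ∑ y with Low y ∧ r y = m,
        ((x - D z) y * c y) • Finsupp.single (up y) (1 : k), fun y hy hm => ?_⟩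
      rw [map_add, ← sub_sub, Finsupp.sub_apply, map_sum, Finsupp.finsetSum_apply, sub_eq_zero]
      simp only [map_smul, Finsupp.smul_apply, smul_eq_mul]
      by_cases hym : r y = m
      · rw [Finset.sum_eq_single y]
        · rw [mul_assoc, hc y hy, mul_one]
        · intro y' hy' hne
          simp only [Finset.mem_filter, Finset.mem_univ, true_and] at hy'
          by_contra hzero
          have := hr y' y hy'.1 hy hne.symm fun h => hzero (by rw [h, mul_zero])
          omega
        · intro hn
          exact absurd (by simp [hy, hym]) hn
      · rw [hz y hy (by omega), Finset.sum_eq_zero]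
        intro y' hy'
        simp only [Finset.mem_filter, Finset.mem_univ, true_and] at hy'
        by_contra hzero
        have := hr y' y hy'.1 hy (by rintro rfl; exact hym hy'.2)
          fun h => hzero (by rw [h, mul_zero])
        omega
  obtain ⟨z, hz⟩ := step (Finset.univ.sup r + 1)
  have hlow : ∀ y, Low y → (x - D z) y = 0 := fun y hy =>
    hz y hy (Nat.lt_succ_of_le (Finset.le_sup (Finset.mem_univ y)))
  set v := x - D z with hv
  have hDv : D v = 0 := by rw [hv, map_sub, hx, hD, sub_zero]
  -- `v` is a cycle that vanishes on `Low`. At `y`, its boundary involves `up y` with a unit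
  -- coefficient and otherwise only partners of elements with smaller `r`, where `v` is already
  -- known to vanish.
  have key : ∀ m y, Low y → r y < m → v (up y) = 0 := by
    intro m
    induction m with
    | zero => exact fun y _ h => absurd h (Nat.not_lt_zero _)
    | succ m ih =>
      intro y hy hm
      have hsum : D v y = ∑ p, v p * D (Finsupp.single p 1) y := by
        conv_lhs => rw [← Finsupp.univ_sum_single v]
        rw [map_sum, Finsupp.finsetSum_apply]
        refine Finset.sum_congr rfl fun p _ => ?_
        rw [← smul_eq_mul, ← Finsupp.smul_apply, ← map_smul, Finsupp.smul_single_one]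
      rw [hDv, Finset.sum_eq_single (up y)] at hsum
      · exact (hunit y hy).mul_left_eq_zero.mp hsum.symm
      · intro p _ hp
        by_cases hlp : Low p
        · rw [hlow p hlp, zero_mul]
        · obtain ⟨y', hy', rfl⟩ := hsurj p hlp
          by_contra hzero
          have hlt := hr y' y hy' hy (fun h => hp (by rw [h]))
            fun h => hzero (by rw [h, mul_zero])
          exact hzero (by rw [ih y' hy' (by omega), zero_mul])
      · exact fun h => absurd (Finset.mem_univ _) h
  refine ⟨z, ?_⟩
  have hv0 : v = 0 := Finsupp.ext fun p => by
    by_cases hp : Low p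
    · exact hlow p hp
    · obtain ⟨y, hy, rfl⟩ := hsurj p hp
      exact key _ y hy (Nat.lt_succ_self _)
  exact (sub_eq_zero.mp (hv.symm.trans hv0)).symm

/-! ### The Koszul complex with coefficients -/

section TwoStep

variable (k : Type w) [CommRing k] {τ σ : PrunedTree n}

/-- A morphism from `τ` to `σ` with a factorisation. -/
abbrev TwoStep (τ σ : PrunedTree n) : Type := Σ u : τ ⟶ σ, Factorisation u

/-- The factorisation obtained by splitting the first factor of a factorisation. -/
def TwoStep.split (t : TwoStep τ σ) (f : Factorisation t.2.ι) : TwoStep τ σ :=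
  ⟨t.1, f.mid, f.ι, f.π ≫ t.2.π, by rw [← Category.assoc, f.ι_π, t.2.ι_π]⟩

open Classical in
/-- The differential of the Koszul complex with coefficients, which splits morphisms of
degree one off the first factor. -/
noncomputable def koszulDifferential (τ σ : PrunedTree n) :
    (TwoStep τ σ →₀ k) →ₗ[k] (TwoStep τ σ →₀ k) :=
  Finsupp.linearCombination k fun t =>
    ∑ f : Factorisation t.2.ι with HasDegree f.π 1,
      Finsupp.single (t.split f) ((sgn f.π : ℤ) : k)

open Classical in
theorem koszulDifferential_single (t : TwoStep τ σ) :
    koszulDifferential k τ σ (Finsupp.single t 1) =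
      ∑ f : Factorisation t.2.ι with HasDegree f.π 1,
        Finsupp.single (t.split f) ((sgn f.π : ℤ) : k) := by
  rw [koszulDifferential, Finsupp.linearCombination_single, one_smul]

/-- The two ways of iterating factorisations agree. -/
def factorisationEquiv (β : τ ⟶ σ) :
    (Σ f : Factorisation β, Factorisation f.ι) ≃ Σ h : Factorisation β, Factorisation h.π where
  toFun p := ⟨⟨p.2.mid, p.2.ι, p.2.π ≫ p.1.π, by rw [← Category.assoc, p.2.ι_π, p.1.ι_π]⟩,
    ⟨p.1.mid, p.2.π, p.1.π, rfl⟩⟩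
  invFun p := ⟨⟨p.2.mid, p.1.ι ≫ p.2.ι, p.2.π, by rw [Category.assoc, p.2.ι_π, p.1.ι_π]⟩,
    ⟨p.1.mid, p.1.ι, p.2.ι, rfl⟩⟩
  left_inv := by
    rintro ⟨⟨Y, ι, π, h⟩, (⟨X, a, b, rfl⟩ : Factorisation ι)⟩
    rfl
  right_inv := by
    rintro ⟨⟨X, a, c, h⟩, (⟨Y, b, d, rfl⟩ : Factorisation c)⟩
    rfl

/-- Double splittings are grouped by the first factor that remains in the end. The coefficient of
each group is the sum of sign products over the factorisations of one morphism into two of degree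
one. -/
theorem koszulDifferential_comp_self (x : TwoStep τ σ →₀ k) :
    koszulDifferential k τ σ (koszulDifferential k τ σ x) = 0 := by
  classical
  suffices h : koszulDifferential k τ σ ∘ₗ koszulDifferential k τ σ = 0 from
    LinearMap.congr_fun h x
  refine Finsupp.lhom_ext' fun t => LinearMap.ext_ring ?_
  simp only [LinearMap.comp_apply, Finsupp.lsingle_apply, LinearMap.zero_apply]
  rw [koszulDifferential_single, map_sum]
  have h1 : ∀ f : Factorisation t.2.ι,
      koszulDifferential k τ σ (Finsupp.single (t.split f) ((sgn f.π : ℤ) : k)) =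
        ∑ g : Factorisation f.ι with HasDegree g.π 1,
          Finsupp.single ((t.split f).split g) (((sgn f.π * sgn g.π : ℤ)) : k) := fun f => by
    rw [← Finsupp.smul_single_one, map_smul, koszulDifferential_single, Finset.smul_sum]
    refine Finset.sum_congr rfl fun g _ => ?_
    rw [Finsupp.smul_single, smul_eq_mul, Int.cast_mul]
    rfl
  simp only [h1]
  rw [Finset.sum_sigma']
  rw [Finset.sum_equiv (factorisationEquiv t.2.ι)
    (t := Finset.univ.sigma fun h => Finset.univ.filter fun q : Factorisation h.π =>
      HasDegree q.ι 1 ∧ HasDegree q.π 1)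
    (g := fun p => Finsupp.single (t.split p.1) (((sgn p.2.ι * sgn p.2.π : ℤ)) : k))]
  · rw [Finset.sum_sigma]
    refine Finset.sum_eq_zero fun h _ => ?_
    dsimp only
    rw [← Finsupp.single_finsetSum, ← Int.cast_sum, sum_sgn_mul_sgn, Int.cast_zero,
      Finsupp.single_zero]
  · rintro ⟨f, g⟩
    simp [factorisationEquiv, and_comm]
  · rintro ⟨f, g⟩ -
    have : (t.split f).split g = t.split (factorisationEquiv t.2.ι ⟨f, g⟩).1 := by
      simp [TwoStep.split, factorisationEquiv]
    rw [this]
    simp [factorisationEquiv, mul_comm]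

theorem covers_of_split_eq {u : τ ⟶ σ} {x y : Factorisation u} {f : Factorisation x.ι}
    (hf : HasDegree f.π 1) (h : TwoStep.split ⟨u, x⟩ f = ⟨u, y⟩) : Covers y x := by
  obtain rfl := eq_of_heq (Sigma.mk.inj h).2
  exact ⟨⟨f.π, f.ι_π⟩, hf⟩

theorem eq_of_split_eq {u : τ ⟶ σ} {x y : Factorisation u} (e : y.mid ⟶ x.mid)
    (he : y.ι ≫ e = x.ι) {f : Factorisation x.ι} (h : TwoStep.split ⟨u, x⟩ f = ⟨u, y⟩) :
    f = ⟨y.mid, y.ι, e, he⟩ := by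
  obtain rfl := eq_of_heq (Sigma.mk.inj h).2
  obtain rfl : e = f.π := by
    rw [← cancel_epi f.ι, f.ι_π]
    exact he
  rfl

/-- The composite `u` is preserved by the differential, so the matchings for the various `u` combine
to one on all pairs; the coefficient along a matched pair is a sign. -/
theorem koszulDifferential_exact (h : σ.deg < τ.deg) (x : TwoStep τ σ →₀ k)
    (hx : koszulDifferential k τ σ x = 0) : ∃ z, koszulDifferential k τ σ z = x := by
  classical
  choose Low up r h1 h2 h3 h4 using fun u : τ ⟶ σ => exists_matching u h
  refine exists_preimage_of_matching (koszulDifferential k τ σ) (koszulDifferential_comp_self k)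
    (fun t => Low t.1 t.2) (fun t => ⟨t.1, up t.1 t.2⟩) (fun t => r t.1 t.2) ?_ ?_ ?_ x hx
  · rintro ⟨u, y⟩ hy
    obtain ⟨⟨e, he⟩, hdeg⟩ := h2 u y hy
    have hπ := Refines.comp_π he
    let f₀ : Factorisation (up u y).ι := ⟨y.mid, y.ι, e, he⟩
    rw [koszulDifferential_single, Finsupp.finsetSum_apply, Finset.sum_eq_single f₀]
    · have : TwoStep.split ⟨u, up u y⟩ f₀ = ⟨u, y⟩ := by
        simp [TwoStep.split, f₀, hπ]
      rw [this, Finsupp.single_eq_same]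
      exact (isUnit_sgn e).map (Int.castRingHom k)
    · exact fun f _ hne => Finsupp.single_eq_of_ne fun hf => hne (eq_of_split_eq e he hf.symm)
    · intro hn
      exact absurd (Finset.mem_filter.mpr ⟨Finset.mem_univ f₀, hdeg⟩) hn
  · rintro ⟨u, x⟩ hx
    obtain ⟨y, hy, rfl⟩ := h3 u x hx
    exact ⟨⟨u, y⟩, hy, rfl⟩
  · rintro ⟨u, y⟩ ⟨u', y'⟩ hy hy' hne hD
    rw [koszulDifferential_single, Finsupp.finsetSum_apply] at hD
    obtain ⟨f, hf, hD⟩ := Finset.exists_ne_zero_of_sum_ne_zero hD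
    have hs : TwoStep.split ⟨u, up u y⟩ f = ⟨u', y'⟩ := by
      by_contra hs
      exact hD (Finsupp.single_eq_of_ne (Ne.symm hs))
    obtain rfl : u = u' := congrArg Sigma.fst hs
    exact h4 u y y' hy hy' (fun he => hne (by rw [he]))
      (covers_of_split_eq (Finset.mem_filter.mp hf).2 hs)

end TwoStep

/-! ### The bar construction, split according to the first morphism of a tuple -/

section Bar

variable (k : Type w) [CommRing k] {τ θ σ : PrunedTree n}

theorem not_isIdentity_of_hasDegree_one {u : τ ⟶ σ} (h : HasDegree u 1) : ¬ IsIdentity u := by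
  rw [isIdentity_iff]
  unfold HasDegree at h
  omega

theorem deg_lt_of_not_isIdentity {u : τ ⟶ σ} (h : ¬ IsIdentity u) : σ.deg < τ.deg :=
  lt_of_le_of_ne (deg_le u) fun he => h ((isIdentity_iff u).mpr he.symm)

theorem not_isIdentity_comp_of_left (v : τ ⟶ θ) (u : θ ⟶ σ) (hv : ¬ IsIdentity v) :
    ¬ IsIdentity (v ≫ u) := by
  rw [isIdentity_iff]
  exact ((deg_le u).trans_lt (deg_lt_of_not_isIdentity hv)).ne'

theorem BarChain.deg_add_le : ∀ {d : ℕ} {τ σ : PrunedTree n}, BarChain d τ σ → σ.deg + d ≤ τ.deg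
  | _, _, _, nil _ => le_rfl
  | _, _, _, cons _ hu c => by
    have := c.deg_add_le
    have := deg_lt_of_not_isIdentity hu
    omega

theorem BarChain.cons_injective {d : ℕ} (u : θ ⟶ σ) (hu : ¬ IsIdentity u) :
    Function.Injective (BarChain.cons u hu : BarChain d τ θ → BarChain (d + 1) τ σ) :=
  fun c c' h => by
    injection h

/-- Compose the first morphism of a tuple with `u`. -/
def BarChain.merge {d : ℕ} (u : θ ⟶ σ) : BarChain (d + 1) τ θ → BarChain (d + 1) τ σ
  | cons v hv c => cons (v ≫ u) (not_isIdentity_comp_of_left v u hv) c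

open Classical in
/-- The linear extension of `BarChain.cons`, and zero for an identity. -/
noncomputable def consMap {d : ℕ} (u : θ ⟶ σ) :
    (BarChain d τ θ →₀ k) →ₗ[k] (BarChain (d + 1) τ σ →₀ k) :=
  if h : ¬ IsIdentity u then Finsupp.lmapDomain k k (BarChain.cons u h) else 0

/-- The linear extension of `BarChain.merge`. -/
noncomputable def mergeMap {d : ℕ} (u : θ ⟶ σ) :
    (BarChain (d + 1) τ θ →₀ k) →ₗ[k] (BarChain (d + 1) τ σ →₀ k) :=
  Finsupp.lmapDomain k k (BarChain.merge u)

theorem consMap_single {d : ℕ} (u : θ ⟶ σ) (h : ¬ IsIdentity u) (c : BarChain d τ θ) (r : k) :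
    consMap k u (Finsupp.single c r) = Finsupp.single (BarChain.cons u h c) r := by
  rw [consMap, dif_pos h, Finsupp.lmapDomain_apply, Finsupp.mapDomain_single]

theorem mergeMap_consMap {d : ℕ} {ρ : PrunedTree n} (v : ρ ⟶ θ) (u : θ ⟶ σ) (hv : ¬ IsIdentity v)
    (x : BarChain d τ ρ →₀ k) : mergeMap k u (consMap k v x) = consMap k (v ≫ u) x := by
  suffices h : mergeMap k u ∘ₗ consMap k v = consMap k (d := d) (τ := τ) (v ≫ u) from
    LinearMap.congr_fun h x
  refine Finsupp.lhom_ext fun c r => ?_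
  rw [LinearMap.comp_apply, consMap_single k v hv,
    consMap_single k _ (not_isIdentity_comp_of_left v u hv), mergeMap, Finsupp.lmapDomain_apply,
    Finsupp.mapDomain_single, BarChain.merge]

theorem BarChain.face_zero_cons {d : ℕ} (u : θ ⟶ σ) (hu : ¬ IsIdentity u)
    (c : BarChain (d + 1) τ θ) : (BarChain.cons u hu c).face 0 = c.merge u := by
  cases c
  cases d <;> rfl

/-- The first face composes `u` with the next morphism; the other faces act on the rest with their
index shifted by one, whence the second minus sign. -/
theorem barDifferential_consMap {d : ℕ} (u : θ ⟶ σ) (hu : ¬ IsIdentity u)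
    (x : BarChain (d + 1) τ θ →₀ k) :
    barDifferential k τ σ (d + 1) (consMap k u x) =
      -mergeMap k u x - consMap k u (barDifferential k τ θ d x) := by
  suffices h : barDifferential k τ σ (d + 1) ∘ₗ consMap k u =
      -mergeMap k u - consMap k u ∘ₗ barDifferential k τ θ d from LinearMap.congr_fun h x
  refine Finsupp.lhom_ext fun c r => ?_
  simp only [LinearMap.comp_apply, LinearMap.sub_apply, LinearMap.neg_apply,
    consMap_single k u hu]
  rw [barDifferential, LinearMap.sum_apply, Fin.sum_univ_succ]
  simp only [LinearMap.smul_apply, Finsupp.lmapDomain_apply, Finsupp.mapDomain_single,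
    BarChain.face_zero_cons, mergeMap, Fin.val_zero, zero_add, pow_one, neg_smul, one_smul,
    sub_eq_add_neg]
  congr 1
  cases d with
  | zero => simp [barDifferential]
  | succ d =>
    rw [barDifferential, LinearMap.sum_apply, map_sum, ← Finset.sum_neg_distrib]
    refine Finset.sum_congr rfl fun i _ => ?_
    simp only [LinearMap.smul_apply, Finsupp.lmapDomain_apply, Finsupp.mapDomain_single, map_smul,
      consMap_single k u hu, Fin.val_succ, ← neg_smul]
    rw [pow_succ, mul_neg_one]
    rfl

/-- The possible first morphisms of a tuple. -/
abbrev Outer (τ σ : PrunedTree n) : Type :=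
  Σ θ : {θ : PrunedTree n // ∀ i, θ.size i ≤ τ.size i}, {u : θ.1 ⟶ σ // ¬ IsIdentity u}

instance (τ σ : PrunedTree n) : Finite (Outer τ σ) :=
  have := BarChain.finite_bounded τ.size
  inferInstance

noncomputable instance (τ σ : PrunedTree n) : Fintype (Outer τ σ) := Fintype.ofFinite _

/-- The part of a chain that consists of the tuples with a given first morphism. -/
noncomputable def component {d : ℕ} (a : Outer τ σ) :
    (BarChain (d + 1) τ σ →₀ k) →ₗ[k] (BarChain d τ a.1.1 →₀ k) :=
  Finsupp.lcomapDomain (BarChain.cons a.2.1 a.2.2) (BarChain.cons_injective a.2.1 a.2.2)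

theorem component_apply {d : ℕ} (a : Outer τ σ) (x : BarChain (d + 1) τ σ →₀ k)
    (c : BarChain d τ a.1.1) : component k a x c = x (BarChain.cons a.2.1 a.2.2 c) := rfl

theorem BarChain.exists_outer {d : ℕ} (c : BarChain (d + 1) τ σ) :
    ∃ (a : Outer τ σ) (c' : BarChain d τ a.1.1), c = BarChain.cons a.2.1 a.2.2 c' := by
  cases c with
  | cons u hu c => exact ⟨⟨⟨_, size_le c.comp⟩, ⟨u, hu⟩⟩, c, rfl⟩

theorem component_ext {d : ℕ} {x y : BarChain (d + 1) τ σ →₀ k}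
    (h : ∀ a, component k a x = component k a y) : x = y := by
  ext c
  obtain ⟨a, c', rfl⟩ := c.exists_outer
  exact DFunLike.congr_fun (h a) c'

theorem component_consMap_self {d : ℕ} (a : Outer τ σ) (x : BarChain d τ a.1.1 →₀ k) :
    component k a (consMap k a.2.1 x) = x := by
  ext c
  rw [component_apply, consMap, dif_pos a.2.2, Finsupp.lmapDomain_apply,
    Finsupp.mapDomain_apply (BarChain.cons_injective _ _)]

theorem Outer.eq_of_cons_eq {d : ℕ} {a b : Outer τ σ} {c : BarChain d τ a.1.1}
    {c' : BarChain d τ b.1.1}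
    (h : BarChain.cons a.2.1 a.2.2 c = BarChain.cons b.2.1 b.2.2 c') : a = b := by
  obtain ⟨⟨θ, hθ⟩, u, hu⟩ := a
  obtain ⟨⟨θ', hθ'⟩, u', hu'⟩ := b
  dsimp only at c c' h
  injection h with _ _ h1 _ h2
  subst h1
  obtain rfl := eq_of_heq h2
  rfl

theorem component_consMap_of_ne {d : ℕ} {a b : Outer τ σ} (h : a ≠ b)
    (x : BarChain d τ b.1.1 →₀ k) : component k a (consMap k b.2.1 x) = 0 := by
  ext c
  rw [component_apply, consMap, dif_pos b.2.2, Finsupp.lmapDomain_apply,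
    Finsupp.mapDomain_of_notMem_range, Finsupp.zero_apply]
  rintro ⟨c', hc'⟩
  exact h (Outer.eq_of_cons_eq hc').symm

theorem component_sum_consMap {d : ℕ} (e : ∀ a : Outer τ σ, BarChain d τ a.1.1 →₀ k)
    (a : Outer τ σ) : component k a (∑ b, consMap k b.2.1 (e b)) = e a := by
  rw [map_sum, Finset.sum_eq_single a, component_consMap_self]
  · exact fun b _ hb => component_consMap_of_ne k hb.symm _
  · exact fun h => absurd (Finset.mem_univ _) h

theorem sum_consMap_component {d : ℕ} (x : BarChain (d + 1) τ σ →₀ k) :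
    ∑ a : Outer τ σ, consMap k a.2.1 (component k a x) = x :=
  component_ext k fun a => component_sum_consMap k _ a

/-- Composing the first morphism with a non-identity strictly raises the degree of its source. The
bar differential is thus triangular with respect to this degree. -/
theorem component_mergeMap {d : ℕ} {a b : Outer τ σ} (h : a.1.1.deg ≤ b.1.1.deg)
    (x : BarChain (d + 1) τ b.1.1 →₀ k) : component k a (mergeMap k b.2.1 x) = 0 := by
  ext c
  rw [component_apply, mergeMap, Finsupp.lmapDomain_apply, Finsupp.mapDomain_of_notMem_range,
    Finsupp.zero_apply]
  rintro ⟨c', hc'⟩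
  cases c' with
  | cons v hv c' =>
    rw [BarChain.merge] at hc'
    have := deg_lt_of_not_isIdentity hv
    injection hc' with _ _ h1
    rw [h1] at this
    omega

/-- The lowest component of a boundary. -/
theorem component_barDifferential {d : ℕ} (x : BarChain (d + 2) τ σ →₀ k) (a : Outer τ σ)
    (h : ∀ b : Outer τ σ, b.1.1.deg < a.1.1.deg → component k b x = 0) :
    component k a (barDifferential k τ σ (d + 1) x) =
      -barDifferential k τ a.1.1 d (component k a x) := by
  have hx : barDifferential k τ σ (d + 1) x = ∑ b : Outer τ σ,
      barDifferential k τ σ (d + 1) (consMap k b.2.1 (component k b x)) := by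
    rw [← map_sum, sum_consMap_component]
  rw [hx, map_sum, Finset.sum_eq_single a]
  · rw [barDifferential_consMap k _ a.2.2, map_sub, map_neg, component_mergeMap k le_rfl,
      component_consMap_self, neg_zero, zero_sub]
  · intro b _ hb
    rw [barDifferential_consMap k _ b.2.2, map_sub, map_neg, component_consMap_of_ne k hb.symm]
    rcases lt_or_ge b.1.1.deg a.1.1.deg with hlt | hge
    · rw [h b hlt, map_zero, map_zero, neg_zero, sub_zero]
    · rw [component_mergeMap k hge, neg_zero, sub_zero]
  · exact fun h => absurd (Finset.mem_univ _) h

/-! ### The map from the Koszul construction to the bar construction -/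

open Classical in
/-- The image in the bar construction of the generator of the Koszul construction given by `u`. -/
noncomputable def decompositions (d : ℕ) (u : τ ⟶ σ) : BarChain d τ σ →₀ k :=
  ∑ c : BarChain d τ σ with c.AllDegreeOne ∧ c.comp = u, Finsupp.single c ((c.sgn : ℤ) : k)

theorem koszulToBar_single (d : ℕ) (u : {u : τ ⟶ σ // HasDegree u d}) (r : k) :
    koszulToBar k τ σ d (Finsupp.single u r) = r • decompositions k d u.1 := by
  rw [koszulToBar, Finsupp.linearCombination_single]
  rfl

theorem BarChain.sigma_eq_of_cons_eq {d : ℕ} {u : τ ⟶ σ} {f f' : Factorisation u}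
    {c : BarChain d τ f.mid} {c' : BarChain d τ f'.mid} (hc : c.comp = f.ι) (hc' : c'.comp = f'.ι)
    {h : ¬ IsIdentity f.π} {h' : ¬ IsIdentity f'.π}
    (he : BarChain.cons f.π h c = BarChain.cons f'.π h' c') :
    (⟨f, c⟩ : Σ f : Factorisation u, BarChain d τ f.mid) = ⟨f', c'⟩ := by
  obtain ⟨X, a, b, hf⟩ := f
  obtain ⟨X', a', b', hf'⟩ := f'
  dsimp only at c c' hc hc' he
  subst hc hc'
  injection he with _ _ h1 _ h2 h3
  subst h1
  obtain rfl := eq_of_heq h2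
  obtain rfl := eq_of_heq h3
  rfl

open Classical in
theorem decompositions_succ (d : ℕ) (u : τ ⟶ σ) :
    decompositions k (d + 1) u = ∑ f : Factorisation u with HasDegree f.π 1,
      ((sgn f.π : ℤ) : k) • consMap k f.π (decompositions k d f.ι) := by
  simp only [decompositions, map_sum, Finset.smul_sum]
  rw [Finset.sum_sigma']
  symm
  refine Finset.sum_bij (fun p hp => BarChain.cons p.1.π (not_isIdentity_of_hasDegree_one
    (Finset.mem_filter.mp (Finset.mem_sigma.mp hp).1).2) p.2) ?_ ?_ ?_ ?_
  · rintro ⟨f, c⟩ hp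
    simp only [Finset.mem_sigma, Finset.mem_filter, Finset.mem_univ, true_and] at hp ⊢
    refine ⟨⟨hp.1, hp.2.1⟩, ?_⟩
    rw [BarChain.comp, hp.2.2, f.ι_π]
  · rintro ⟨f, c⟩ hp ⟨f', c'⟩ hp' he
    simp only [Finset.mem_sigma, Finset.mem_filter, Finset.mem_univ, true_and] at hp hp'
    exact BarChain.sigma_eq_of_cons_eq hp.2.2 hp'.2.2 he
  · intro c hc
    cases c with
    | cons v hv c =>
      simp only [Finset.mem_filter, Finset.mem_univ, true_and] at hc
      refine ⟨⟨⟨_, c.comp, v, hc.2⟩, c⟩, ?_, rfl⟩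
      simp only [Finset.mem_sigma, Finset.mem_filter, Finset.mem_univ, true_and]
      exact ⟨hc.1.1, hc.1.2, trivial⟩
  · rintro ⟨f, c⟩ hp
    rw [consMap_single k _ (not_isIdentity_of_hasDegree_one
      (Finset.mem_filter.mp (Finset.mem_sigma.mp hp).1).2), Finsupp.smul_single, smul_eq_mul,
      BarChain.sgn, Int.cast_mul]

/-- The map from the Koszul complex with coefficients to the bar construction. -/
noncomputable def twoStepToBar (d : ℕ) (τ σ : PrunedTree n) :
    (TwoStep τ σ →₀ k) →ₗ[k] (BarChain (d + 1) τ σ →₀ k) :=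
  Finsupp.linearCombination k fun t => consMap k t.2.π (decompositions k d t.2.ι)

theorem twoStepToBar_single (d : ℕ) (t : TwoStep τ σ) (r : k) :
    twoStepToBar k d τ σ (Finsupp.single t r) =
      r • consMap k t.2.π (decompositions k d t.2.ι) := by
  rw [twoStepToBar, Finsupp.linearCombination_single]

/-- The trivial factorisation of `u`, with second factor the identity. -/
def TwoStep.trivial (u : τ ⟶ σ) : TwoStep τ σ := ⟨u, σ, u, 𝟙 σ, Category.comp_id u⟩

theorem twoStepToBar_koszulDifferential_trivial (d : ℕ) (u : τ ⟶ σ) :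
    twoStepToBar k d τ σ (koszulDifferential k τ σ (Finsupp.single (TwoStep.trivial u) 1)) =
      decompositions k (d + 1) u := by
  classical
  rw [koszulDifferential_single, map_sum, decompositions_succ]
  refine Finset.sum_congr rfl fun f _ => ?_
  rw [twoStepToBar_single]
  simp only [TwoStep.split, TwoStep.trivial, Category.comp_id]
  rfl

/-- Splitting a morphism off the first factor and composing it into the second produces exactly the
first faces of the associated tuples. -/
theorem twoStepToBar_koszulDifferential_single (d : ℕ) (t : TwoStep τ σ) :
    twoStepToBar k d τ σ (koszulDifferential k τ σ (Finsupp.single t 1)) =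
      mergeMap k t.2.π (decompositions k (d + 1) t.2.ι) := by
  classical
  rw [koszulDifferential_single, map_sum, decompositions_succ, map_sum]
  refine Finset.sum_congr rfl fun f hf => ?_
  rw [twoStepToBar_single, map_smul, mergeMap_consMap]
  · rfl
  · exact not_isIdentity_of_hasDegree_one (Finset.mem_filter.mp hf).2

/-- Two linear maps that agree on the basis elements in `s` agree on the elements supported
in `s`. -/
theorem eq_of_mem_supported {P M : Type*} [AddCommGroup M] [Module k M] {s : Set P}
    {f g : (P →₀ k) →ₗ[k] M}
    (h : ∀ p ∈ s, f (Finsupp.single p 1) = g (Finsupp.single p 1)) {x : P →₀ k}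
    (hx : x ∈ Finsupp.supported k k s) : f x = g x := by
  rw [Finsupp.supported_eq_span_single] at hx
  refine LinearMap.eqOn_span (f := f) (g := g) ?_ hx
  rintro _ ⟨p, hp, rfl⟩
  exact h p hp

theorem map_mem_of_mem_supported {P M : Type*} [AddCommGroup M] [Module k M] {s : Set P}
    {f : (P →₀ k) →ₗ[k] M} {N : Submodule k M}
    (h : ∀ p ∈ s, f (Finsupp.single p 1) ∈ N) {x : P →₀ k}
    (hx : x ∈ Finsupp.supported k k s) : f x ∈ N := by
  rw [Finsupp.supported_eq_span_single] at hx
  refine Submodule.span_le (p := N.comap f) |>.mpr ?_ hx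
  rintro _ ⟨p, hp, rfl⟩
  exact h p hp

/-- The inner faces cancel by `hd`, which leaves the first face. Keeping `hd` as a hypothesis lets
this serve in the induction that proves it. -/
theorem barDifferential_twoStepToBar_of_cycle {d : ℕ}
    (hd : ∀ {θ : PrunedTree n} (u : τ ⟶ θ),
      barDifferential k τ θ d (decompositions k (d + 1) u) = 0)
    {x : TwoStep τ σ →₀ k} (hx : x ∈ Finsupp.supported k k {t | ¬ IsIdentity t.2.π}) :
    barDifferential k τ σ (d + 1) (twoStepToBar k (d + 1) τ σ x) =
      -twoStepToBar k d τ σ (koszulDifferential k τ σ x) := by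
  refine eq_of_mem_supported k (f := barDifferential k τ σ (d + 1) ∘ₗ twoStepToBar k (d + 1) τ σ)
    (g := -(twoStepToBar k d τ σ ∘ₗ koszulDifferential k τ σ)) (fun t ht => ?_) hx
  rw [LinearMap.comp_apply, LinearMap.neg_apply, LinearMap.comp_apply,
    twoStepToBar_koszulDifferential_single, twoStepToBar_single, one_smul,
    barDifferential_consMap k _ ht, hd, map_zero, sub_zero]

theorem koszulDifferential_single_mem (t : TwoStep τ σ) :
    koszulDifferential k τ σ (Finsupp.single t 1) ∈
      Finsupp.supported k k {s : TwoStep τ σ | ¬ IsIdentity s.2.π} := by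
  classical
  rw [koszulDifferential_single]
  refine Submodule.sum_mem _ fun f hf => Finsupp.single_mem_supported k _ ?_
  exact not_isIdentity_comp_of_left _ _
    (not_isIdentity_of_hasDegree_one (Finset.mem_filter.mp hf).2)

/-- The image of `u` comes from the Koszul boundary of the pair formed by `u` and an identity, so
its boundary is governed by the square of the Koszul differential. -/
theorem barDifferential_decompositions (d : ℕ) :
    ∀ {σ : PrunedTree n} (u : τ ⟶ σ),
      barDifferential k τ σ d (decompositions k (d + 1) u) = 0 := by
  induction d with
  | zero => exact fun u => rfl
  | succ d ih =>
    intro σ u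
    rw [← twoStepToBar_koszulDifferential_trivial, barDifferential_twoStepToBar_of_cycle k ih
      (koszulDifferential_single_mem k _), koszulDifferential_comp_self, map_zero, neg_zero]

theorem barDifferential_twoStepToBar (d : ℕ) {x : TwoStep τ σ →₀ k}
    (hx : x ∈ Finsupp.supported k k {t | ¬ IsIdentity t.2.π}) :
    barDifferential k τ σ (d + 1) (twoStepToBar k (d + 1) τ σ x) =
      -twoStepToBar k d τ σ (koszulDifferential k τ σ x) :=
  barDifferential_twoStepToBar_of_cycle k (barDifferential_decompositions k d) hx

/-! ### Injectivity -/

/-- Compose a morphism of degree `d` with the first morphism of a tuple. -/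
def Outer.toTwoStep (a : Outer τ σ) {d : ℕ} (β : {β : τ ⟶ a.1.1 // HasDegree β d}) :
    TwoStep τ σ := ⟨β.1 ≫ a.2.1, a.1.1, β.1, a.2.1, rfl⟩

theorem twoStepToBar_lmapDomain {d : ℕ} (a : Outer τ σ)
    (y : {β : τ ⟶ a.1.1 // HasDegree β d} →₀ k) :
    twoStepToBar k d τ σ (Finsupp.lmapDomain k k a.toTwoStep y) =
      consMap k a.2.1 (koszulToBar k τ a.1.1 d y) := by
  suffices h : twoStepToBar k d τ σ ∘ₗ Finsupp.lmapDomain k k a.toTwoStep =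
      consMap k a.2.1 ∘ₗ koszulToBar k τ a.1.1 d from LinearMap.congr_fun h y
  refine Finsupp.lhom_ext fun β r => ?_
  rw [LinearMap.comp_apply, LinearMap.comp_apply, Finsupp.lmapDomain_apply,
    Finsupp.mapDomain_single, twoStepToBar_single, koszulToBar_single, map_smul]
  rfl

theorem exists_eq_sum_lmapDomain {d : ℕ} {x : TwoStep τ σ →₀ k}
    (hx : x ∈ Finsupp.supported k k {t | ¬ IsIdentity t.2.π ∧ HasDegree t.2.ι d}) :
    ∃ y : ∀ a : Outer τ σ, {β : τ ⟶ a.1.1 // HasDegree β d} →₀ k,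
      x = ∑ a, Finsupp.lmapDomain k k a.toTwoStep (y a) := by
  classical
  let Φ : (∀ a : Outer τ σ, {β : τ ⟶ a.1.1 // HasDegree β d} →₀ k) →ₗ[k] (TwoStep τ σ →₀ k) :=
    ∑ a, Finsupp.lmapDomain k k a.toTwoStep ∘ₗ LinearMap.proj a
  have hΦ : ∀ y, Φ y = ∑ a, Finsupp.lmapDomain k k a.toTwoStep (y a) := fun y => by
    simp [Φ, LinearMap.sum_apply]
  have := map_mem_of_mem_supported k (f := LinearMap.id) (N := LinearMap.range Φ) ?_ hx
  · obtain ⟨y, hy⟩ := this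
    exact ⟨y, by rw [← hΦ, hy, LinearMap.id_apply]⟩
  · rintro ⟨u, θ, β, α, h⟩ ⟨h1, h2⟩
    subst h
    let a : Outer τ σ := ⟨⟨θ, size_le β⟩, α, h1⟩
    refine ⟨Pi.single a (Finsupp.single ⟨β, h2⟩ 1), ?_⟩
    rw [hΦ, Finset.sum_eq_single a]
    · rw [Pi.single_eq_same, Finsupp.lmapDomain_apply, Finsupp.mapDomain_single]
      rfl
    · intro b _ hb
      rw [Pi.single_eq_of_ne hb, map_zero]
    · exact fun h => absurd (Finset.mem_univ _) h

theorem eq_zero_of_twoStepToBar_eq_zero {d : ℕ}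
    (hd : ∀ (θ : PrunedTree n) (y : {β : τ ⟶ θ // HasDegree β d} →₀ k),
      koszulToBar k τ θ d y = 0 → y = 0) {x : TwoStep τ σ →₀ k}
    (hx : x ∈ Finsupp.supported k k {t | ¬ IsIdentity t.2.π ∧ HasDegree t.2.ι d})
    (h : twoStepToBar k d τ σ x = 0) : x = 0 := by
  obtain ⟨y, rfl⟩ := exists_eq_sum_lmapDomain k hx
  rw [map_sum] at h
  simp only [twoStepToBar_lmapDomain] at h
  refine Finset.sum_eq_zero fun a _ => ?_
  have := component_sum_consMap k (fun a : Outer τ σ => koszulToBar k τ a.1.1 d (y a)) a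
  rw [h, map_zero] at this
  rw [hd _ _ this.symm, map_zero]

theorem koszulDifferential_single_mem_of_hasDegree {d : ℕ} {t : TwoStep τ σ}
    (ht : HasDegree t.2.ι (d + 1)) : koszulDifferential k τ σ (Finsupp.single t 1) ∈
      Finsupp.supported k k {s : TwoStep τ σ | ¬ IsIdentity s.2.π ∧ HasDegree s.2.ι d} := by
  classical
  rw [koszulDifferential_single]
  refine Submodule.sum_mem _ fun f hf => Finsupp.single_mem_supported k _ ?_
  have hf' := (Finset.mem_filter.mp hf).2
  refine ⟨not_isIdentity_comp_of_left _ _ (not_isIdentity_of_hasDegree_one hf'), ?_⟩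
  change τ.deg = f.mid.deg + d
  unfold HasDegree at ht hf'
  omega

theorem koszulDifferential_single_mem_of_not_hasDegree {d : ℕ} {t : TwoStep τ σ}
    (ht : ¬ HasDegree t.2.ι (d + 1)) : koszulDifferential k τ σ (Finsupp.single t 1) ∈
      Finsupp.supported k k {s : TwoStep τ σ | ¬ HasDegree s.2.ι d} := by
  classical
  rw [koszulDifferential_single]
  refine Submodule.sum_mem _ fun f hf => Finsupp.single_mem_supported k _ ?_
  have hf' := (Finset.mem_filter.mp hf).2
  change ¬ (τ.deg = f.mid.deg + d)
  unfold HasDegree at ht hf'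
  omega

/-- Every term of a boundary has absorbed a morphism of degree one into its second factor, which
therefore has positive degree. -/
theorem koszulDifferential_apply_eq_zero (x : TwoStep τ σ →₀ k) {t : TwoStep τ σ}
    (ht : t.2.mid.deg = σ.deg) : koszulDifferential k τ σ x t = 0 := by
  classical
  suffices h : Finsupp.lapply t ∘ₗ koszulDifferential k τ σ = (0 : _ →ₗ[k] k) from
    LinearMap.congr_fun h x
  refine Finsupp.lhom_ext' fun s => LinearMap.ext_ring ?_
  rw [LinearMap.comp_apply, LinearMap.comp_apply, Finsupp.lsingle_apply,
    koszulDifferential_single, map_sum]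
  refine Finset.sum_eq_zero fun f hf => ?_
  refine Finsupp.single_eq_of_ne fun he => ?_
  have hf' := (Finset.mem_filter.mp hf).2
  have h1 : f.mid.deg = σ.deg := by rw [← ht, he]; rfl
  have h2 := deg_le s.2.π
  unfold HasDegree at hf'
  omega

theorem trivial_injective :
    Function.Injective (TwoStep.trivial : (τ ⟶ σ) → TwoStep τ σ) :=
  fun _ _ h => congrArg Sigma.fst h

theorem koszulToBar_succ {d : ℕ} (y : {u : τ ⟶ σ // HasDegree u (d + 1)} →₀ k) :
    koszulToBar k τ σ (d + 1) y = twoStepToBar k d τ σ (koszulDifferential k τ σ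
      (Finsupp.lmapDomain k k (fun u => TwoStep.trivial u.1) y)) := by
  suffices h : koszulToBar k τ σ (d + 1) = twoStepToBar k d τ σ ∘ₗ koszulDifferential k τ σ ∘ₗ
      Finsupp.lmapDomain k k (fun u : {u : τ ⟶ σ // HasDegree u (d + 1)} => TwoStep.trivial u.1)
    from LinearMap.congr_fun h y
  refine Finsupp.lhom_ext' fun u => LinearMap.ext_ring ?_
  simp only [LinearMap.comp_apply, Finsupp.lsingle_apply, Finsupp.lmapDomain_apply,
    Finsupp.mapDomain_single]
  rw [twoStepToBar_koszulDifferential_trivial, koszulToBar_single, one_smul]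

theorem barDifferential_koszulToBar {d : ℕ} (y : {u : τ ⟶ σ // HasDegree u (d + 1)} →₀ k) :
    barDifferential k τ σ d (koszulToBar k τ σ (d + 1) y) = 0 := by
  suffices h : barDifferential k τ σ d ∘ₗ koszulToBar k τ σ (d + 1) = 0 from
    LinearMap.congr_fun h y
  refine Finsupp.lhom_ext' fun u => LinearMap.ext_ring ?_
  simp only [LinearMap.comp_apply, Finsupp.lsingle_apply]
  rw [koszulToBar_single, one_smul, barDifferential_decompositions, LinearMap.zero_apply]

theorem decompositions_zero (τ : PrunedTree n) :
    decompositions k 0 (𝟙 τ) = Finsupp.single (BarChain.nil τ) 1 := by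
  classical
  have hs : ∀ c : BarChain 0 τ τ, c = BarChain.nil τ := by rintro ⟨⟩; rfl
  rw [decompositions, Finset.sum_eq_single (BarChain.nil τ)]
  · simp [BarChain.sgn]
  · exact fun c _ hc => absurd (hs c) hc
  · intro h
    simp [BarChain.AllDegreeOne, BarChain.comp] at h

theorem eq_id_of_hasDegree_zero {u : τ ⟶ τ} (h : HasDegree u 0) : u = 𝟙 τ := by
  obtain ⟨_, hu⟩ := (isIdentity_iff u).mpr h
  rw [hu]
  rfl

theorem koszulToBar_zero_single (r : k) (h : HasDegree (𝟙 τ) 0) :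
    koszulToBar k τ τ 0 (Finsupp.single ⟨𝟙 τ, h⟩ r) = Finsupp.single (BarChain.nil τ) r := by
  rw [koszulToBar_single, decompositions_zero, Finsupp.smul_single_one]

/-- By induction the comparison map on pairs is injective, so the pairs formed from `y` and
identities give a Koszul cycle. By exactness it is a boundary, and boundaries have no coordinates at
pairs ending in an identity. -/
theorem eq_zero_of_koszulToBar_eq_zero (d : ℕ) : ∀ (σ : PrunedTree n)
    (y : {u : τ ⟶ σ // HasDegree u d} →₀ k), koszulToBar k τ σ d y = 0 → y = 0 := by
  induction d with
  | zero =>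
    intro σ y hy
    ext ⟨u, hu⟩
    obtain ⟨rfl, -⟩ := (isIdentity_iff u).mpr hu
    obtain rfl := eq_id_of_hasDegree_zero hu
    have hs : y = Finsupp.single ⟨𝟙 τ, hu⟩ (y ⟨𝟙 τ, hu⟩) := by
      ext ⟨v, hv⟩
      obtain rfl := eq_id_of_hasDegree_zero hv
      rw [Finsupp.single_eq_same]
    rw [hs, koszulToBar_zero_single, Finsupp.single_eq_zero] at hy
    rw [hy, Finsupp.zero_apply]
  | succ d ih =>
    intro σ y hy
    ext ⟨u, hu⟩
    have hlt : σ.deg < τ.deg := by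
      unfold HasDegree at hu
      omega
    rw [koszulToBar_succ] at hy
    have hmem : koszulDifferential k τ σ
        (Finsupp.lmapDomain k k (fun u => TwoStep.trivial u.1) y) ∈
        Finsupp.supported k k {s : TwoStep τ σ | ¬ IsIdentity s.2.π ∧ HasDegree s.2.ι d} := by
      refine map_mem_of_mem_supported k (s := Set.univ)
        (f := koszulDifferential k τ σ ∘ₗ Finsupp.lmapDomain k k
          (fun u : {u : τ ⟶ σ // HasDegree u (d + 1)} => TwoStep.trivial u.1))
        (fun v _ => ?_) (by simp)
      rw [LinearMap.comp_apply, Finsupp.lmapDomain_apply, Finsupp.mapDomain_single]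
      exact koszulDifferential_single_mem_of_hasDegree k v.2
    obtain ⟨z, hz⟩ := koszulDifferential_exact k hlt _
      (eq_zero_of_twoStepToBar_eq_zero k ih hmem hy)
    have h0 := koszulDifferential_apply_eq_zero k z (t := TwoStep.trivial u) rfl
    rw [hz, Finsupp.lmapDomain_apply] at h0
    rw [Finsupp.zero_apply, ← h0]
    exact (Finsupp.mapDomain_apply (fun a b h => Subtype.ext (trivial_injective h)) y
      (⟨u, hu⟩ : {u : τ ⟶ σ // HasDegree u (d + 1)})).symm

/-! ### Exactness -/

/-- `x` is a cycle of the bar construction. -/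
def IsCycle : ∀ {d : ℕ} {τ σ : PrunedTree n}, (BarChain d τ σ →₀ k) → Prop
  | 0, _, _, _ => True
  | d + 1, τ, σ, x => barDifferential k τ σ d x = 0

theorem subsingleton_chain {d : ℕ} (h : ¬ σ.deg + d ≤ τ.deg) :
    Subsingleton (BarChain d τ σ →₀ k) := by
  have : IsEmpty (BarChain d τ σ) := ⟨fun c => h c.deg_add_le⟩
  infer_instance

/-- The components are corrected in the order of increasing degree `t` of the source of the first
morphism. The lowest nonzero component of a cycle is itself a cycle, to which the induction
hypothesis `hd` applies; `m` only bounds the number of steps. -/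
theorem exists_components_eq_koszulToBar {d : ℕ}
    (hd : ∀ (θ : PrunedTree n) (x : BarChain d τ θ →₀ k), IsCycle k x →
      ∃ z y, x = barDifferential k τ θ d z + koszulToBar k τ θ d y) (m : ℕ) :
    ∀ (t : ℕ), τ.deg + 1 ≤ t + m → ∀ x : BarChain (d + 1) τ σ →₀ k,
      barDifferential k τ σ d x = 0 →
      (∀ a : Outer τ σ, a.1.1.deg < t → component k a x = 0) →
      ∃ z, ∀ a : Outer τ σ, ∃ y,
        component k a (x - barDifferential k τ σ (d + 1) z) = koszulToBar k τ a.1.1 d y := by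
  induction m with
  | zero =>
    intro t ht x _ hx
    refine ⟨0, fun a => ⟨0, ?_⟩⟩
    have : a.1.1.deg ≤ τ.deg := Finset.sum_le_sum fun i _ => a.1.2 i.castSucc
    rw [map_zero, map_zero, sub_zero, hx a (by omega)]
  | succ m ih =>
    intro t ht x hcyc hx
    have hcomp : ∀ a : Outer τ σ, ∃ e y, a.1.1.deg = t →
        component k a x = barDifferential k τ a.1.1 d e + koszulToBar k τ a.1.1 d y := by
      intro a
      by_cases ha : a.1.1.deg = t
      · have hc : IsCycle k (component k a x) := by
          cases d with
          | zero => exact True.intro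
          | succ d =>
            have := component_barDifferential k x a fun b hb => hx b (ha ▸ hb)
            rw [hcyc, map_zero] at this
            exact neg_eq_zero.mp this.symm
        obtain ⟨e, y, h⟩ := hd _ _ hc
        exact ⟨e, y, fun _ => h⟩
      · exact ⟨0, 0, fun h => absurd h ha⟩
    choose e y hey using hcomp
    -- The sign compensates for the minus sign with which the boundary acts on components.
    let e' : ∀ a : Outer τ σ, BarChain (d + 1) τ a.1.1 →₀ k := fun a =>
      if a.1.1.deg = t then -e a else 0
    let z := ∑ a : Outer τ σ, consMap k a.2.1 (e' a)
    have hz : ∀ a, component k a z = e' a := fun a => component_sum_consMap k _ a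
    have hdz : ∀ a : Outer τ σ, a.1.1.deg ≤ t → component k a (barDifferential k τ σ (d + 1) z) =
        -barDifferential k τ a.1.1 d (e' a) := fun a ha => by
      rw [component_barDifferential, hz]
      intro b hb
      rw [hz]
      exact if_neg (by omega)
    have hlow : ∀ a : Outer τ σ, a.1.1.deg < t →
        component k a (x + barDifferential k τ σ (d + 1) (-z)) = 0 := fun a ha => by
      rw [map_neg, map_add, map_neg, hdz a ha.le, hx a ha, show e' a = 0 from if_neg ha.ne,
        map_zero, neg_zero, neg_zero, add_zero]
    have heq : ∀ a : Outer τ σ, a.1.1.deg = t →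
        component k a (x - barDifferential k τ σ (d + 1) z) = koszulToBar k τ a.1.1 d (y a) :=
      fun a ha => by
      rw [map_sub, hdz a ha.le, hey a ha, show e' a = -e a from if_pos ha, map_neg, neg_neg]
      abel
    have hlow' : ∀ a : Outer τ σ, a.1.1.deg < t →
        component k a (x - barDifferential k τ σ (d + 1) z) = 0 := fun a ha => by
      rw [sub_eq_add_neg, ← map_neg]
      exact hlow a ha
    -- Only at `t = τ.deg - d` can a Koszul term survive: beyond it there are no tuples of length
    -- `d` left, and before it there are no morphisms of degree `d`, so the component vanishes and
    -- the process goes on.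
    by_cases htd : τ.deg = t + d
    · refine ⟨z, fun a => ?_⟩
      rcases lt_trichotomy a.1.1.deg t with ha | ha | ha
      · exact ⟨0, by rw [hlow' a ha, map_zero]⟩
      · exact ⟨y a, heq a ha⟩
      · have := subsingleton_chain k (d := d) (τ := τ) (σ := a.1.1) (by omega)
        exact ⟨0, Subsingleton.elim _ _⟩
    · obtain ⟨z', hz'⟩ := ih (t + 1) (by omega) (x - barDifferential k τ σ (d + 1) z) (by
        rw [map_sub, hcyc, ← LinearMap.comp_apply, barDifferential_comp, LinearMap.zero_apply,
          sub_zero]) (fun a ha => by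
        rcases Nat.lt_succ_iff_lt_or_eq.mp ha with ha | ha
        · exact hlow' a ha
        · have : IsEmpty {β : τ ⟶ a.1.1 // HasDegree β d} :=
            ⟨fun β => htd (by rw [← ha]; exact β.2)⟩
          rw [heq a ha, Subsingleton.elim (y a) 0, map_zero])
      refine ⟨z + z', fun a => ?_⟩
      rw [map_add, ← sub_sub]
      exact hz' a

/-- The components assemble to a chain `Y` of pairs lying over `x`. Injectivity makes `Y` a Koszul
cycle, and exactness writes it as a boundary. Pairs with a non-identity second factor then
contribute a bar boundary, the remaining ones an element of the image of `ι`. -/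
theorem exists_eq_of_components {d : ℕ} (x : BarChain (d + 1) τ σ →₀ k)
    (hx : barDifferential k τ σ d x = 0)
    (hc : ∀ a : Outer τ σ, ∃ y, component k a x = koszulToBar k τ a.1.1 d y) :
    ∃ z y, x = barDifferential k τ σ (d + 1) z + koszulToBar k τ σ (d + 1) y := by
  classical
  by_cases hlt : σ.deg < τ.deg
  swap
  · have := subsingleton_chain k (d := d + 1) (τ := τ) (σ := σ) (by omega)
    exact ⟨0, 0, Subsingleton.elim _ _⟩
  choose y hy using hc
  set Y : TwoStep τ σ →₀ k := ∑ a, Finsupp.lmapDomain k k a.toTwoStep (y a) with hYdef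
  have hxY : twoStepToBar k d τ σ Y = x := by
    refine component_ext k fun a => ?_
    rw [hYdef, map_sum]
    simp only [twoStepToBar_lmapDomain]
    rw [component_sum_consMap k (fun a : Outer τ σ => koszulToBar k τ a.1.1 d (y a)), hy]
  have hY : Y ∈ Finsupp.supported k k {t | ¬ IsIdentity t.2.π ∧ HasDegree t.2.ι d} := by
    refine Submodule.sum_mem _ fun a _ => ?_
    refine map_mem_of_mem_supported k (s := Set.univ)
      (f := Finsupp.lmapDomain k k a.toTwoStep) (fun β _ => ?_) (by simp)
    rw [Finsupp.lmapDomain_apply, Finsupp.mapDomain_single]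
    exact Finsupp.single_mem_supported k _ ⟨a.2.2, β.2⟩
  have hDY : koszulDifferential k τ σ Y = 0 := by
    cases d with
    | zero =>
      refine eq_of_mem_supported k (g := 0) (fun t ht => ?_) hY
      rw [koszulDifferential_single, LinearMap.zero_apply]
      refine Finset.sum_eq_zero fun f hf => ?_
      have h1 := (Finset.mem_filter.mp hf).2
      have h2 := ht.2
      have h3 := deg_le f.ι
      unfold HasDegree at h1 h2
      omega
    | succ d =>
      refine eq_zero_of_twoStepToBar_eq_zero k (eq_zero_of_koszulToBar_eq_zero k d)
        (map_mem_of_mem_supported k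
          (fun t ht => koszulDifferential_single_mem_of_hasDegree k ht.2) hY) ?_
      rw [← hxY, barDifferential_twoStepToBar k d
        (Finsupp.supported_mono (fun t ht => ht.1) hY)] at hx
      exact neg_eq_zero.mp hx
  obtain ⟨z, hz⟩ := koszulDifferential_exact k hlt Y hDY
  -- The Koszul differential lowers the degree of the first factor by one, so only the part of `z`
  -- in degree `d + 1` contributes to `Y`.
  let p : TwoStep τ σ → Prop := fun t => HasDegree t.2.ι (d + 1)
  have hsplit := Finsupp.filter_add_filter_not z p
  have hz1 : z.filter p ∈ Finsupp.supported k k {t | p t} := by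
    intro t ht
    exact (Finset.mem_filter.mp ht).2
  have hz2 : z.filter (fun t => ¬ p t) ∈ Finsupp.supported k k {t | ¬ p t} := by
    intro t ht
    exact (Finset.mem_filter.mp ht).2
  have hDz1 : koszulDifferential k τ σ (z.filter p) ∈
      Finsupp.supported k k {t : TwoStep τ σ | HasDegree t.2.ι d} :=
    Finsupp.supported_mono (fun t ht => ht.2) (map_mem_of_mem_supported k
      (fun t ht => koszulDifferential_single_mem_of_hasDegree k ht) hz1)
  have hDz2 : koszulDifferential k τ σ (z.filter fun t => ¬ p t) ∈
      Finsupp.supported k k {t : TwoStep τ σ | ¬ HasDegree t.2.ι d} :=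
    map_mem_of_mem_supported k
      (fun t ht => koszulDifferential_single_mem_of_not_hasDegree k ht) hz2
  have hDz : koszulDifferential k τ σ (z.filter p) = Y := by
    ext t
    rw [← hz, ← hsplit, map_add, Finsupp.add_apply, hsplit]
    by_cases ht : HasDegree t.2.ι d
    · rw [(Finsupp.mem_supported' k _).mp hDz2 t fun h => h ht, add_zero]
    · have h1 := (Finsupp.mem_supported' k _).mp hDz1 t ht
      have h2 := (Finsupp.mem_supported' k _).mp hY t fun h => ht h.2
      rw [h1, zero_add]
      rw [← hz, ← hsplit, map_add, Finsupp.add_apply, h1, zero_add] at h2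
      exact h2.symm
  let q : TwoStep τ σ → Prop := fun t => ¬ IsIdentity t.2.π
  set z₁ := (z.filter p).filter q with hz₁
  set z₂ := (z.filter p).filter (fun t => ¬ q t) with hz₂
  have hz12 : z₁ + z₂ = z.filter p := Finsupp.filter_add_filter_not _ q
  have hz₁mem : z₁ ∈ Finsupp.supported k k {t : TwoStep τ σ | ¬ IsIdentity t.2.π} := by
    intro t ht
    exact (Finset.mem_filter.mp ht).2
  have hz₂mem : z₂ ∈ Finsupp.supported k k {t | IsIdentity t.2.π ∧ HasDegree t.2.ι (d + 1)} := by
    intro t ht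
    have ht' := Finset.mem_filter.mp ht
    exact ⟨not_not.mp ht'.2, (Finset.mem_filter.mp ht'.1).2⟩
  have hz₂range : z₂ ∈ LinearMap.range (Finsupp.lmapDomain k k
      (fun u : {u : τ ⟶ σ // HasDegree u (d + 1)} => TwoStep.trivial u.1)) := by
    refine map_mem_of_mem_supported k (f := LinearMap.id) ?_ hz₂mem
    rintro ⟨u, θ, β, α, h⟩ ⟨⟨h1, h1'⟩, h2⟩
    dsimp only at h1 h1' h2
    subst h1
    subst h1'
    obtain rfl : β = u := by rw [← h]; exact (Category.comp_id β).symm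
    refine ⟨Finsupp.single ⟨β, h2⟩ 1, ?_⟩
    rw [Finsupp.lmapDomain_apply, Finsupp.mapDomain_single]
    rfl
  obtain ⟨y₂, hy₂⟩ := hz₂range
  refine ⟨-twoStepToBar k (d + 1) τ σ z₁, y₂, ?_⟩
  rw [map_neg, barDifferential_twoStepToBar k d hz₁mem, neg_neg, koszulToBar_succ, hy₂, ← map_add,
    ← map_add, hz12, hDz, hxY]

theorem exists_eq_of_isCycle (d : ℕ) : ∀ (σ : PrunedTree n) (x : BarChain d τ σ →₀ k),
    IsCycle k x → ∃ z y, x = barDifferential k τ σ d z + koszulToBar k τ σ d y := by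
  induction d with
  | zero =>
    intro σ x _
    refine ⟨0, ?_⟩
    rw [map_zero]
    by_cases h : τ = σ
    · subst h
      have h0 : HasDegree (𝟙 τ) 0 := rfl
      refine ⟨Finsupp.single ⟨𝟙 τ, h0⟩ (x (BarChain.nil τ)), ?_⟩
      rw [koszulToBar_zero_single, zero_add]
      ext c
      cases c
      rw [Finsupp.single_eq_same]
    · have : IsEmpty (BarChain 0 τ σ) := ⟨by rintro ⟨⟩; exact h rfl⟩
      exact ⟨0, Subsingleton.elim _ _⟩
  | succ d ih =>
    intro σ x hx
    obtain ⟨z, hz⟩ := exists_components_eq_koszulToBar k ih (τ.deg + 1) 0 (by omega) x hx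
      fun a ha => absurd ha (Nat.not_lt_zero _)
    obtain ⟨z', y, h⟩ := exists_eq_of_components k _ (by
      rw [map_sub, show barDifferential k τ σ d x = 0 from hx, ← LinearMap.comp_apply,
        barDifferential_comp, LinearMap.zero_apply, sub_zero]) hz
    refine ⟨z + z', y, ?_⟩
    rw [map_add, add_assoc, ← h]
    abel

end Bar

/-! ### The quasi-isomorphism and the homology of the bar construction -/

section QuasiIsomorphism

variable (k : Type w) [CommRing k] (τ σ : PrunedTree n)

theorem barComplex_d (d : ℕ) :
    (barComplex k τ σ).d (d + 1) d = ModuleCat.ofHom (barDifferential k τ σ d) :=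
  ChainComplex.of_d (fun d => ModuleCat.of k (BarChain d τ σ →₀ k))
    (fun d => ModuleCat.ofHom (barDifferential k τ σ d)) d

theorem koszulComplex_d (i j : ℕ) : (koszulComplex k τ σ).d i j = 0 := by
  by_cases h : i = j + 1
  · subst h
    exact ChainComplex.of_d (fun d => ModuleCat.of k ({u : τ ⟶ σ // HasDegree u d} →₀ k))
      (fun _ => 0) j
  · exact (koszulComplex k τ σ).shape _ _ fun h' => h h'.symm

/-- The morphism `ι` from the Koszul construction to the bar construction. -/
noncomputable def koszulToBarHom : koszulComplex k τ σ ⟶ barComplex k τ σ where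
  f d := ModuleCat.ofHom (koszulToBar k τ σ d)
  comm' i j h := by
    obtain rfl : j + 1 = i := h
    rw [koszulComplex_d, barComplex_d]
    refine Eq.trans ?_ Limits.zero_comp.symm
    exact ModuleCat.hom_ext (LinearMap.ext fun y => barDifferential_koszulToBar k y)

theorem exists_of_barComplex_d_eq_zero (d : ℕ) (x : BarChain d τ σ →₀ k)
    (hx : (barComplex k τ σ).d d (d - 1) x = 0) :
    ∃ (z : BarChain (d + 1) τ σ →₀ k) (y : {u : τ ⟶ σ // HasDegree u d} →₀ k),
      x = barDifferential k τ σ d z + koszulToBar k τ σ d y := by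
  refine exists_eq_of_isCycle k d σ x ?_
  cases d with
  | zero => trivial
  | succ d =>
    rw [Nat.add_sub_cancel, barComplex_d] at hx
    exact hx

/-- If a morphism of degree `d` exists, then `d` is the top degree of the bar construction, so there
are no boundaries to divide out and `ι` is an isomorphism onto the cycles. Otherwise the Koszul side
is zero and every cycle is a boundary. -/
theorem quasiIsoAt_koszulToBarHom (d : ℕ) : QuasiIsoAt (koszulToBarHom k τ σ) d := by
  have hprev : (ComplexShape.down ℕ).prev d = d + 1 := by simp
  have hnext : (ComplexShape.down ℕ).next d = d - 1 := by
    cases d <;> simp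
  by_cases h : Nonempty {u : τ ⟶ σ // HasDegree u d}
  · obtain ⟨u, hu⟩ := h
    have hB : Subsingleton (BarChain (d + 1) τ σ →₀ k) :=
      subsingleton_chain k (by have : τ.deg = σ.deg + d := hu; omega)
    have hz : (barComplex k τ σ).d (d + 1) d = 0 := by
      rw [barComplex_d]
      exact ModuleCat.hom_ext (LinearMap.ext fun z => by
        rw [Subsingleton.elim (α := BarChain (d + 1) τ σ →₀ k) z 0, map_zero, map_zero])
    rw [quasiIsoAt_iff' _ _ _ _ hprev hnext, ShortComplex.quasiIso_iff_of_zeros _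
      (koszulComplex_d ..) (koszulComplex_d ..) hz]
    refine ⟨(ShortComplex.moduleCat_exact_iff _).2 fun x hx => ?_,
      (ModuleCat.mono_iff_injective _).2 ?_⟩
    · obtain ⟨z, y, h⟩ := exists_of_barComplex_d_eq_zero k τ σ d x hx
      refine ⟨y, ?_⟩
      rw [Subsingleton.elim z 0, map_zero, zero_add] at h
      exact h.symm
    · exact (injective_iff_map_eq_zero (koszulToBar k τ σ d)).2
        (eq_zero_of_koszulToBar_eq_zero k d σ)
  · rw [not_nonempty_iff] at h
    have hK : (koszulComplex k τ σ).ExactAt d := ShortComplex.exact_of_isZero_X₂ _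
      (ModuleCat.isZero_of_subsingleton
        (ModuleCat.of k ({u : τ ⟶ σ // HasDegree u d} →₀ k)))
    rw [quasiIsoAt_iff_exactAt _ _ hK, HomologicalComplex.exactAt_iff' _ _ _ _ hprev hnext]
    refine (ShortComplex.moduleCat_exact_iff _).2 fun x hx => ?_
    obtain ⟨z, y, h⟩ := exists_of_barComplex_d_eq_zero k τ σ d x hx
    refine ⟨z, ?_⟩
    rw [Subsingleton.elim y 0, map_zero, add_zero] at h
    rw [h]
    change (barComplex k τ σ).d (d + 1) d z = _
    rw [barComplex_d]
    rfl

/-- The differential of the Koszul construction vanishes, so its homology is free on the morphisms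
of the given degree. -/
noncomputable def koszulComplexHomologyIso (d : ℕ) : (koszulComplex k τ σ).homology d ≅
    ModuleCat.of k ({u : τ ⟶ σ // HasDegree u d} →₀ k) :=
  ((koszulComplex k τ σ).isoHomologyπ _ d rfl (koszulComplex_d ..)).symm ≪≫
    (koszulComplex k τ σ).iCyclesIso d _ rfl (koszulComplex_d ..)

end QuasiIsomorphism

end PrunedTree

theorem mainTheorem1 {k : Type w} [CommRing k] (n : ℕ) (τ σ : PrunedTree n) :
    (∃ ι : PrunedTree.koszulComplex k τ σ ⟶ PrunedTree.barComplex k τ σ,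
      (∀ d : ℕ, ι.f d = ModuleCat.ofHom (PrunedTree.koszulToBar k τ σ d)) ∧ QuasiIso ι) ∧
    ∀ d : ℕ, Nonempty ((PrunedTree.barComplex k τ σ).homology d ≅
      ModuleCat.of k ({u : τ ⟶ σ // PrunedTree.HasDegree u d} →₀ k)) := by
  have hι : QuasiIso (PrunedTree.koszulToBarHom k τ σ) :=
    ⟨PrunedTree.quasiIsoAt_koszulToBarHom k τ σ⟩
  exact ⟨⟨PrunedTree.koszulToBarHom k τ σ, fun _ => rfl, hι⟩, fun d =>
    ⟨(asIso (HomologicalComplex.homologyMap (PrunedTree.koszulToBarHom k τ σ) d)).symm ≪≫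
      PrunedTree.koszulComplexHomologyIso k τ σ d⟩⟩
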